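/- Let $m\ge 3$ and let $\mathbb{C}_m$ be the complex Clifford algebra generated by $e_1,\dots,e_m$ with $e_j^2=-1$ and $e_je_k+e_ke_j=0$ for $j\neq k$. Vectors $\underline{u}\in\mathbb{C}^m$ are identified with $\sum_j u_je_j\in\mathbb{C}_m$; put $\langle \underline{u},\underline{v}\rangle=\sum_j u_jv_j$ and $\underline{u}^\dagger=-\sum_j\overline{u_j}e_j$. Let $A_m=2\pi^{m/2}/\Gamma(m/2)$ be the area of the unit sphere $\mathbb{S}^{m-1}\subset\mathbb{R}^m$, and let $LB(0,1)$ be the Lie ball, i.e. the set of all $\underline{x}+i\underline{y}$ ($\underline{x},\underline{y}\in\mathbb{R}^m$) for which $\{\underline{u}\in\mathbb{R}^m : |\underline{u}-\underline{x}|=|\underline{y}|,\ \langle\underline{u}-\underline{x},\underline{y}\rangle=0\}$ is contained in the open unit ball of $\mathbb{R}^m$. For $\underline{\tau}=\underline{t}+i\underline{s}$ with $\underline{t},\underline{s}\in\mathbb{S}^{m-1}$, $\langle\underline{t},\underline{s}\rangle=0$, the polarized Hua–Radon transform of $f$ is $$\mathcal{R}^H_{\underline{\tau}}[f](\underline{z})=\int_{\mathbb{S}^{m-1}}\int_0^\pi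 L_{\underline{\tau}}(\underline{z},e^{-i\theta}\underline{\omega})\,f(e^{i\theta}\underline{\omega})\,d\theta\,dS(\underline{\omega}),\qquad \underline z\in LB(0,1),$$ $$L_{\underline{\tau}}(\underline{z},\underline{y})=\frac{1}{\pi A_m}\sum_{s=0}^\infty\sum_{k=0}^\infty\nu_{k,s}a^{k+s}b^s-\frac{1}{\pi A_m}\frac{\underline{\tau}^\dagger\underline{\tau}}{4}\sum_{s=0}^\infty\nu_{0,s}a^sb^s,\qquad \nu_{k,s}=(-1)^k\frac{\Gamma(k+2s+\frac m2)}{\Gamma(k+2s+1)\Gamma(\frac m2)},$$ where $a=\langle\underline{z},\underline{\tau}\rangle\langle\underline{y},\underline{\tau}^\dagger\rangle$ and $b=\langle\underline{z},\underline{\tau}^\dagger\rangle\langle\underline{y},\underline{\tau}\rangle$. The dual Radon transform is $$\tilde R[F(\underline{z},\underline{\tau})]=\frac{1}{A_mA_{m-1}}\int_{\mathbb{S}^{m-1}}\Big(\int_{\mathbb{S}^{m-2}}F(\underline{z},\underline{t}+i\underline{s})\,dS(\underline{s})\Big)dS(\underline{t}),$$ where $\mathbb{S}^{m-2}\subset\mathbb{S}^{m-1}$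 is the unit sphere orthogonal to $\underline{t}$. Let $t,n\in\mathbb{N}$ (zero included) with $t-2n\ge 0$, and let $M_{t-2n}$ be a complex spherical monogenic of degree $t-2n$: a $\mathbb{C}_m$-valued homogeneous polynomial of degree $t-2n$ on $\mathbb{C}^m$ with $\sum_j e_j\,\partial_{z_j}M_{t-2n}=0$. Then, for all $\underline{z}\in LB(0,1)$, the series and integrals below converge and $$\tilde R\big[\mathcal{R}^H_{\underline{\tau}}[\underline{z}^{2n}M_{t-2n}(\underline{z})]\big]=\rho_{t,2n}\,\underline{z}^{2n}M_{t-2n}(\underline{z}),$$ where $$\rho_{t,2n}=\begin{cases}\displaystyle\sum_{s=n}^{\ell}\nu_{2\ell-2s,s}\,\theta_{n,2\ell-s,s}-\tfrac14\nu_{0,\ell}\,\vartheta_{2n,\ell}&\text{if }t=2\ell\text{ is even},\\[2mm]\displaystyle\sum_{s=n}^{\ell}\nu_{2\ell+1-2s,s}\,\theta_{n,2\ell+1-s,s}&\text{if }t=2\ell+1\text{ is odd},\end{cases}$$ $$\theta_{n,k,\ell}=(-1)^{k+\ell}\frac{\Gamma(m-1)\Gamma(\frac m2+k-n-1)\Gamma(\frac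 m2+\ell-n-1)(m-2)}{4(\ell-n)!\,\Gamma(\frac m2+k+\ell-n)^2\,\Gamma(m+k+\ell-2n-2)}\Big(\frac{k!\,\ell!}{n!}\Big)^2\frac{(k+\ell-2n)!}{(k-n)!}\quad(n\le\min\{k,\ell\}),$$ and $\vartheta_{2n,\ell}=2\theta_{n,\ell,\ell}$. -/

import Mathlib

open MeasureTheory
open scoped TensorProduct

noncomputable section

namespace HuaRadon

/-- `x₁, …, x_m ↦ -(x₁² + … + x_m²)`, the quadratic form of the complex Clifford algebra. -/
def cliffordForm (m : ℕ) : QuadraticForm ℂ (Fin m → ℂ) :=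
  QuadraticMap.weightedSumSquares ℂ (fun _ => (-1 : ℂ))

/-- The complex Clifford algebra `ℂ_m`: `e_j² = -1` and `e_j e_k + e_k e_j = 0` for `j ≠ k`. -/
abbrev Cl (m : ℕ) : Type := CliffordAlgebra (cliffordForm m)

/-- The 1-vector `∑ j, u_j e_j`. -/
def vec {m : ℕ} (u : Fin m → ℂ) : Cl m := CliffordAlgebra.ι (cliffordForm m) u

/-- The generator `e_j`. -/
def e {m : ℕ} (j : Fin m) : Cl m := vec (Pi.single j 1)

theorem e_mul_self {m : ℕ} (j : Fin m) : e j * e j = (-1 : Cl m) := by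
  unfold e vec
  rw [CliffordAlgebra.ι_sq_scalar]
  have h : cliffordForm m (Pi.single j 1) = -1 := by
    simp [cliffordForm, QuadraticMap.weightedSumSquares_apply, Pi.single_apply]
  rw [h]
  simp

theorem e_mul_add_mul {m : ℕ} {j k : Fin m} (hjk : j ≠ k) : e j * e k + e k * e j = (0 : Cl m) := by
  unfold e vec
  rw [CliffordAlgebra.ι_mul_ι_add_swap]
  have h : QuadraticMap.polar (cliffordForm m) (Pi.single j 1) (Pi.single k 1) = 0 := by
    simp only [QuadraticMap.polar, cliffordForm, QuadraticMap.weightedSumSquares_apply,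
      ← Finset.sum_sub_distrib]
    refine Finset.sum_eq_zero fun i _ => ?_
    by_cases h1 : i = j
    · subst h1; simp [hjk]
    · simp [Pi.single_apply, h1]
  rw [h, map_zero]

/-! ### Clifford-valued polynomials and spherical monogenics -/

/-- `ℂ_m`-valued polynomials in the variables `z₁, …, z_m`. -/
abbrev CliffPoly (m : ℕ) : Type := MvPolynomial (Fin m) ℂ ⊗[ℂ] Cl m

/-- The value at `z` of a Clifford-valued polynomial. -/
def CliffPoly.eval {m : ℕ} (P : CliffPoly m) (z : Fin m → ℂ) : Cl m :=
  TensorProduct.lid ℂ (Cl m) ((MvPolynomial.aeval z).toLinearMap.rTensor (Cl m) P)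

/-- The complexified Dirac operator `∑ j, e_j ∂_{z_j}`, acting from the left. -/
def dirac (m : ℕ) : CliffPoly m →ₗ[ℂ] CliffPoly m :=
  ∑ j : Fin m, TensorProduct.map (MvPolynomial.pderiv (R := ℂ) j).toLinearMap
    (LinearMap.mulLeft ℂ (e j : Cl m))

/-- The Clifford-valued homogeneous polynomials of degree `k`. -/
def homogeneousPolys (m k : ℕ) : Submodule ℂ (CliffPoly m) :=
  LinearMap.range ((MvPolynomial.homogeneousSubmodule (Fin m) ℂ k).subtype.rTensor (Cl m))

/-- The space `M_k(ℂ^m)` of complex (left) spherical monogenics of degree `k`. -/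
def sphericalMonogenics (m k : ℕ) : Submodule ℂ (CliffPoly m) :=
  homogeneousPolys m k ⊓ LinearMap.ker (dirac m)

/-! ### Integration of Clifford-valued functions -/

/-- `I` is the integral of the `ℂ_m`-valued function `F`, all of whose coordinates are integrable
(`ℂ_m` is finite dimensional, so integration is coordinatewise). -/
def HasCliffIntegral {m : ℕ} {α : Type*} [MeasurableSpace α] (μ : Measure α) (F : α → Cl m)
    (I : Cl m) : Prop :=
  ∀ φ : Module.Dual ℂ (Cl m), Integrable (fun x => φ (F x)) μ ∧ ∫ x, φ (F x) ∂μ = φ I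

/-- The coordinates of `F` are integrable. -/
def CliffIntegrable {m : ℕ} {α : Type*} [MeasurableSpace α] (μ : Measure α) (F : α → Cl m) : Prop :=
  ∃ I : Cl m, HasCliffIntegral μ F I

theorem HasCliffIntegral.unique {m : ℕ} {α : Type*} [MeasurableSpace α] {μ : Measure α}
    {F : α → Cl m} {I J : Cl m} (hI : HasCliffIntegral μ F I) (hJ : HasCliffIntegral μ F J) :
    I = J := by
  rw [← sub_eq_zero, ← Module.forall_dual_apply_eq_zero_iff ℂ]
  intro φ
  rw [map_sub, ← (hI φ).2, ← (hJ φ).2, sub_self]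

open Classical in
/-- The integral of a Clifford-valued function (and `0` if it is not integrable). -/
def cliffIntegral {m : ℕ} {α : Type*} [MeasurableSpace α] (μ : Measure α) (F : α → Cl m) : Cl m :=
  if h : CliffIntegrable μ F then h.choose else 0

/-! ### Spheres, the Lie ball and the vectors `τ` -/

/-- The real Euclidean space `ℝ^m`. -/
abbrev E (m : ℕ) : Type := EuclideanSpace ℝ (Fin m)

/-- A real vector regarded as a complex vector. -/
def toC {m : ℕ} (x : E m) : Fin m → ℂ := fun j => (x j : ℂ)

/-- The surface measure of the unit sphere `S^{m-1}` of `ℝ^m`. -/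
def sphereMeasure (m : ℕ) : Measure (Metric.sphere (0 : E m) 1) :=
  (volume : Measure (E m)).toSphere

/-- The unit sphere `S^{m-2}` of the orthogonal complement of `t`. -/
abbrev perpSphere {m : ℕ} (t : E m) : Type := Metric.sphere (0 : ↥(ℝ ∙ t)ᗮ) 1

/-- The surface measure of the unit sphere `S^{m-2}` of the orthogonal complement of `t`. -/
def perpSphereMeasure {m : ℕ} (t : E m) : Measure (perpSphere t) :=
  (@volume ↥(ℝ ∙ t)ᗮ measureSpaceOfInnerProductSpace).toSphere

/-- The area `A_m` of the unit sphere of `ℝ^m`. -/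
def sphereArea (m : ℕ) : ℝ := 2 * Real.pi ^ ((m : ℝ) / 2) / Real.Gamma ((m : ℝ) / 2)

/-- The (open) Lie ball `LB(0,1)`: the `x + iy` such that the sphere
`{u | |u - x| = |y|, ⟨u - x, y⟩ = 0}` lies in the open unit ball. -/
def lieBall (m : ℕ) : Set (Fin m → ℂ) :=
  {z | ∃ x y : E m, z = toC x + Complex.I • toC y ∧
    {u : E m | ‖u - x‖ = ‖y‖ ∧ inner ℝ (u - x) y = 0} ⊆ Metric.ball 0 1}

/-- `τ = t + i s`. -/
def tau {m : ℕ} (t s : E m) : Fin m → ℂ := toC t + Complex.I • toC s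

/-- Hermitian conjugation on 1-vectors, `(∑ u_j e_j)† = -∑ conj(u_j) e_j`. In particular
`(t + i s)† = -t + i s` for real `t` and `s`. -/
def dagger {m : ℕ} (u : Fin m → ℂ) : Fin m → ℂ := fun j => -(starRingEnd ℂ) (u j)

/-- The pairs `(t, s)` of orthogonal real unit vectors. -/
def stiefel (m : ℕ) : Set (E m × E m) := {p | ‖p.1‖ = 1 ∧ ‖p.2‖ = 1 ∧ inner ℝ p.1 p.2 = 0}

/-! ### The polarized Hua-Radon transform -/

/-- `ν_{k,s}`. -/
def nu (m k s : ℕ) : ℝ :=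
  (-1) ^ k * Real.Gamma (k + 2 * s + (m : ℝ) / 2) /
    (Real.Gamma (k + 2 * s + 1) * Real.Gamma ((m : ℝ) / 2))

/-- `a = ⟨z, τ⟩⟨y, τ†⟩`. -/
def coefA {m : ℕ} (τ z y : Fin m → ℂ) : ℂ := (z ⬝ᵥ τ) * (y ⬝ᵥ dagger τ)

/-- `b = ⟨z, τ†⟩⟨y, τ⟩`. -/
def coefB {m : ℕ} (τ z y : Fin m → ℂ) : ℂ := (z ⬝ᵥ dagger τ) * (y ⬝ᵥ τ)

/-- The kernel `L_τ(z, y)` of the polarized Hua-Radon transform. -/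
def kernelL {m : ℕ} (τ z y : Fin m → ℂ) : Cl m :=
  ((1 / (Real.pi * sphereArea m) : ℝ) : ℂ) •
      ((∑' s : ℕ, ∑' k : ℕ, (nu m k s : ℂ) * coefA τ z y ^ (k + s) * coefB τ z y ^ s) •
        (1 : Cl m)) -
    ((1 / (Real.pi * sphereArea m) : ℝ) : ℂ) •
      ((∑' s : ℕ, (nu m 0 s : ℂ) * coefA τ z y ^ s * coefB τ z y ^ s) •
        ((1 / 4 : ℂ) • (vec (dagger τ) * vec τ)))

/-- The points `e^{iθ} ω` of the Lie sphere. -/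
def liePoint {m : ℕ} (θ : ℝ) (ω : E m) : Fin m → ℂ := Complex.exp (θ * Complex.I) • toC ω

/-- The integrand `L_τ(z, e^{-iθ} ω) f(e^{iθ} ω)`. -/
def polarizedIntegrand {m : ℕ} (τ : Fin m → ℂ) (f : (Fin m → ℂ) → Cl m) (z : Fin m → ℂ)
    (ω : E m) (θ : ℝ) : Cl m :=
  kernelL τ z (liePoint (-θ) ω) * f (liePoint θ ω)

/-- The measure `dθ` on `[0, π)`. -/
def thetaMeasure : Measure ℝ := volume.restrict (Set.Ico 0 Real.pi)

/-- The polarized Hua-Radon transform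
`R^H_τ[f](z) = ∫_{S^{m-1}} ∫_0^π L_τ(z, e^{-iθ} ω) f(e^{iθ} ω) dθ dS(ω)`. -/
def polarizedHuaRadon {m : ℕ} (τ : Fin m → ℂ) (f : (Fin m → ℂ) → Cl m) (z : Fin m → ℂ) : Cl m :=
  cliffIntegral (sphereMeasure m) fun ω =>
    cliffIntegral thetaMeasure fun θ => polarizedIntegrand τ f z ω θ

/-- All series and integrals in the definition of `R^H_τ[f](z)` converge (absolutely). -/
def PolarizedHuaRadonConverges {m : ℕ} (τ : Fin m → ℂ) (f : (Fin m → ℂ) → Cl m)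
    (z : Fin m → ℂ) : Prop :=
  (∀ (ω : E m) (θ : ℝ), ‖ω‖ = 1 →
    Summable (fun p : ℕ × ℕ => (nu m p.2 p.1 : ℂ) *
      coefA τ z (liePoint (-θ) ω) ^ (p.2 + p.1) * coefB τ z (liePoint (-θ) ω) ^ p.1) ∧
    Summable (fun s : ℕ => (nu m 0 s : ℂ) *
      coefA τ z (liePoint (-θ) ω) ^ s * coefB τ z (liePoint (-θ) ω) ^ s)) ∧
  (∀ ω : Metric.sphere (0 : E m) 1,
    CliffIntegrable thetaMeasure fun θ => polarizedIntegrand τ f z ω θ) ∧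
  CliffIntegrable (sphereMeasure m) fun ω =>
    cliffIntegral thetaMeasure fun θ => polarizedIntegrand τ f z ω θ

/-! ### The dual Radon transform -/

/-- The dual Radon transform
`R̃[F](z) = (A_m A_{m-1})⁻¹ ∫_{S^{m-1}} ∫_{S^{m-2}} F(z, t + i s) dS(s) dS(t)`. -/
def dualRadon {m : ℕ} (F : (Fin m → ℂ) → (Fin m → ℂ) → Cl m) (z : Fin m → ℂ) : Cl m :=
  ((1 / (sphereArea m * sphereArea (m - 1)) : ℝ) : ℂ) •
    cliffIntegral (sphereMeasure m) fun t =>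
      cliffIntegral (perpSphereMeasure (t : E m)) fun s => F z (tau (t : E m) (s.1 : E m))

/-- The integrals in the definition of `R̃[F](z)` converge. -/
def DualRadonConverges {m : ℕ} (F : (Fin m → ℂ) → (Fin m → ℂ) → Cl m) (z : Fin m → ℂ) : Prop :=
  (∀ t : Metric.sphere (0 : E m) 1,
    CliffIntegrable (perpSphereMeasure (t : E m)) fun s => F z (tau (t : E m) (s.1 : E m))) ∧
  CliffIntegrable (sphereMeasure m) fun t =>
    cliffIntegral (perpSphereMeasure (t : E m)) fun s => F z (tau (t : E m) (s.1 : E m))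

/-! ### The coefficients -/

/-- `θ_{n,k,ℓ}` (for `n ≤ min k ℓ`). -/
def theta (m n k l : ℕ) : ℝ :=
  (-1) ^ (k + l) *
    ((Real.Gamma ((m : ℝ) - 1) * Real.Gamma ((m : ℝ) / 2 + k - n - 1) *
        Real.Gamma ((m : ℝ) / 2 + l - n - 1) * ((m : ℝ) - 2)) /
      (4 * (l - n).factorial * Real.Gamma ((m : ℝ) / 2 + k + l - n) ^ 2 *
        Real.Gamma ((m : ℝ) + k + l - 2 * n - 2))) *
    (((k.factorial : ℝ) * l.factorial) / n.factorial) ^ 2 *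
    (((k + l - 2 * n).factorial : ℝ) / (k - n).factorial)

/-- `ϑ_{j,k}`: `ϑ_{2i,k} = 2 θ_{i,k,k}` and `ϑ_{2i+1,k} = -ϑ_{2i,k}`. -/
def vartheta (m j k : ℕ) : ℝ := (-1) ^ j * (2 * theta m (j / 2) k k)

/-- `ρ_{t,2n}`, written with `ℓ = ⌊t/2⌋`, so that `t = 2ℓ` or `t = 2ℓ + 1`. -/
def rho (m t n : ℕ) : ℝ :=
  let l := t / 2
  if Even t then
    (∑ s ∈ Finset.Icc n l, nu m (2 * l - 2 * s) s * theta m n (2 * l - s) s) -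
      1 / 4 * nu m 0 l * vartheta m (2 * n) l
  else
    ∑ s ∈ Finset.Icc n l, nu m (2 * l + 1 - 2 * s) s * theta m n (2 * l + 1 - s) s

end HuaRadon

end

/-! On the Lie sphere everything is homogeneous. The kernel term with indices (k, s) at e^{-iθ}ω is
e^{-i(k+2s)θ} times its value at ω, while f(e^{iθ}ω) = e^{itθ} f(ω). Integration over θ in [0, π)
kills the even nonzero frequency differences, and the antipodal map of the sphere kills the odd
ones, so only the terms with k + 2s = t survive. Hence the transform of f is a polynomial in (t, s),
a finite sum of the terms ν ⟨z,τ⟩^k ⟨z,τ†⟩^l times the sphere average of ⟨ω,τ†⟩^k ⟨ω,τ⟩^l f(ω), with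
k + l the degree of f (`polarizedHuaRadon_eq`). Convergence rests on |⟨z,τ⟩| < 1 and |⟨z,τ†⟩| < 1 in
the Lie ball, together with the subexponential growth of ν.

The Dirac operator squares to minus the Laplacian, so in a basis of the Clifford algebra the
components of a spherical monogenic are harmonics H of degree d (`exists_harmonic_decomposition`),
and scalar computations suffice. Averaging over orthonormal pairs and exchanging this with the
average over ω turns the problem into an integral operator whose kernel is a combination of ⟨z,z⟩^i
⟨z,w⟩^j ⟨w,w⟩^h. By Funk-Hecke such an operator sends H to a constant times ⟨z,z⟩^n H(z), the
constant depending on d, n, k, l only (`exists_stiefelAvg_eigenvalue`).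

The constant can therefore be read off from a zonal harmonic at its pole. The inner average comes
from Funk-Hecke applied to the vector τ + uτ†, whose square is -4u, by extracting a coefficient in u
(`sphAvg_null_pair`). What remains are moments of equal powers of ⟨z,τ⟩ and ⟨z,τ†⟩, and a
terminating hypergeometric sum that the Pfaff-Saalschütz formula evaluates to `theta`
(`zonal_sum_eq_theta`, `stiefelAvg_kernel`).

In the correction term, τ†τ = 2 + 2i st. The diagonal kernel is even in s, so the bivector part
averages to zero and only the scalar 2 contributes; with the factor 1/4 this gives ν θ / 2 = ν ϑ /
4.

All the analysis on spheres is concentrated in one identity, integration by parts for polynomials,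
axiomatised as `IsSphericalMean`. The Funk-Hecke formula and the recursions for both averages are
algebraic consequences of it. -/

noncomputable section
namespace HuaRadon

/-! ### Integration on spheres via Gaussian integrals. -/

section Polar

variable {V : Type*} [NormedAddCommGroup V] [InnerProductSpace ℝ V] [FiniteDimensional ℝ V]
  [MeasurableSpace V] [BorelSpace V]

/-- Integration in polar coordinates of a homogeneous function against a radial one. -/
theorem integral_homogeneous_mul_radial [Nontrivial V] (μ : Measure V) [μ.IsAddHaarMeasure]
    (q : V → ℂ) (D : ℕ) (hq : ∀ (r : ℝ) (x : V), 0 < r → q (r • x) = (r : ℂ) ^ D * q x)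
    (g : ℝ → ℂ) :
    ∫ x, q x * g ‖x‖ ∂μ = (∫ ω, q ω ∂μ.toSphere) *
      ∫ r in Set.Ioi (0 : ℝ), ((r : ℂ) ^ (Module.finrank ℝ V - 1 + D)) * g r := by
  have h1 : ∫ x, q x * g ‖x‖ ∂μ = ∫ x : ({0}ᶜ : Set V), q x * g ‖(x : V)‖ ∂(μ.comap (↑)) := by
    rw [integral_subtype_comap (measurableSet_singleton _).compl (fun x => q x * g ‖x‖),
      restrict_compl_singleton]
  have h2 := μ.measurePreserving_homeomorphUnitSphereProd.integral_comp
    (Homeomorph.measurableEmbedding _)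
    (fun p : Metric.sphere (0 : V) 1 × Set.Ioi (0 : ℝ) => q p.1 * ((p.2.1 : ℂ) ^ D * g p.2.1))
  have h3 : ∀ x : ({0}ᶜ : Set V), q x * g ‖(x : V)‖ =
      q ((homeomorphUnitSphereProd V x).1) * (((homeomorphUnitSphereProd V x).2.1 : ℂ) ^ D *
        g (homeomorphUnitSphereProd V x).2.1) := by
    intro x
    have hx : 0 < ‖(x : V)‖ := norm_pos_iff.2 x.2
    have := hq ‖(x : V)‖ ((homeomorphUnitSphereProd V x).1) hx
    rw [homeomorphUnitSphereProd_apply_fst_coe, smul_smul, mul_inv_cancel₀ hx.ne', one_smul]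
      at this
    rw [homeomorphUnitSphereProd_apply_snd_coe, this, homeomorphUnitSphereProd_apply_fst_coe]
    ring
  rw [h1, integral_congr_ae (Filter.Eventually.of_forall h3), h2,
    integral_prod_mul (fun ω : Metric.sphere (0 : V) 1 => q ω)
      (fun r : Set.Ioi (0 : ℝ) => ((r.1 : ℂ) ^ D * g r.1))]
  congr 1
  rw [Measure.volumeIoiPow, integral_withDensity_eq_integral_toReal_smul₀]
  · rw [← integral_subtype_comap measurableSet_Ioi
      (fun r : ℝ => ((r : ℂ) ^ (Module.finrank ℝ V - 1 + D)) * g r)]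
    congr 1
    ext r
    have hr : (0 : ℝ) < r.1 := r.2
    rw [ENNReal.toReal_ofReal (by positivity), Complex.real_smul]
    push_cast
    ring
  · fun_prop
  · exact Filter.Eventually.of_forall fun _ => ENNReal.ofReal_lt_top

/-- By homogeneity and compactness of the sphere, |q(x)| ≤ C‖x‖^D away from the origin, so the
integrand is dominated by a radial function. -/
theorem integrable_homogeneous_mul_radial [Nontrivial V] (μ : Measure V) [μ.IsAddHaarMeasure]
    (q : V → ℂ) (D : ℕ) (hq : ∀ (r : ℝ) (x : V), 0 < r → q (r • x) = (r : ℂ) ^ D * q x)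
    (hqc : Continuous q) (g : ℝ → ℂ)
    (hg : IntegrableOn (fun r : ℝ => ((r : ℂ) ^ (Module.finrank ℝ V - 1 + D)) * g r)
      (Set.Ioi 0)) (hgc : Continuous g) :
    Integrable (fun x => q x * g ‖x‖) μ := by
  have hb : ∃ C, ∀ ω : Metric.sphere (0 : V) 1, ‖q ω‖ ≤ C := by
    obtain ⟨C, hC⟩ := (isCompact_sphere (0 : V) 1).exists_bound_of_continuousOn
      hqc.continuousOn
    exact ⟨C, fun ω => hC ω ω.2⟩
  obtain ⟨C, hC⟩ := hb
  have hC0 : 0 ≤ |C| := abs_nonneg C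
  have key : Integrable (fun x : V => (|C| : ℝ) * (‖x‖ ^ D * ‖g ‖x‖‖)) μ := by
    refine Integrable.const_mul ?_ _
    refine (integrable_fun_norm_addHaar μ (f := fun r : ℝ => r ^ D * ‖g r‖)).2 ?_
    refine IntegrableOn.congr_fun (Integrable.norm hg) ?_ measurableSet_Ioi
    intro r hr
    have hr : (0 : ℝ) < r := hr
    simp only [norm_mul, norm_pow, Complex.norm_real, Real.norm_eq_abs, abs_of_pos hr, smul_eq_mul]
    ring
  refine key.mono' (by fun_prop) ?_
  have h0 : ∀ᵐ x ∂μ, x ≠ 0 := by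
    rw [ae_iff]; simp
  filter_upwards [h0] with x hx
  have hx : 0 < ‖x‖ := norm_pos_iff.2 hx
  have h := hq ‖x‖ (‖x‖⁻¹ • x) hx
  rw [smul_smul, mul_inv_cancel₀ hx.ne', one_smul] at h
  rw [h, norm_mul, norm_mul, norm_pow, Complex.norm_real, norm_norm]
  have h1 : ‖q (‖x‖⁻¹ • x)‖ ≤ |C| :=
    (hC ⟨‖x‖⁻¹ • x, by simp [norm_smul, hx.ne']⟩).trans (le_abs_self C)
  have : 0 ≤ ‖x‖ ^ D * ‖g ‖x‖‖ := by positivity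
  nlinarith [mul_le_mul_of_nonneg_right h1 this]

theorem integral_pow_mul_exp_neg_sq (N : ℕ) :
    IntegrableOn (fun r : ℝ => (r : ℂ) ^ N * (Real.exp (-r ^ 2) : ℂ)) (Set.Ioi 0) ∧
    ∫ r in Set.Ioi (0 : ℝ), (r : ℂ) ^ N * (Real.exp (-r ^ 2) : ℂ) =
      ((Real.Gamma (((N : ℝ) + 1) / 2) / 2 : ℝ) : ℂ) := by
  have h : (fun r : ℝ => (r : ℂ) ^ N * (Real.exp (-r ^ 2) : ℂ)) =
      fun r : ℝ => ((r ^ N * Real.exp (-r ^ 2) : ℝ) : ℂ) := by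
    ext r; push_cast; ring
  have hcongr : Set.EqOn (fun r : ℝ => r ^ (N : ℝ) * Real.exp (-r ^ (2 : ℝ)))
      (fun r : ℝ => r ^ N * Real.exp (-r ^ 2)) (Set.Ioi 0) := by
    intro r _
    simp only [Real.rpow_natCast, Real.rpow_two]
  rw [h]
  constructor
  · refine Integrable.ofReal (f := fun r : ℝ => r ^ N * Real.exp (-r ^ 2)) ?_
    have h1 := integrableOn_rpow_mul_exp_neg_rpow (p := 2) (s := (N : ℝ))
      (by have : (0 : ℝ) ≤ N := by positivity
          linarith) (by norm_num)
    exact h1.congr_fun hcongr measurableSet_Ioi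
  · rw [integral_complex_ofReal]
    congr 1
    rw [← setIntegral_congr_fun measurableSet_Ioi hcongr,
      integral_rpow_mul_exp_neg_rpow (by norm_num)
        (by have : (0 : ℝ) ≤ N := by positivity
            linarith)]
    ring

/-- Integration by parts on the unit sphere: for `q` homogeneous of degree `D` with derivative `q'`
in the direction `v`, `(dim V + D - 1) ∫ ⟨v, ω⟩ q = ∫ q'`. -/
theorem sphere_integration_by_parts [Nontrivial V] (μ : Measure V) [μ.IsAddHaarMeasure]
    (v : V) (q q' : V → ℂ) (D : ℕ)
    (hq : ∀ (r : ℝ) (x : V), 0 < r → q (r • x) = (r : ℂ) ^ (D + 1) * q x)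
    (hq' : ∀ (r : ℝ) (x : V), 0 < r → q' (r • x) = (r : ℂ) ^ D * q' x)
    (hqc : Continuous q) (hqc' : Continuous q') (hd : ∀ x, HasLineDerivAt ℝ q (q' x) x v) :
    ((Module.finrank ℝ V + D : ℕ) : ℂ) * ∫ ω, (inner ℝ v (ω : V) : ℂ) * q ω ∂μ.toSphere =
      ∫ ω, q' ω ∂μ.toSphere := by
  -- A Gaussian weight turns the identity on the sphere into integration by parts on the whole
  -- space, without boundary terms. Its derivative along v supplies the factor ⟨v, x⟩.
  set g : ℝ → ℂ := fun r => (Real.exp (-r ^ 2) : ℂ) with hg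
  have hgc : Continuous g := by fun_prop
  set p : V → ℂ := fun x => (inner ℝ v x : ℂ) * q x with hp
  have hpc : Continuous p := by fun_prop
  have hp' : ∀ (r : ℝ) (x : V), 0 < r → p (r • x) = (r : ℂ) ^ (D + 2) * p x := by
    intro r x hr
    simp only [hp, inner_smul_right, hq r x hr]
    push_cast; ring
  have I1 := integrable_homogeneous_mul_radial μ q (D + 1) hq hqc g
    (integral_pow_mul_exp_neg_sq _).1 hgc
  have I2 := integrable_homogeneous_mul_radial μ q' D hq' hqc' g
    (integral_pow_mul_exp_neg_sq _).1 hgc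
  have I3 := integrable_homogeneous_mul_radial μ p (D + 2) hp' hpc g
    (integral_pow_mul_exp_neg_sq _).1 hgc
  have hgd : ∀ x : V, HasLineDerivAt ℝ (fun x : V => g ‖x‖)
      (-2 * (inner ℝ v x : ℂ) * g ‖x‖) x v := by
    intro x
    have h1 : HasFDerivAt (fun x : V => ‖x‖ ^ 2) (2 • (innerSL ℝ x)) x :=
      (hasStrictFDerivAt_norm_sq x).hasFDerivAt
    have h2 := ((h1.neg).exp).hasLineDerivAt v
    have h3 := h2.ofReal_comp
    simp only [hg, HasLineDerivAt]
    convert! h3 using 1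
    simp [real_inner_comm]
    ring
  have ibp := integral_bilinear_hasLineDerivAt_right_eq_neg_left_of_integrable (μ := μ)
    (f := q) (f' := q') (g := fun x => g ‖x‖) (g' := fun x => -2 * (inner ℝ v x : ℂ) * g ‖x‖)
    (v := v) (B := ContinuousLinearMap.mul ℝ ℂ) (by simpa using I2)
    (by
      have : (fun x => q x * (-2 * (inner ℝ v x : ℂ) * g ‖x‖)) = fun x => -2 * (p x * g ‖x‖) := by
        ext x; simp only [hp]; ring
      simp only [ContinuousLinearMap.mul_apply', this]
      exact I3.const_mul _)
    (by simpa using I1) (fun x _ => hd x) (fun x _ => hgd x)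
  simp only [ContinuousLinearMap.mul_apply'] at ibp
  have h4 : ∫ x, q x * (-2 * (inner ℝ v x : ℂ) * g ‖x‖) ∂μ = -2 * ∫ x, p x * g ‖x‖ ∂μ := by
    rw [← integral_const_mul]
    congr 1; ext x; simp only [hp]; ring
  rw [h4, integral_homogeneous_mul_radial μ p (D + 2) hp', integral_homogeneous_mul_radial μ q' D hq']
    at ibp
  simp only [hg] at ibp
  rw [(integral_pow_mul_exp_neg_sq _).2, (integral_pow_mul_exp_neg_sq _).2] at ibp
  have hdim : 0 < Module.finrank ℝ V := Module.finrank_pos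
  obtain ⟨M, hM⟩ : ∃ M, Module.finrank ℝ V = M + 1 := ⟨_, (Nat.sub_add_cancel hdim).symm⟩
  rw [hM] at ibp ⊢
  -- The two radial moments have exponents differing by 2, so their ratio is half of dim V + D; this
  -- is the constant in the formula.
  have hG : Real.Gamma ((((M + 1 - 1 + (D + 2) : ℕ) : ℝ) + 1) / 2) =
      ((M + 1 + D : ℕ) : ℝ) / 2 * Real.Gamma ((((M + 1 - 1 + D : ℕ) : ℝ) + 1) / 2) := by
    have h5 : ((M + 1 + D : ℕ) : ℝ) / 2 = (((M + 1 - 1 + D : ℕ) : ℝ) + 1) / 2 := by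
      rw [Nat.add_sub_cancel]; push_cast; ring
    rw [h5, ← Real.Gamma_add_one (by positivity)]
    congr 1; simp only [Nat.add_sub_cancel]; push_cast; ring
  have hpos : Real.Gamma ((((M + 1 - 1 + D : ℕ) : ℝ) + 1) / 2) ≠ 0 :=
    (Real.Gamma_pos_of_pos (by positivity)).ne'
  rw [hG] at ibp
  have hposC : ((Real.Gamma ((((M + 1 - 1 + D : ℕ) : ℝ) + 1) / 2) : ℝ) : ℂ) ≠ 0 := by
    exact_mod_cast hpos
  set G := Real.Gamma ((((M + 1 - 1 + D : ℕ) : ℝ) + 1) / 2)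
  refine mul_right_cancel₀ hposC ?_
  simp only [hp] at ibp
  push_cast at ibp ⊢
  linear_combination (-2) * ibp

/-- The area of the unit sphere of a real inner product space. -/
theorem toSphere_real_univ_eq_sphereArea [Nontrivial V] :
    (@volume V measureSpaceOfInnerProductSpace).toSphere.real Set.univ =
      sphereArea (Module.finrank ℝ V) := by
  let _ := @measureSpaceOfInnerProductSpace V
  have hdim : 0 < Module.finrank ℝ V := Module.finrank_pos
  rw [Measure.toSphere_real_apply_univ, Measure.real, InnerProductSpace.volume_ball]
  rw [ENNReal.toReal_mul, ENNReal.toReal_pow, ENNReal.toReal_ofReal zero_le_one, one_pow, one_mul,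
    ENNReal.toReal_ofReal (by positivity), sphereArea]
  have h : Real.Gamma ((Module.finrank ℝ V : ℝ) / 2 + 1) =
      (Module.finrank ℝ V : ℝ) / 2 * Real.Gamma ((Module.finrank ℝ V : ℝ) / 2) :=
    Real.Gamma_add_one (by positivity)
  have h2 : √Real.pi ^ Module.finrank ℝ V = Real.pi ^ ((Module.finrank ℝ V : ℝ) / 2) := by
    rw [Real.sqrt_eq_rpow, ← Real.rpow_natCast, ← Real.rpow_mul Real.pi_pos.le]
    congr 1; ring
  have h3 : Real.Gamma ((Module.finrank ℝ V : ℝ) / 2) ≠ 0 :=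
    (Real.Gamma_pos_of_pos (by positivity)).ne'
  rw [h, h2]
  field_simp

open scoped Pointwise in
theorem toSphere_measurePreserving_neg (μ : Measure V) [μ.IsAddHaarMeasure] :
    MeasurePreserving (fun ω : Metric.sphere (0 : V) 1 => -ω) μ.toSphere μ.toSphere := by
  refine ⟨continuous_neg.measurable, ?_⟩
  ext s hs
  rw [Measure.map_apply continuous_neg.measurable hs, Measure.toSphere_apply' _ hs,
    Measure.toSphere_apply' _ (continuous_neg.measurable hs)]
  congr 1
  rw [← Measure.measure_neg μ (Set.Ioo (0 : ℝ) 1 • (Subtype.val '' s))]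
  congr 1
  ext x
  simp only [Set.mem_smul, Set.mem_image, Set.mem_preimage, Set.mem_neg]
  constructor
  · rintro ⟨r, hr, y, ⟨ω, hω, rfl⟩, rfl⟩
    exact ⟨r, hr, _, ⟨_, hω, rfl⟩, by simp⟩
  · rintro ⟨r, hr, y, ⟨ω, hω, rfl⟩, h⟩
    refine ⟨r, hr, _, ⟨-ω, by simpa using hω, rfl⟩, ?_⟩
    rw [← neg_neg x, ← h]; simp

theorem integral_toSphere_comp_neg (μ : Measure V) [μ.IsAddHaarMeasure]
    (g : Metric.sphere (0 : V) 1 → ℂ) :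
    ∫ ω, g (-ω) ∂μ.toSphere = ∫ ω, g ω ∂μ.toSphere :=
  (toSphere_measurePreserving_neg μ).integral_comp
    (Homeomorph.neg _).measurableEmbedding g

end Polar
-- Linear forms, directional derivatives and homogeneity.
section Polynomials

open MvPolynomial

variable {m : ℕ}

/-- The linear polynomial `⟨x, ·⟩`. -/
def lin (x : Fin m → ℂ) : MvPolynomial (Fin m) ℂ := ∑ j, C (x j) * X j

/-- The derivative in the direction `y`. -/
def dirD (y : Fin m → ℂ) : Derivation ℂ (MvPolynomial (Fin m) ℂ) (MvPolynomial (Fin m) ℂ) :=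
  mkDerivation ℂ fun j => C (y j)

theorem eval_lin (x w : Fin m → ℂ) : eval w (lin x) = x ⬝ᵥ w := by
  simp [lin, dotProduct]

theorem isHomogeneous_lin (x : Fin m → ℂ) : (lin x).IsHomogeneous 1 := by
  refine IsHomogeneous.sum _ _ _ fun j _ => ?_
  simpa using (isHomogeneous_C _ (x j)).mul (isHomogeneous_X ℂ j)

theorem lin_single (j : Fin m) : lin (Pi.single j 1) = X j := by
  rw [lin, Finset.sum_eq_single j] <;> simp +contextual

theorem lin_add_smul (a b : Fin m → ℂ) (c : ℂ) : lin (a + c • b) = lin a + C c * lin b := by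
  simp only [lin, Pi.add_apply, Pi.smul_apply, smul_eq_mul, map_add, map_mul, add_mul,
    Finset.sum_add_distrib, Finset.mul_sum, mul_assoc]

theorem dirD_lin (y x : Fin m → ℂ) : dirD y (lin x) = C (x ⬝ᵥ y) := by
  simp only [lin, map_sum, dotProduct]
  refine Finset.sum_congr rfl fun j _ => ?_
  rw [Derivation.leibniz, derivation_C, dirD, mkDerivation_X, smul_zero, add_zero, smul_eq_mul,
    map_mul]

theorem dirD_eq_sum (y : Fin m → ℂ) (q : MvPolynomial (Fin m) ℂ) :
    dirD y q = ∑ j, C (y j) * pderiv j q := by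
  induction q using MvPolynomial.induction_on with
  | C a => simp [dirD, derivation_C]
  | add p q hp hq => simp only [map_add, hp, hq, mul_add, Finset.sum_add_distrib]
  | mul_X p i hp =>
    simp only [Derivation.leibniz, hp, smul_eq_mul, mul_add, Finset.sum_add_distrib, Finset.mul_sum]
    congr 1
    · rw [dirD, mkDerivation_X, Finset.sum_eq_single i]
      · simp; ring
      · intro j _ hj; rw [pderiv_X_of_ne hj.symm]; simp
      · simp
    · exact Finset.sum_congr rfl fun j _ => by ring

theorem dirD_add_smul (a b : Fin m → ℂ) (c : ℂ) (q : MvPolynomial (Fin m) ℂ) :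
    dirD (a + c • b) q = dirD a q + C c * dirD b q := by
  simp only [dirD_eq_sum, Pi.add_apply, Pi.smul_apply, smul_eq_mul, map_add, map_mul, add_mul,
    Finset.sum_add_distrib, Finset.mul_sum, mul_assoc]

theorem isHomogeneous_dirD {y : Fin m → ℂ} {q : MvPolynomial (Fin m) ℂ} {D : ℕ}
    (hq : q.IsHomogeneous D) : (dirD y q).IsHomogeneous (D - 1) := by
  rw [dirD_eq_sum]
  refine IsHomogeneous.sum _ _ _ fun j _ => ?_
  simpa using (isHomogeneous_C _ (y j)).mul hq.pderiv

theorem eval_smul_of_isHomogeneous {σ : Type*} {q : MvPolynomial σ ℂ} {D : ℕ}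
    (hq : q.IsHomogeneous D) (r : ℂ) (x : σ → ℂ) : eval (r • x) q = r ^ D * eval x q := by
  rw [eval_eq, eval_eq, Finset.mul_sum]
  refine Finset.sum_congr rfl fun d hd => ?_
  have h := hq (mem_support_iff.1 hd)
  rw [Finsupp.weight_apply, Finsupp.sum] at h
  simp only [Pi.one_apply, smul_eq_mul, mul_one] at h
  simp only [Pi.smul_apply, smul_eq_mul, mul_pow, Finset.prod_mul_distrib, Finset.prod_pow_eq_pow_sum,
    h]
  ring

theorem toC_add_smul (a b : E m) (r : ℝ) : toC (a + r • b) = toC a + (r : ℂ) • toC b := by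
  ext j; simp [toC]

theorem toC_smul (r : ℝ) (a : E m) : toC (r • a) = (r : ℂ) • toC a := by
  ext j; simp [toC]

theorem toC_neg (a : E m) : toC (-a) = -toC a := by
  ext j; simp [toC]

theorem toC_dotProduct (a b : E m) : toC a ⬝ᵥ toC b = ((inner ℝ a b : ℝ) : ℂ) := by
  simp [toC, dotProduct, PiLp.inner_apply, mul_comm]

@[fun_prop]
theorem continuous_toC : Continuous (toC : E m → Fin m → ℂ) := by
  unfold toC; fun_prop

@[fun_prop]
theorem continuous_eval_toC (q : MvPolynomial (Fin m) ℂ) :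
    Continuous fun x : E m => eval (toC x) q :=
  (MvPolynomial.continuous_eval q).comp continuous_toC

theorem hasDerivAt_eval_line (q : MvPolynomial (Fin m) ℂ) (x v : Fin m → ℂ) :
    HasDerivAt (fun r : ℝ => eval (x + (r : ℂ) • v) q) (eval x (dirD v q)) 0 := by
  induction q using MvPolynomial.induction_on with
  | C a => simpa [dirD, derivation_C] using hasDerivAt_const (0 : ℝ) a
  | add p q hp hq => simp only [map_add]; exact hp.add hq
  | mul_X p i hp =>
    have hX : HasDerivAt (fun r : ℝ => x i + (r : ℂ) * v i) (v i) 0 := by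
      have := ((Complex.ofRealCLM.hasDerivAt (x := (0 : ℝ))).mul_const (v i)).const_add (x i)
      simpa using this
    have h := hp.mul hX
    simp only [Derivation.leibniz, dirD, mkDerivation_X, smul_eq_mul, map_mul, map_add, eval_X,
      eval_C, Pi.add_apply, Pi.smul_apply]
    convert! h using 1
    simp [dirD]
    ring

theorem hasLineDerivAt_eval (q : MvPolynomial (Fin m) ℂ) (x v : E m) :
    HasLineDerivAt ℝ (fun x : E m => eval (toC x) q) (eval (toC x) (dirD (toC v) q)) x v := by
  unfold HasLineDerivAt
  simpa only [toC_add_smul] using hasDerivAt_eval_line q (toC x) (toC v)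

end Polynomials

/-! ### Spherical means as functionals on polynomials. -/

section Averages

open MvPolynomial

variable {m : ℕ}

instance : IsFiniteMeasure (sphereMeasure m) := by
  unfold sphereMeasure; infer_instance

instance (t : E m) : IsFiniteMeasure (perpSphereMeasure t) := by
  unfold perpSphereMeasure; infer_instance

theorem sphereArea_pos {m : ℕ} (hm : 0 < m) : 0 < sphereArea m := by
  unfold sphereArea
  have := Real.Gamma_pos_of_pos (s := (m : ℝ) / 2) (by positivity)
  positivity

theorem integrable_sphere {g : E m → ℂ} (hg : Continuous g) :
    Integrable (fun ω : Metric.sphere (0 : E m) 1 => g ω) (sphereMeasure m) :=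
  (hg.comp continuous_subtype_val).integrable_of_hasCompactSupport
    (HasCompactSupport.of_compactSpace _)

theorem integrable_perpSphere (t : E m) {g : E m → ℂ} (hg : Continuous g) :
    Integrable (fun s : perpSphere t => g (s.1 : E m)) (perpSphereMeasure t) :=
  (hg.comp (continuous_subtype_val.comp continuous_subtype_val)).integrable_of_hasCompactSupport
    (HasCompactSupport.of_compactSpace _)

/-- The average of a polynomial over the unit sphere. -/
def sphAvg (m : ℕ) : MvPolynomial (Fin m) ℂ →ₗ[ℂ] ℂ where
  toFun p := ((sphereArea m : ℝ) : ℂ)⁻¹ *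
    ∫ ω : Metric.sphere (0 : E m) 1, eval (toC (ω : E m)) p ∂sphereMeasure m
  map_add' p q := by
    simp only [map_add]
    rw [integral_add (integrable_sphere (continuous_eval_toC p))
      (integrable_sphere (continuous_eval_toC q)), mul_add]
  map_smul' c p := by
    simp only [smul_eval, integral_const_mul, RingHom.id_apply, smul_eq_mul]
    ring

/-- The average of a polynomial over the unit sphere of `t⊥`. -/
def perpAvg (t : E m) : MvPolynomial (Fin m) ℂ →ₗ[ℂ] ℂ where
  toFun p := ((sphereArea (m - 1) : ℝ) : ℂ)⁻¹ *
    ∫ s : perpSphere t, eval (toC (s.1 : E m)) p ∂perpSphereMeasure t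
  map_add' p q := by
    simp only [map_add]
    rw [integral_add (integrable_perpSphere t (continuous_eval_toC p))
      (integrable_perpSphere t (continuous_eval_toC q)), mul_add]
  map_smul' c p := by
    simp only [smul_eval, integral_const_mul, RingHom.id_apply, smul_eq_mul]
    ring

theorem sphAvg_apply (p : MvPolynomial (Fin m) ℂ) : sphAvg m p = ((sphereArea m : ℝ) : ℂ)⁻¹ *
    ∫ ω : Metric.sphere (0 : E m) 1, eval (toC (ω : E m)) p ∂sphereMeasure m := rfl

theorem perpAvg_apply (t : E m) (p : MvPolynomial (Fin m) ℂ) :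
    perpAvg t p = ((sphereArea (m - 1) : ℝ) : ℂ)⁻¹ *
      ∫ s : perpSphere t, eval (toC (s.1 : E m)) p ∂perpSphereMeasure t := rfl

/-- A normalised functional on polynomials that satisfies the integration by parts formula of the
average over the unit sphere of an `N`-dimensional space, `B` being the orthogonal projection to
this space. -/
structure IsSphericalMean (N : ℕ) (B : (Fin m → ℂ) → (Fin m → ℂ))
    (Λ : MvPolynomial (Fin m) ℂ →ₗ[ℂ] ℂ) : Prop where
  one : Λ 1 = 1
  parts : ∀ (x : Fin m → ℂ) (D : ℕ) (q : MvPolynomial (Fin m) ℂ), q.IsHomogeneous D →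
    ((N : ℂ) + D - 1) * Λ (lin x * q) = Λ (dirD (B x) q)

/-- The real and imaginary parts of a complex vector. -/
theorem exists_toC_add_I_smul (x : Fin m → ℂ) : ∃ a b : E m, x = toC a + Complex.I • toC b :=
  ⟨WithLp.toLp 2 fun j => (x j).re, WithLp.toLp 2 fun j => (x j).im, by
    ext j
    simp only [toC, Pi.add_apply, Pi.smul_apply, smul_eq_mul]
    rw [mul_comm]; exact (Complex.re_add_im (x j)).symm⟩

/-- Both sides of the parts formula are complex linear in the direction, so real directions suffice;
those are the ones that integration by parts reaches. -/
theorem IsSphericalMean.of_real {N : ℕ} {B : (Fin m → ℂ) → (Fin m → ℂ)}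
    {Λ : MvPolynomial (Fin m) ℂ →ₗ[ℂ] ℂ} (one : Λ 1 = 1)
    (hB : ∀ (a b : Fin m → ℂ) (c : ℂ), B (a + c • b) = B a + c • B b)
    (parts : ∀ (x : E m) (D : ℕ) (q : MvPolynomial (Fin m) ℂ), q.IsHomogeneous D →
      ((N : ℂ) + D - 1) * Λ (lin (toC x) * q) = Λ (dirD (B (toC x)) q)) :
    IsSphericalMean N B Λ := by
  refine ⟨one, fun x D q hq => ?_⟩
  obtain ⟨a, b, rfl⟩ := exists_toC_add_I_smul x
  rw [lin_add_smul, hB, dirD_add_smul, add_mul, map_add, map_add, mul_assoc, ← smul_eq_C_mul,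
    ← smul_eq_C_mul, map_smul, map_smul, mul_add, parts a D q hq, ← parts b D q hq]
  simp only [smul_eq_mul]; ring

/-- The orthogonal projection to `t⊥`. -/
def perpProj (t : E m) (x : Fin m → ℂ) : Fin m → ℂ := x - (x ⬝ᵥ toC t) • toC t

/-- Integration by parts for polynomial functions on the unit sphere. -/
theorem polynomial_integration_by_parts {W : Type*} [NormedAddCommGroup W] [InnerProductSpace ℝ W]
    [FiniteDimensional ℝ W] [MeasurableSpace W] [BorelSpace W] [Nontrivial W]
    (μ : Measure W) [μ.IsAddHaarMeasure] (J : W →L[ℝ] E m) (v : E m) (w : W)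
    (hw : ∀ s : W, inner ℝ w s = inner ℝ v (J s)) (D : ℕ) (q : MvPolynomial (Fin m) ℂ)
    (hq : q.IsHomogeneous D) :
    ((Module.finrank ℝ W : ℂ) + D - 1) *
      ∫ s, eval (toC (J (s : W))) (lin (toC v) * q) ∂μ.toSphere =
      ∫ s, eval (toC (J (s : W))) (dirD (toC (J w)) q) ∂μ.toSphere := by
  have hval : ∀ s : W, eval (toC (J s)) (lin (toC v) * q) =
      (inner ℝ w s : ℂ) * eval (toC (J s)) q := by
    intro s
    rw [map_mul, eval_lin, toC_dotProduct, hw]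
  have hc : ∀ p : MvPolynomial (Fin m) ℂ, Continuous fun s : W => eval (toC (J s)) p :=
    fun p => (continuous_eval_toC p).comp J.continuous
  simp only [hval]
  -- For constant q the general formula would need a derivative of degree -1. Here the left
  -- integrand is odd and the derivative is zero, so both sides vanish.
  rcases D with _ | D
  · obtain ⟨c, rfl⟩ : ∃ c, q = C c := ⟨_, totalDegree_eq_zero_iff_eq_C.1
      (Nat.le_zero.1 hq.totalDegree_le)⟩
    have h := integral_toSphere_comp_neg μ
      (fun s => (inner ℝ w (s : W) : ℂ) * eval (toC (J (s : W))) (C c))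
    have h0 : ∫ s, (inner ℝ w ((s : Metric.sphere (0 : W) 1) : W) : ℂ) *
        eval (toC (J (s : W))) (C c) ∂μ.toSphere = 0 := by
      refine self_eq_neg.1 (h.symm.trans ?_)
      rw [← integral_neg]
      congr 1; ext s
      rw [show ((-s : Metric.sphere (0 : W) 1) : W) = -(s : W) from rfl, inner_neg_right]
      simp
    rw [h0]
    simp [dirD, derivation_C]
  · have := sphere_integration_by_parts μ w (fun s : W => eval (toC (J s)) q)
      (fun s : W => eval (toC (J s)) (dirD (toC (J w)) q)) D
      (fun r x _ => by
        simp only [map_smul, toC_smul]; exact eval_smul_of_isHomogeneous hq _ _)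
      (fun r x _ => by
        simp only [map_smul, toC_smul]
        exact eval_smul_of_isHomogeneous (isHomogeneous_dirD hq) _ _)
      (hc _) (hc _)
      (fun x => by
        have := hasLineDerivAt_eval q (J x) (J w)
        simpa only [HasLineDerivAt, map_add, map_smul] using this)
    rw [← this]
    congr 1
    push_cast; ring

theorem isSphericalMean_sphAvg (hm : 3 ≤ m) : IsSphericalMean m id (sphAvg m) := by
  have : Nontrivial (E m) := by
    have : Nonempty (Fin m) := ⟨⟨0, by omega⟩⟩
    infer_instance
  have hA : ((sphereArea m : ℝ) : ℂ) ≠ 0 := by exact_mod_cast (sphereArea_pos (by omega)).ne'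
  refine .of_real ?_ (fun _ _ _ => rfl) fun v D q hq => ?_
  · have h := toSphere_real_univ_eq_sphereArea (V := E m)
    rw [finrank_euclideanSpace_fin] at h
    rw [sphAvg_apply]
    simp only [map_one, integral_const, mul_one, Complex.real_smul]
    rw [show (sphereMeasure m).real Set.univ = sphereArea m from h, inv_mul_cancel₀ hA]
  · rw [sphAvg_apply, sphAvg_apply, mul_left_comm]
    congr 1
    have h := polynomial_integration_by_parts (volume : Measure (E m))
      (ContinuousLinearMap.id ℝ (E m)) v v (fun _ => rfl) D q hq
    rwa [finrank_euclideanSpace_fin] at h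

theorem finrank_orthogonal_unit (hm : 0 < m) {t : E m} (ht : ‖t‖ = 1) :
    Module.finrank ℝ ↥(ℝ ∙ t)ᗮ = m - 1 := by
  have : Fact (Module.finrank ℝ (E m) = (m - 1) + 1) :=
    ⟨by rw [finrank_euclideanSpace_fin]; omega⟩
  exact Submodule.finrank_orthogonal_span_singleton (by rintro rfl; simp at ht)

/-- On t⊥ the functional ⟨v, ·⟩ is represented by the projection of v. This is why the derivative is
taken along `perpProj t v`, and why the dimension drops to m - 1. -/
theorem isSphericalMean_perpAvg (hm : 3 ≤ m) {t : E m} (ht : ‖t‖ = 1) :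
    IsSphericalMean (m - 1) (perpProj t) (perpAvg t) := by
  have hfin := finrank_orthogonal_unit (by omega) ht
  have : Nontrivial ↥(ℝ ∙ t)ᗮ := Module.nontrivial_of_finrank_pos (R := ℝ) (by omega)
  have hA : ((sphereArea (m - 1) : ℝ) : ℂ) ≠ 0 := by
    exact_mod_cast (sphereArea_pos (by omega)).ne'
  let _ := @measureSpaceOfInnerProductSpace ↥(ℝ ∙ t)ᗮ
  refine .of_real ?_ (fun a b c => ?_) fun v D q hq => ?_
  · have h := toSphere_real_univ_eq_sphereArea (V := ↥(ℝ ∙ t)ᗮ)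
    rw [hfin] at h
    rw [perpAvg_apply]
    simp only [map_one, integral_const, mul_one, Complex.real_smul]
    rw [show (perpSphereMeasure t).real Set.univ = sphereArea (m - 1) from h, inv_mul_cancel₀ hA]
  · simp only [perpProj, add_dotProduct, smul_dotProduct, smul_eq_mul]
    module
  · rw [perpAvg_apply, perpAvg_apply, mul_left_comm]
    congr 1
    have hmem : v - (inner ℝ t v : ℝ) • t ∈ (ℝ ∙ t)ᗮ := by
      rw [Submodule.mem_orthogonal_singleton_iff_inner_right, inner_sub_right, inner_smul_right,
        real_inner_self_eq_norm_sq, ht]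
      ring
    have h := polynomial_integration_by_parts
      (volume : Measure ↥(ℝ ∙ t)ᗮ) (Submodule.subtypeL _) v ⟨_, hmem⟩
      (fun s => by
        have := Submodule.mem_orthogonal_singleton_iff_inner_right.1 s.2
        simp [inner_sub_left, inner_smul_left, this]) D q hq
    rw [hfin] at h
    have h1 : toC (v - (inner ℝ t v : ℝ) • t) = perpProj t (toC v) := by
      rw [sub_eq_add_neg, ← neg_smul, toC_add_smul, perpProj, toC_dotProduct, real_inner_comm]
      push_cast
      module
    simp only [Submodule.subtypeL_apply, h1] at h
    exact h

end Averages
-- Harmonic polynomials and the Funk-Hecke formula.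
section FunkHecke

open MvPolynomial

variable {m : ℕ}

/-- The Laplace operator on polynomials. -/
def lap (q : MvPolynomial (Fin m) ℂ) : MvPolynomial (Fin m) ℂ := ∑ j, pderiv j (pderiv j q)

/-- The solid spherical harmonics of degree `d`. -/
def IsHarmonic (d : ℕ) (H : MvPolynomial (Fin m) ℂ) : Prop := H.IsHomogeneous d ∧ lap H = 0

theorem pderiv_pderiv_comm (i j : Fin m) (q : MvPolynomial (Fin m) ℂ) :
    pderiv i (pderiv j q) = pderiv j (pderiv i q) := by
  have h : ⁅(pderiv i : Derivation ℂ (MvPolynomial (Fin m) ℂ) (MvPolynomial (Fin m) ℂ)),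
      (pderiv j : Derivation ℂ (MvPolynomial (Fin m) ℂ) (MvPolynomial (Fin m) ℂ))⁆ = 0 := by
    refine derivation_ext fun k => ?_
    rw [Derivation.commutator_apply, pderiv_X, pderiv_X]
    simp [Pi.single_apply, apply_ite]
  have h2 := congrArg (fun D => D q) h
  simpa [Derivation.commutator_apply, sub_eq_zero] using h2

theorem lap_dirD (v : Fin m → ℂ) (q : MvPolynomial (Fin m) ℂ) :
    lap (dirD v q) = dirD v (lap q) := by
  simp only [lap, dirD_eq_sum, map_sum, pderiv_C_mul]
  refine Finset.sum_congr rfl fun j _ => Finset.sum_congr rfl fun k _ => ?_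
  rw [pderiv_pderiv_comm j k, pderiv_pderiv_comm j k]

theorem IsHarmonic.dirD {d : ℕ} {H : MvPolynomial (Fin m) ℂ} (hH : IsHarmonic d H)
    (v : Fin m → ℂ) : IsHarmonic (d - 1) (dirD v H) :=
  ⟨isHomogeneous_dirD hH.1, by rw [lap_dirD, hH.2, map_zero]⟩

theorem eval_dirD_self {d : ℕ} {H : MvPolynomial (Fin m) ℂ} (hH : H.IsHomogeneous d)
    (v : Fin m → ℂ) : eval v (dirD v H) = d * eval v H := by
  have h := congrArg (eval v) hH.sum_X_mul_pderiv
  simp only [map_sum, map_mul, eval_X, nsmul_eq_mul, map_natCast] at h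
  rw [dirD_eq_sum, ← h]
  simp

/-- One factor ⟨x, ·⟩ is contracted against each of the others, as in Wick's formula with covariance
⟨y, Bx⟩. This lowers the degree by two and drives the later inductions. -/
theorem IsSphericalMean.wick {N : ℕ} {B : (Fin m → ℂ) → (Fin m → ℂ)}
    {Λ : MvPolynomial (Fin m) ℂ →ₗ[ℂ] ℂ} (hΛ : IsSphericalMean N B Λ) (x y : Fin m → ℂ)
    (c d : ℕ) :
    ((N : ℂ) + (c + d : ℕ) - 1) * Λ (lin x ^ (c + 1) * lin y ^ d) =
      c * (x ⬝ᵥ B x) * Λ (lin x ^ (c - 1) * lin y ^ d) +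
        d * (y ⬝ᵥ B x) * Λ (lin x ^ c * lin y ^ (d - 1)) := by
  have hh : (lin x ^ c * lin y ^ d).IsHomogeneous (c + d) := by
    simpa using ((isHomogeneous_lin x).pow c).mul ((isHomogeneous_lin y).pow d)
  rw [pow_succ', mul_assoc, hΛ.parts x _ _ hh]
  have h : dirD (B x) (lin x ^ c * lin y ^ d) =
      ((c : ℂ) * (x ⬝ᵥ B x)) • (lin x ^ (c - 1) * lin y ^ d) +
        ((d : ℂ) * (y ⬝ᵥ B x)) • (lin x ^ c * lin y ^ (d - 1)) := by
    simp only [Derivation.leibniz, Derivation.leibniz_pow, dirD_lin, smul_eq_mul, nsmul_eq_mul,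
      MvPolynomial.smul_eq_C_mul, map_mul, map_natCast]
    ring
  rw [h, map_add, map_smul, map_smul, smul_eq_mul, smul_eq_mul]

/-- The recursion behind Funk-Hecke: one factor ⟨v, ·⟩ differentiates either the remaining power or
H. For harmonic H the derivative is again harmonic, so the recursion stays within harmonics. -/
theorem IsSphericalMean.lin_pow_succ_mul {N : ℕ} {Λ : MvPolynomial (Fin m) ℂ →ₗ[ℂ] ℂ}
    (hΛ : IsSphericalMean N id Λ) {d : ℕ} {H : MvPolynomial (Fin m) ℂ} (hH : H.IsHomogeneous d)
    (v : Fin m → ℂ) (c : ℕ) :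
    ((N : ℂ) + (c + d : ℕ) - 1) * Λ (lin v ^ (c + 1) * H) =
      c * (v ⬝ᵥ v) * Λ (lin v ^ (c - 1) * H) + Λ (lin v ^ c * dirD v H) := by
  have hh : (lin v ^ c * H).IsHomogeneous (c + d) := by
    simpa using ((isHomogeneous_lin v).pow c).mul hH
  rw [pow_succ', mul_assoc, hΛ.parts v _ _ hh]
  have h : HuaRadon.dirD (id v) (lin v ^ c * H) =
      ((c : ℂ) * (v ⬝ᵥ v)) • (lin v ^ (c - 1) * H) + lin v ^ c * HuaRadon.dirD v H := by
    simp only [Derivation.leibniz, Derivation.leibniz_pow, dirD_lin, smul_eq_mul, nsmul_eq_mul,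
      MvPolynomial.smul_eq_C_mul, map_mul, map_natCast, id]
    ring
  rw [h, map_add, map_smul, smul_eq_mul]

theorem dirD_eq_zero_of_isHomogeneous_zero {H : MvPolynomial (Fin m) ℂ} (hH : H.IsHomogeneous 0)
    (v : Fin m → ℂ) : dirD v H = 0 := by
  obtain ⟨c, rfl⟩ : ∃ c, H = C c := ⟨_, totalDegree_eq_zero_iff_eq_C.1
    (Nat.le_zero.1 hH.totalDegree_le)⟩
  rw [derivation_C]

/-- Euler's identity writes (d + 1) H as the sum of X_j ∂_j H. Integrating each summand by parts
produces the mean of the Laplacian of H, which is zero. -/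
theorem IsSphericalMean.harmonic_eq_zero {Λ : MvPolynomial (Fin m) ℂ →ₗ[ℂ] ℂ} (hm : 2 ≤ m)
    (hΛ : IsSphericalMean m id Λ) {d : ℕ} {H : MvPolynomial (Fin m) ℂ}
    (hH : IsHarmonic (d + 1) H) : Λ H = 0 := by
  have h1 : ∀ j, ((m : ℂ) + d - 1) * Λ (X j * pderiv j H) = Λ (pderiv j (pderiv j H)) := by
    intro j
    have := hΛ.parts (Pi.single j 1) d (pderiv j H) hH.1.pderiv
    rw [lin_single, id, dirD_eq_sum, Finset.sum_eq_single j] at this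
    · simpa using this
    · intro k _ hk; simp [hk]
    · simp
  have h2 := congrArg Λ hH.1.sum_X_mul_pderiv
  rw [map_sum, map_nsmul, nsmul_eq_mul] at h2
  have h3 : ((m : ℂ) + d - 1) * (((d + 1 : ℕ) : ℂ) * Λ H) = 0 := by
    rw [← h2, Finset.mul_sum, Finset.sum_congr rfl fun j _ => h1 j, ← map_sum]
    exact (congrArg Λ hH.2).trans (map_zero Λ)
  have h4 : ((m : ℂ) + d - 1) ≠ 0 := by
    obtain ⟨k, rfl⟩ := Nat.exists_eq_add_of_le hm
    have : ((2 + k : ℕ) : ℂ) + d - 1 = ((k + d + 1 : ℕ) : ℂ) := by push_cast; ring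
    rw [this]; exact Nat.cast_ne_zero.2 (by omega)
  have h5 : ((d + 1 : ℕ) : ℂ) ≠ 0 := Nat.cast_ne_zero.2 (by omega)
  exact ((mul_eq_zero.1 ((mul_eq_zero.1 h3).resolve_left h4)).resolve_left h5)

theorem natCast_add_sub_one_ne_zero {m : ℕ} (hm : 2 ≤ m) (N : ℕ) : ((m : ℂ) + N - 1) ≠ 0 := by
  obtain ⟨k, rfl⟩ := Nat.exists_eq_add_of_le hm
  have : ((2 + k : ℕ) : ℂ) + N - 1 = ((k + N + 1 : ℕ) : ℂ) := by push_cast; ring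
  rw [this]; exact Nat.cast_ne_zero.2 (by omega)

/-- Orthogonality of harmonics to polynomials of lower degree. In the recursion the gap between d
and the power never closes, and power zero is the mean of a harmonic of positive degree. -/
theorem IsSphericalMean.funkHecke_eq_zero {Λ : MvPolynomial (Fin m) ℂ →ₗ[ℂ] ℂ} (hm : 2 ≤ m)
    (hΛ : IsSphericalMean m id Λ) (v : Fin m → ℂ) (N : ℕ) : ∀ (d : ℕ) (H : MvPolynomial (Fin m) ℂ),
    IsHarmonic d H → N < d → Λ (lin v ^ N * H) = 0 := by
  induction N using Nat.strong_induction_on with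
  | _ N ih =>
    intro d H hH hN
    obtain ⟨d, rfl⟩ : ∃ e, d = e + 1 := ⟨d - 1, by omega⟩
    rcases N with _ | N
    · simpa using hΛ.harmonic_eq_zero hm hH
    · have h := hΛ.lin_pow_succ_mul hH.1 v N
      rw [ih (N - 1) (by omega) _ H hH (by omega),
        ih N (by omega) _ _ (hH.dirD v) (by simpa using hN), mul_zero, add_zero] at h
      exact (mul_eq_zero.1 h).resolve_left (natCast_add_sub_one_ne_zero hm _)

/-- The constants in the Funk-Hecke formula for powers. -/
def kappa (m d n : ℕ) : ℝ :=
  (d + 2 * n).factorial * Real.Gamma ((m : ℝ) / 2) /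
    (2 ^ (d + 2 * n) * n.factorial * Real.Gamma ((m : ℝ) / 2 + d + n))

/-- The **Funk-Hecke formula** for powers: a spherical harmonic `H` of degree `d` satisfies
`Λ(⟨v, ·⟩^(d+2n) H) = κ ⟨v, v⟩^n H(v)`. -/
theorem IsSphericalMean.funkHecke {Λ : MvPolynomial (Fin m) ℂ →ₗ[ℂ] ℂ} (hm : 2 ≤ m)
    (hΛ : IsSphericalMean m id Λ) (v : Fin m → ℂ) (N : ℕ) :
    ∀ (d n : ℕ) (H : MvPolynomial (Fin m) ℂ), IsHarmonic d H → N = d + 2 * n →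
      Λ (lin v ^ N * H) = kappa m d n * (v ⬝ᵥ v) ^ n * eval v H := by
  induction N using Nat.strong_induction_on with
  | _ N ih =>
    intro d n H hH hN
    rcases N with _ | N
    · obtain ⟨rfl, rfl⟩ : d = 0 ∧ n = 0 := by omega
      obtain ⟨c, rfl⟩ : ∃ c, H = C c := ⟨_, totalDegree_eq_zero_iff_eq_C.1
        (Nat.le_zero.1 hH.1.totalDegree_le)⟩
      have hG : Real.Gamma ((m : ℝ) / 2) ≠ 0 := (Real.Gamma_pos_of_pos (by positivity)).ne'
      have h1 : Λ (C c) = c := by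
        rw [← mul_one (C c), ← smul_eq_C_mul, map_smul, hΛ.one, smul_eq_mul, mul_one]
      simp [kappa, h1, hG]
    · have hne := natCast_add_sub_one_ne_zero (m := m) hm (N + d)
      refine mul_left_cancel₀ hne ?_
      rw [hΛ.lin_pow_succ_mul hH.1 v N]
      have hpos : (0 : ℝ) < (m : ℝ) / 2 + d + n - 1 := by
        have h2 : (2 : ℝ) ≤ m := by exact_mod_cast hm
        have h3 : (1 : ℝ) ≤ (d : ℝ) + n := by exact_mod_cast (by omega : 1 ≤ d + n)
        linarith
      have hG : Real.Gamma ((m : ℝ) / 2 + d + n) =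
          ((m : ℝ) / 2 + d + n - 1) * Real.Gamma ((m : ℝ) / 2 + d + n - 1) := by
        rw [← Real.Gamma_add_one hpos.ne']; congr 1; ring
      have hG0 : Real.Gamma ((m : ℝ) / 2 + d + n - 1) ≠ 0 := (Real.Gamma_pos_of_pos hpos).ne'
      have hpos' : (m : ℝ) + 2 * d + 2 * n - 2 ≠ 0 := by
        intro h; apply hpos.ne'; linarith
      -- The two terms of the recursion contribute the shares 2n/(N+1) and d/(N+1) of the claimed
      -- value. They add up to 1 because N + 1 = d + 2n. For n = 0 the first share vanishes by
      -- orthogonality.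
      have t1 : (N : ℂ) * (v ⬝ᵥ v) * Λ (lin v ^ (N - 1) * H) =
          ((2 * n / (N + 1) * (m + (N + d : ℕ) - 1) * kappa m d n : ℝ) : ℂ) * (v ⬝ᵥ v) ^ n *
            eval v H := by
        rcases n with _ | n
        · rcases N with _ | N
          · simp
          · rw [hΛ.funkHecke_eq_zero hm v _ d H hH (by omega)]; simp
        · rw [ih (N - 1) (by omega) d n H hH (by omega)]
          have : (N : ℝ) * kappa m d n = 2 * (n + 1 : ℕ) / (N + 1) * (m + (N + d : ℕ) - 1) *
              kappa m d (n + 1) := by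
            obtain ⟨rfl⟩ : N = d + 2 * n + 1 := by omega
            have e1 : (m : ℝ) / 2 + d + n = (m : ℝ) / 2 + d + (n + 1 : ℕ) - 1 := by
              push_cast; ring
            rw [kappa, kappa, hG, e1, show d + 2 * (n + 1) = (d + 2 * n + 1) + 1 by ring,
              Nat.factorial_succ (d + 2 * n + 1), Nat.factorial_succ (d + 2 * n),
              Nat.factorial_succ n]
            have e3 : (m : ℝ) + ((d + 2 * n + 1 + d : ℕ) : ℝ) - 1 =
              2 * ((m : ℝ) / 2 + d + (n + 1 : ℕ) - 1) := by push_cast; ring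
            rw [e3]
            set w := (m : ℝ) / 2 + d + (n + 1 : ℕ) - 1
            push_cast
            field_simp
            ring
          rw [← this]
          push_cast; ring
      -- The derivative of H along v is harmonic of degree d - 1, and by Euler its value at v is d
      -- H(v).
      have t2 : Λ (lin v ^ N * HuaRadon.dirD v H) =
          ((d / (N + 1) * (m + (N + d : ℕ) - 1) * kappa m d n : ℝ) : ℂ) * (v ⬝ᵥ v) ^ n *
            eval v H := by
        rcases d with _ | d
        · rw [dirD_eq_zero_of_isHomogeneous_zero hH.1]; simp
        · rw [ih N (by omega) d n _ (hH.dirD v) (by omega), eval_dirD_self hH.1]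
          have : kappa m d n * (d + 1 : ℕ) = (d + 1 : ℕ) / (N + 1) *
              (m + (N + (d + 1) : ℕ) - 1) * kappa m (d + 1) n := by
            obtain ⟨rfl⟩ : N = d + 2 * n := by omega
            have e1 : (m : ℝ) / 2 + d + n = (m : ℝ) / 2 + (d + 1 : ℕ) + n - 1 := by
              push_cast; ring
            rw [kappa, kappa, hG, e1, show d + 1 + 2 * n = (d + 2 * n) + 1 by ring,
              Nat.factorial_succ (d + 2 * n)]
            have e3 : (m : ℝ) + ((d + 2 * n + (d + 1) : ℕ) : ℝ) - 1 =
              2 * ((m : ℝ) / 2 + (d + 1 : ℕ) + n - 1) := by push_cast; ring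
            rw [e3]
            set w := (m : ℝ) / 2 + (d + 1 : ℕ) + n - 1
            push_cast
            field_simp
            ring
          have this' := congrArg (fun x : ℝ => (x : ℂ)) this
          push_cast at this' ⊢
          linear_combination (v ⬝ᵥ v) ^ n * eval v H * this'
      rw [t1, t2]
      have hN' : (N : ℂ) + 1 = d + 2 * n := by exact_mod_cast hN
      have hN0 : (d : ℂ) + 2 * n ≠ 0 := by rw [← hN']; exact_mod_cast Nat.succ_ne_zero N
      push_cast
      rw [hN']
      field_simp
      ring

end FunkHecke
-- Polynomials in two blocks of variables and an algebraic Fubini theorem.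
section Slices

open MvPolynomial

variable {σ τ : Type*}

/-- Partial evaluation of the first block of variables. -/
def evalL (x : σ → ℂ) : MvPolynomial (σ ⊕ τ) ℂ →ₐ[ℂ] MvPolynomial τ ℂ :=
  aeval (Sum.elim (fun j => C (x j)) X)

/-- Partial evaluation of the second block of variables. -/
def evalR (y : τ → ℂ) : MvPolynomial (σ ⊕ τ) ℂ →ₐ[ℂ] MvPolynomial σ ℂ :=
  aeval (Sum.elim X fun j => C (y j))

theorem evalL_rename_inl (x : σ → ℂ) (p : MvPolynomial σ ℂ) :
    evalL (τ := τ) x (rename Sum.inl p) = C (eval x p) := by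
  induction p using MvPolynomial.induction_on with
  | C a => simp [evalL]
  | add p q hp hq => simp [hp, hq]
  | mul_X p i hp => rw [map_mul, map_mul, hp]; simp [evalL]

theorem evalL_rename_inr (x : σ → ℂ) (p : MvPolynomial τ ℂ) :
    evalL x (rename Sum.inr p) = p := by
  induction p using MvPolynomial.induction_on with
  | C a => simp [evalL]
  | add p q hp hq => simp [hp, hq]
  | mul_X p i hp => rw [map_mul, map_mul, hp]; simp [evalL]

theorem evalR_rename_inl (y : τ → ℂ) (p : MvPolynomial σ ℂ) :
    evalR y (rename Sum.inl p) = p := by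
  induction p using MvPolynomial.induction_on with
  | C a => simp [evalR]
  | add p q hp hq => simp [hp, hq]
  | mul_X p i hp => rw [map_mul, map_mul, hp]; simp [evalR]

theorem evalR_rename_inr (y : τ → ℂ) (p : MvPolynomial τ ℂ) :
    evalR (σ := σ) y (rename Sum.inr p) = C (eval y p) := by
  induction p using MvPolynomial.induction_on with
  | C a => simp [evalR]
  | add p q hp hq => simp [hp, hq]
  | mul_X p i hp => rw [map_mul, map_mul, hp]; simp [evalR]

theorem eval_evalL (x : σ → ℂ) (y : τ → ℂ) (p : MvPolynomial (σ ⊕ τ) ℂ) :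
    eval y (evalL x p) = eval (Sum.elim x y) p := by
  induction p using MvPolynomial.induction_on with
  | C a => simp [evalL]
  | add p q hp hq => simp [hp, hq]
  | mul_X p i hp => rw [map_mul, map_mul, hp]; cases i <;> simp [evalL]

/-- Polynomials in two blocks of variables are sums of products. -/
theorem sumPolynomial_induction {motive : MvPolynomial (σ ⊕ τ) ℂ → Prop}
    (add : ∀ p q, motive p → motive q → motive (p + q))
    (mul : ∀ (a : MvPolynomial σ ℂ) (b : MvPolynomial τ ℂ),
      motive (rename Sum.inl a * rename Sum.inr b)) (p : MvPolynomial (σ ⊕ τ) ℂ) : motive p := by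
  have hspan : p ∈ Submodule.span ℂ {q : MvPolynomial (σ ⊕ τ) ℂ |
      ∃ (a : MvPolynomial σ ℂ) (b : MvPolynomial τ ℂ), q = rename Sum.inl a * rename Sum.inr b} := by
    induction p using MvPolynomial.induction_on with
    | C a => exact Submodule.subset_span ⟨C a, 1, by simp⟩
    | add p q hp hq => exact Submodule.add_mem _ hp hq
    | mul_X p i hp =>
      induction hp using Submodule.span_induction with
      | mem x hx =>
        obtain ⟨a, b, rfl⟩ := hx
        rcases i with i | i
        · exact Submodule.subset_span ⟨a * X i, b, by simp; ring⟩
        · exact Submodule.subset_span ⟨a, b * X i, by simp; ring⟩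
      | zero => simp
      | add x y _ _ hx hy => rw [add_mul]; exact Submodule.add_mem _ hx hy
      | smul c x _ hx => rw [smul_mul_assoc]; exact Submodule.smul_mem _ _ hx
  -- The motive need not be stable under scalars. The statement is strengthened to all multiples,
  -- and the scalar is absorbed into the first factor of a product.
  have hsmul : ∀ (c : ℂ) (x : MvPolynomial (σ ⊕ τ) ℂ), x ∈ Submodule.span ℂ
      {q : MvPolynomial (σ ⊕ τ) ℂ | ∃ (a : MvPolynomial σ ℂ) (b : MvPolynomial τ ℂ),
        q = rename Sum.inl a * rename Sum.inr b} → motive (c • x) := by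
    intro c x hx
    induction hx using Submodule.span_induction generalizing c with
    | mem x hx =>
      obtain ⟨a, b, rfl⟩ := hx
      rw [← smul_mul_assoc, ← map_smul]
      exact mul _ _
    | zero => simpa using mul 0 0
    | add x y _ _ hx hy => rw [smul_add]; exact add _ _ (hx c) (hy c)
    | smul d x _ hx => rw [smul_smul]; exact hx _
  simpa using hsmul 1 p hspan

/-- Fubini's theorem for linear functionals on polynomials in two blocks of variables. -/
theorem exists_slice (Λ₁ : MvPolynomial σ ℂ →ₗ[ℂ] ℂ) (Λ₂ : MvPolynomial τ ℂ →ₗ[ℂ] ℂ)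
    (p : MvPolynomial (σ ⊕ τ) ℂ) :
    ∃ (Q : MvPolynomial τ ℂ) (R : MvPolynomial σ ℂ), (∀ y, eval y Q = Λ₁ (evalR y p)) ∧
      (∀ x, eval x R = Λ₂ (evalL x p)) ∧ Λ₂ Q = Λ₁ R := by
  induction p using sumPolynomial_induction with
  | add p q hp hq =>
    obtain ⟨Q, R, h1, h2, h3⟩ := hp
    obtain ⟨Q', R', h1', h2', h3'⟩ := hq
    exact ⟨Q + Q', R + R', fun y => by simp [h1, h1'], fun x => by simp [h2, h2'],
      by simp [h3, h3']⟩
  | mul a b =>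
    refine ⟨Λ₁ a • b, Λ₂ b • a, fun y => ?_, fun x => ?_, ?_⟩
    · rw [map_mul, evalR_rename_inl, evalR_rename_inr, mul_comm a, ← smul_eq_C_mul, smul_eval,
        map_smul, smul_eq_mul, mul_comm]
    · rw [map_mul, evalL_rename_inl, evalL_rename_inr, ← smul_eq_C_mul, smul_eval,
        map_smul, smul_eq_mul, mul_comm]
    · rw [map_smul, map_smul, smul_eq_mul, smul_eq_mul, mul_comm]

end Slices

/-! ### The average over pairs of orthonormal vectors. -/

section StiefelAverage

open MvPolynomial

variable {m : ℕ}

/-- The inner sphere varies with t, so regularity in t is not automatic. Euler's identity and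
integration by parts reduce the average of q to those of its second derivatives, with coefficients
polynomial in t through e_j - t_j t; induction on the degree finishes. -/
theorem exists_eval_eq_perpAvg_of_isHomogeneous (hm : 3 ≤ m) (D : ℕ) :
    ∀ q : MvPolynomial (Fin m) ℂ, q.IsHomogeneous D →
      ∃ P : MvPolynomial (Fin m) ℂ, ∀ t : E m, ‖t‖ = 1 → perpAvg t q = eval (toC t) P := by
  induction D using Nat.strong_induction_on with
  | _ D ih =>
    intro q hq
    rcases D with _ | D
    · obtain ⟨c, rfl⟩ : ∃ c, q = C c := ⟨_, totalDegree_eq_zero_iff_eq_C.1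
        (Nat.le_zero.1 hq.totalDegree_le)⟩
      refine ⟨C c, fun t ht => ?_⟩
      rw [← mul_one (C c), ← smul_eq_C_mul, map_smul, (isSphericalMean_perpAvg hm ht).one]
      simp
    · have hne : ((m - 1 : ℕ) : ℂ) + D - 1 ≠ 0 := natCast_add_sub_one_ne_zero (by omega) D
      have hh : ∀ j k, (pderiv k (pderiv j q)).IsHomogeneous (D + 1 - 1 - 1) :=
        fun j k => hq.pderiv.pderiv
      choose P hP using fun j k => ih (D + 1 - 1 - 1) (by omega) _ (hh j k)
      refine ⟨C ((((m - 1 : ℕ) : ℂ) + D - 1)⁻¹ * ((D + 1 : ℕ) : ℂ)⁻¹) *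
        ∑ j, (P j j - X j * ∑ k, X k * P j k), fun t ht => ?_⟩
      have key : ∀ j, perpAvg t (X j * pderiv j q) = (((m - 1 : ℕ) : ℂ) + D - 1)⁻¹ *
          eval (toC t) (P j j - X j * ∑ k, X k * P j k) := by
        intro j
        have h := (isSphericalMean_perpAvg hm ht).parts (Pi.single j 1) D (pderiv j q)
          (by simpa using hq.pderiv)
        rw [lin_single] at h
        rw [eq_inv_mul_iff_mul_eq₀ hne, h, dirD_eq_sum, map_sum]
        have e : ∀ (a : ℂ) (q : MvPolynomial (Fin m) ℂ), perpAvg t (C a * q) = a * perpAvg t q := by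
          intro a q; rw [← smul_eq_C_mul, map_smul, smul_eq_mul]
        simp only [e, hP j _ t ht]
        simp only [perpProj, smul_eq_mul, Pi.sub_apply, Pi.smul_apply, sub_mul, Finset.sum_sub_distrib, map_sub, map_mul, map_sum, eval_X,
          Finset.mul_sum]
        congr 1
        · rw [Finset.sum_eq_single j] <;> simp +contextual
        · refine Finset.sum_congr rfl fun k _ => ?_
          simp; ring
      have h2 := congrArg (perpAvg t) hq.sum_X_mul_pderiv
      rw [map_sum, Finset.sum_congr rfl fun j _ => key j, ← Finset.mul_sum, ← map_sum, map_nsmul,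
        nsmul_eq_mul] at h2
      have h3 : ((D + 1 : ℕ) : ℂ) ≠ 0 := Nat.cast_ne_zero.2 (by omega)
      rw [map_mul, eval_C, mul_right_comm, h2]
      field_simp

theorem exists_eval_eq_perpAvg (hm : 3 ≤ m) (p : MvPolynomial (Fin m ⊕ Fin m) ℂ) :
    ∃ P : MvPolynomial (Fin m) ℂ, ∀ t : E m, ‖t‖ = 1 →
      perpAvg t (evalL (toC t) p) = eval (toC t) P := by
  induction p using sumPolynomial_induction with
  | add p q hp hq =>
    obtain ⟨P, hP⟩ := hp
    obtain ⟨Q, hQ⟩ := hq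
    exact ⟨P + Q, fun t ht => by simp [hP t ht, hQ t ht]⟩
  | mul a b =>
    choose P hP using fun D => exists_eval_eq_perpAvg_of_isHomogeneous hm D
      (homogeneousComponent D b) (homogeneousComponent_isHomogeneous D b)
    refine ⟨a * ∑ D ∈ Finset.range (b.totalDegree + 1), P D, fun t ht => ?_⟩
    rw [map_mul, evalL_rename_inl, evalL_rename_inr, ← smul_eq_C_mul, map_smul, smul_eq_mul,
      map_mul, map_sum, ← Finset.sum_congr rfl fun D _ => hP D t ht, ← map_sum,
      sum_homogeneousComponent]

/-- The integrals over `S^{m-2}` of a polynomial in `(t, s)`, as a function of `t`. -/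
theorem integrable_perpAvg (hm : 3 ≤ m) (p : MvPolynomial (Fin m ⊕ Fin m) ℂ) :
    Integrable (fun t : Metric.sphere (0 : E m) 1 => perpAvg (t : E m) (evalL (toC (t : E m)) p))
      (sphereMeasure m) := by
  obtain ⟨P, hP⟩ := exists_eval_eq_perpAvg hm p
  have : (fun t : Metric.sphere (0 : E m) 1 => perpAvg (t : E m) (evalL (toC (t : E m)) p)) =
      fun t : Metric.sphere (0 : E m) 1 => eval (toC (t : E m)) P := by
    ext t; exact hP t (by simp)
  rw [this]
  exact integrable_sphere (continuous_eval_toC P)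

/-- The average of a polynomial over the pairs `(t, s)` of orthogonal unit vectors. -/
def stiefelAvg (hm : 3 ≤ m) : MvPolynomial (Fin m ⊕ Fin m) ℂ →ₗ[ℂ] ℂ where
  toFun p := ((sphereArea m : ℝ) : ℂ)⁻¹ *
    ∫ t : Metric.sphere (0 : E m) 1, perpAvg (t : E m) (evalL (toC (t : E m)) p) ∂sphereMeasure m
  map_add' p q := by
    simp only [map_add]
    rw [integral_add (integrable_perpAvg hm p) (integrable_perpAvg hm q), mul_add]
  map_smul' c p := by
    simp only [map_smul, smul_eq_mul, integral_const_mul, RingHom.id_apply]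
    ring

theorem stiefelAvg_apply (hm : 3 ≤ m) (p : MvPolynomial (Fin m ⊕ Fin m) ℂ) :
    stiefelAvg hm p = ((sphereArea m : ℝ) : ℂ)⁻¹ * ∫ t : Metric.sphere (0 : E m) 1,
      perpAvg (t : E m) (evalL (toC (t : E m)) p) ∂sphereMeasure m := rfl

theorem stiefelAvg_congr (hm : 3 ≤ m) {p q : MvPolynomial (Fin m ⊕ Fin m) ℂ}
    (h : ∀ t : E m, ‖t‖ = 1 → perpAvg t (evalL (toC t) p) = perpAvg t (evalL (toC t) q)) :
    stiefelAvg hm p = stiefelAvg hm q := by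
  rw [stiefelAvg_apply, stiefelAvg_apply]
  congr 2
  ext t; exact h t (by simp)

/-- Only the values at orthogonal unit vectors matter. -/
theorem perpAvg_congr {t : E m} {p q : MvPolynomial (Fin m) ℂ}
    (h : ∀ s : E m, ‖s‖ = 1 → inner ℝ t s = 0 → eval (toC s) p = eval (toC s) q) :
    perpAvg t p = perpAvg t q := by
  rw [perpAvg_apply, perpAvg_apply]
  congr 2
  ext s
  exact h _ (mem_sphere_zero_iff_norm.1 s.2)
    (Submodule.mem_orthogonal_singleton_iff_inner_right.1 s.1.2)

theorem stiefelAvg_congr_eval (hm : 3 ≤ m) {p q : MvPolynomial (Fin m ⊕ Fin m) ℂ}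
    (h : ∀ t s : E m, ‖t‖ = 1 → ‖s‖ = 1 → inner ℝ t s = 0 →
      eval (Sum.elim (toC t) (toC s)) p = eval (Sum.elim (toC t) (toC s)) q) :
    stiefelAvg hm p = stiefelAvg hm q :=
  stiefelAvg_congr hm fun t ht => perpAvg_congr fun s hs hts => by
    rw [eval_evalL, eval_evalL, h t s ht hs hts]

theorem perpAvg_comp_neg {t : E m} {p q : MvPolynomial (Fin m) ℂ}
    (h : ∀ s : E m, eval (toC (-s)) p = eval (toC s) q) : perpAvg t p = perpAvg t q := by
  let _ := @measureSpaceOfInnerProductSpace ↥(ℝ ∙ t)ᗮ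
  rw [perpAvg_apply, perpAvg_apply, perpSphereMeasure]
  congr 1
  rw [← integral_toSphere_comp_neg]
  congr 1
  ext s
  exact h _

theorem stiefelAvg_one (hm : 3 ≤ m) : stiefelAvg hm 1 = 1 := by
  have h : ∀ t : Metric.sphere (0 : E m) 1, perpAvg (t : E m) (evalL (toC (t : E m)) 1) = 1 :=
    fun t => by
      rw [map_one]
      exact (isSphericalMean_perpAvg hm (mem_sphere_zero_iff_norm.1 t.2)).one
  have := (isSphericalMean_sphAvg hm).one
  rw [sphAvg_apply] at this
  rw [stiefelAvg_apply]
  simp only [h]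
  simpa only [map_one] using this

end StiefelAverage

/-! ### Averages of linear forms as invariant polynomials in two vectors. -/

section Universality

open MvPolynomial

variable {m : ℕ}

/-- The span of the invariants `⟨z, z⟩^i ⟨z, w⟩^j ⟨w, w⟩^h` of bidegree `(a, b)`. -/
def invariants (m a b : ℕ) : Submodule ℂ ((Fin m → ℂ) → (Fin m → ℂ) → ℂ) :=
  Submodule.span ℂ {f | ∃ i j h : ℕ, 2 * i + j = a ∧ j + 2 * h = b ∧
    f = fun z w => (z ⬝ᵥ z) ^ i * (z ⬝ᵥ w) ^ j * (w ⬝ᵥ w) ^ h}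

theorem invariants_of_eq_zero {a b : ℕ} {g : (Fin m → ℂ) → (Fin m → ℂ) → ℂ}
    (h : ∀ z w, g z w = 0) : g ∈ invariants m a b := by
  have : g = 0 := by ext z w; exact h z w
  rw [this]; exact Submodule.zero_mem _

theorem invariants_mul {a b a' b' : ℕ} {f g : (Fin m → ℂ) → (Fin m → ℂ) → ℂ}
    (hf : f ∈ invariants m a b) (c : ℂ) (i j h : ℕ) (ha : a' = 2 * i + j + a)
    (hb : b' = j + 2 * h + b)
    (hg : ∀ z w, g z w = c * ((z ⬝ᵥ z) ^ i * (z ⬝ᵥ w) ^ j * (w ⬝ᵥ w) ^ h * f z w)) :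
    g ∈ invariants m a' b' := by
  subst ha hb
  have hg' : g = c • fun z w => (z ⬝ᵥ z) ^ i * (z ⬝ᵥ w) ^ j * (w ⬝ᵥ w) ^ h * f z w := by
    ext z w; exact hg z w
  rw [hg']
  refine Submodule.smul_mem _ _ ?_
  clear hg hg'
  induction hf using Submodule.span_induction with
  | mem f hf =>
    obtain ⟨i', j', h', h1, h2, rfl⟩ := hf
    refine Submodule.subset_span ⟨i + i', j + j', h + h', by omega, by omega, ?_⟩
    ext z w; ring
  | zero => exact invariants_of_eq_zero fun z w => by simp
  | add f g _ _ hf hg =>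
    have := Submodule.add_mem _ hf hg
    convert! this using 1
    ext z w; simp; ring
  | smul c f _ hf =>
    have := Submodule.smul_mem _ c hf
    convert! this using 1
    ext z w; simp; ring

theorem invariants_of_mul_eq {a b : ℕ} {f g : (Fin m → ℂ) → (Fin m → ℂ) → ℂ}
    (hg : g ∈ invariants m a b) {c : ℂ} (hc : c ≠ 0) (h : ∀ z w, c * f z w = g z w) :
    f ∈ invariants m a b := by
  have : f = c⁻¹ • g := by
    ext z w
    simp only [Pi.smul_apply, ← h z w, smul_eq_mul]
    field_simp
  rw [this]; exact Submodule.smul_mem _ _ hg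

/-- Each Wick contraction emits ⟨z,z⟩, ⟨z,w⟩ or ⟨w,w⟩ and removes two linear forms, so invariance
follows from the recursion without an action of the rotation group. -/
theorem sphAvg_lin_pow_mem_invariants (hm : 3 ≤ m) (N : ℕ) : ∀ c d : ℕ, c + d = N →
    (fun z w : Fin m → ℂ => sphAvg m (lin z ^ c * lin w ^ d)) ∈ invariants m c d := by
  have hΛ := isSphericalMean_sphAvg hm
  induction N using Nat.strong_induction_on with
  | _ N ih =>
    intro c d hN
    rcases c with _ | c
    · rcases d with _ | d
      · refine Submodule.subset_span ⟨0, 0, 0, rfl, rfl, ?_⟩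
        ext z w; simp [hΛ.one]
      · refine invariants_of_mul_eq (c := (m : ℂ) + (d + 0 : ℕ) - 1)
          (g := fun z w => d * (w ⬝ᵥ w) * sphAvg m (lin z ^ 0 * lin w ^ (d - 1))) ?_
          (natCast_add_sub_one_ne_zero (by omega) _) fun z w => ?_
        · rcases d with _ | d
          · exact invariants_of_eq_zero fun z w => by simp
          · exact invariants_mul (ih d (by omega) 0 d (by omega)) (d + 1 : ℕ) 0 0 1 (by omega)
              (by omega) fun z w => by simp; ring
        · have := hΛ.wick w z d 0
          simp only [pow_zero, mul_one, one_mul, Nat.cast_zero, zero_mul, add_zero, id] at this ⊢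
          rw [this]
    · refine invariants_of_mul_eq (c := (m : ℂ) + (c + d : ℕ) - 1)
        (g := (fun z w => c * (z ⬝ᵥ z) * sphAvg m (lin z ^ (c - 1) * lin w ^ d)) +
          fun z w => d * (z ⬝ᵥ w) * sphAvg m (lin z ^ c * lin w ^ (d - 1)))
        (Submodule.add_mem _ ?_ ?_) (natCast_add_sub_one_ne_zero (by omega) _) fun z w => ?_
      · rcases c with _ | c
        · exact invariants_of_eq_zero fun z w => by simp
        · exact invariants_mul (ih (c + d) (by omega) c d (by omega)) (c + 1 : ℕ) 1 0 0 (by omega)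
            (by omega) fun z w => by simp; ring
      · rcases d with _ | d
        · exact invariants_of_eq_zero fun z w => by simp
        · exact invariants_mul (ih (c + d) (by omega) c d (by omega)) (d + 1 : ℕ) 0 1 0 (by omega)
            (by omega) fun z w => by simp; ring
      · have := hΛ.wick z w c d
        simp only [id] at this
        simp only [Pi.add_apply]
        rw [this, dotProduct_comm w z]

/-- `⟨z, t⟩` as a polynomial in `(t, s)`. -/
def linT (z : Fin m → ℂ) : MvPolynomial (Fin m ⊕ Fin m) ℂ := rename Sum.inl (lin z)

/-- `⟨z, s⟩` as a polynomial in `(t, s)`. -/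
def linS (z : Fin m → ℂ) : MvPolynomial (Fin m ⊕ Fin m) ℂ := rename Sum.inr (lin z)

theorem dotProduct_perpProj (t : E m) (x y : Fin m → ℂ) :
    y ⬝ᵥ perpProj t x = y ⬝ᵥ x - (x ⬝ᵥ toC t) * (y ⬝ᵥ toC t) := by
  rw [perpProj, dotProduct_sub, dotProduct_smul, smul_eq_mul]

/-- The covariance on t⊥ is ⟨x,y⟩ - ⟨x,t⟩⟨y,t⟩. A contraction therefore either emits an invariant or
moves two linear forms from s to t; in both cases the degree in s drops by two. -/
theorem stiefelAvg_wick (hm : 3 ≤ m) (p : MvPolynomial (Fin m) ℂ) (z w : Fin m → ℂ) (c d : ℕ) :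
    (((m - 1 : ℕ) : ℂ) + (c + d : ℕ) - 1) *
      stiefelAvg hm (rename Sum.inl p * (linS z ^ (c + 1) * linS w ^ d)) =
    c * ((z ⬝ᵥ z) * stiefelAvg hm (rename Sum.inl p * (linS z ^ (c - 1) * linS w ^ d)) -
      stiefelAvg hm (rename Sum.inl (p * lin z ^ 2) * (linS z ^ (c - 1) * linS w ^ d))) +
    d * ((z ⬝ᵥ w) * stiefelAvg hm (rename Sum.inl p * (linS z ^ c * linS w ^ (d - 1))) -
      stiefelAvg hm (rename Sum.inl (p * (lin z * lin w)) *
        (linS z ^ c * linS w ^ (d - 1)))) := by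
  have key : ∀ t : E m, ‖t‖ = 1 →
    perpAvg t (evalL (toC t) ((((m - 1 : ℕ) : ℂ) + (c + d : ℕ) - 1) •
      (rename Sum.inl p * (linS z ^ (c + 1) * linS w ^ d)))) =
    perpAvg t (evalL (toC t) ((c : ℂ) • ((z ⬝ᵥ z) •
        (rename Sum.inl p * (linS z ^ (c - 1) * linS w ^ d)) -
      (rename Sum.inl (p * lin z ^ 2) * (linS z ^ (c - 1) * linS w ^ d))) +
    (d : ℂ) • ((z ⬝ᵥ w) • (rename Sum.inl p * (linS z ^ c * linS w ^ (d - 1))) -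
      (rename Sum.inl (p * (lin z * lin w)) * (linS z ^ c * linS w ^ (d - 1)))))) := by
    intro t ht
    have h := (isSphericalMean_perpAvg hm ht).wick z w c d
    simp only [linS, map_add, map_sub, map_smul, map_mul (evalL _), map_pow (evalL _),
      evalL_rename_inl, evalL_rename_inr, smul_eq_mul, dotProduct_perpProj] at h ⊢
    have e : ∀ (a : ℂ) (q : MvPolynomial (Fin m) ℂ), perpAvg t (C a * q) = a * perpAvg t q := by
      intro a q; rw [← smul_eq_C_mul, map_smul, smul_eq_mul]
    rw [e, e, e, e, e, mul_left_comm, h, dotProduct_comm w z]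
    simp only [map_mul, map_pow, eval_lin]
    ring
  simpa only [map_add, map_sub, map_smul, smul_eq_mul] using stiefelAvg_congr hm key

end Universality
-- Invariant kernels act by scalars on spherical harmonics.
section Universality

open MvPolynomial

variable {m : ℕ}

theorem stiefelAvg_rename_inl (hm : 3 ≤ m) (p : MvPolynomial (Fin m) ℂ) :
    stiefelAvg hm (rename Sum.inl p) = sphAvg m p := by
  rw [stiefelAvg_apply, sphAvg_apply]
  congr 2
  ext t
  rw [evalL_rename_inl, ← mul_one (C _), ← smul_eq_C_mul, map_smul,
    (isSphericalMean_perpAvg hm (mem_sphere_zero_iff_norm.1 t.2)).one, smul_eq_mul, mul_one]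

/-- Induction on the degree in s alone, with the powers of t left free: contractions may raise them.
At degree zero in s the average is one over the single sphere. -/
theorem stiefelAvg_lin_pow_mem_invariants (hm : 3 ≤ m) (N : ℕ) : ∀ a b c d : ℕ, c + d = N →
    (fun z w : Fin m → ℂ => stiefelAvg hm (rename Sum.inl (lin z ^ a * lin w ^ b) *
      (linS z ^ c * linS w ^ d))) ∈ invariants m (a + c) (b + d) := by
  induction N using Nat.strong_induction_on with
  | _ N ih =>
    intro a b c d hN
    rcases c with _ | c
    · rcases d with _ | d
      · simpa only [pow_zero, mul_one, add_zero, stiefelAvg_rename_inl] using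
          sphAvg_lin_pow_mem_invariants hm (a + b) a b rfl
      · refine invariants_of_mul_eq (c := ((m - 1 : ℕ) : ℂ) + (d + 0 : ℕ) - 1)
          (g := (fun z w => d * (w ⬝ᵥ w) * stiefelAvg hm (rename Sum.inl (lin z ^ a * lin w ^ b) *
              (linS z ^ 0 * linS w ^ (d - 1)))) +
            fun z w => -d * stiefelAvg hm (rename Sum.inl (lin z ^ a * lin w ^ (b + 2)) *
              (linS z ^ 0 * linS w ^ (d - 1)))) (Submodule.add_mem _ ?_ ?_)
          (natCast_add_sub_one_ne_zero (by omega) _) fun z w => ?_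
        · rcases d with _ | d
          · exact invariants_of_eq_zero fun z w => by simp
          · exact invariants_mul (ih d (by omega) a b 0 d (by omega)) (d + 1 : ℕ) 0 0 1 (by omega)
              (by omega) fun z w => by simp only [Nat.add_sub_cancel]; ring
        · rcases d with _ | d
          · exact invariants_of_eq_zero fun z w => by simp
          · exact invariants_mul (ih d (by omega) a (b + 2) 0 d (by omega)) (-(d + 1 : ℕ)) 0 0 0
              (by omega) (by omega) fun z w => by simp only [Nat.add_sub_cancel]; ring
        · have := stiefelAvg_wick hm (lin z ^ a * lin w ^ b) w z d 0
          simp only [pow_zero, mul_one, one_mul, Nat.cast_zero, zero_mul, add_zero,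
            Pi.add_apply] at this ⊢
          rw [this, mul_assoc (lin z ^ a), ← pow_add]; ring
    · refine invariants_of_mul_eq (c := ((m - 1 : ℕ) : ℂ) + (c + d : ℕ) - 1)
          (g := ((fun z w => c * (z ⬝ᵥ z) * stiefelAvg hm
              (rename Sum.inl (lin z ^ a * lin w ^ b) * (linS z ^ (c - 1) * linS w ^ d))) +
            fun z w => -c * stiefelAvg hm
              (rename Sum.inl (lin z ^ (a + 2) * lin w ^ b) * (linS z ^ (c - 1) * linS w ^ d))) +
            ((fun z w => d * (z ⬝ᵥ w) * stiefelAvg hm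
              (rename Sum.inl (lin z ^ a * lin w ^ b) * (linS z ^ c * linS w ^ (d - 1)))) +
            fun z w => -d * stiefelAvg hm
              (rename Sum.inl (lin z ^ (a + 1) * lin w ^ (b + 1)) *
                (linS z ^ c * linS w ^ (d - 1)))))
          (Submodule.add_mem _ (Submodule.add_mem _ ?_ ?_) (Submodule.add_mem _ ?_ ?_))
          (natCast_add_sub_one_ne_zero (by omega) _) fun z w => ?_
      · rcases c with _ | c
        · exact invariants_of_eq_zero fun z w => by simp
        · exact invariants_mul (ih (c + d) (by omega) a b c d (by omega)) (c + 1 : ℕ) 1 0 0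
            (by omega) (by omega) fun z w => by simp only [Nat.add_sub_cancel]; ring
      · rcases c with _ | c
        · exact invariants_of_eq_zero fun z w => by simp
        · exact invariants_mul (ih (c + d) (by omega) (a + 2) b c d (by omega)) (-(c + 1 : ℕ)) 0 0 0
            (by omega) (by omega) fun z w => by simp only [Nat.add_sub_cancel]; ring
      · rcases d with _ | d
        · exact invariants_of_eq_zero fun z w => by simp
        · exact invariants_mul (ih (c + d) (by omega) a b c d (by omega)) (d + 1 : ℕ) 0 1 0
            (by omega) (by omega) fun z w => by simp only [Nat.add_sub_cancel]; ring
      · rcases d with _ | d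
        · exact invariants_of_eq_zero fun z w => by simp
        · exact invariants_mul (ih (c + d) (by omega) (a + 1) (b + 1) c d (by omega))
            (-(d + 1 : ℕ)) 0 0 0
            (by omega) (by omega) fun z w => by simp only [Nat.add_sub_cancel]; ring
      · have := stiefelAvg_wick hm (lin z ^ a * lin w ^ b) z w c d
        simp only [Pi.add_apply]
        rw [this, show lin z ^ a * lin w ^ b * lin z ^ 2 = lin z ^ (a + 2) * lin w ^ b by ring,
          show lin z ^ a * lin w ^ b * (lin z * lin w) = lin z ^ (a + 1) * lin w ^ (b + 1) by ring]
        ring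

/-- The span of the products `⟨z, t⟩^i ⟨z, s⟩^c ⟨w, t⟩^j ⟨w, s⟩^d` of bidegree `(a, b)`. -/
def stiefelForms (m a b : ℕ) :
    Submodule ℂ ((Fin m → ℂ) → (Fin m → ℂ) → MvPolynomial (Fin m ⊕ Fin m) ℂ) :=
  Submodule.span ℂ {f | ∃ i j c d : ℕ, i + c = a ∧ j + d = b ∧
    f = fun z w => linT z ^ i * linT w ^ j * (linS z ^ c * linS w ^ d)}

theorem stiefelAvg_mem_invariants (hm : 3 ≤ m) {a b : ℕ}
    {f : (Fin m → ℂ) → (Fin m → ℂ) → MvPolynomial (Fin m ⊕ Fin m) ℂ}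
    (hf : f ∈ stiefelForms m a b) : (fun z w => stiefelAvg hm (f z w)) ∈ invariants m a b := by
  induction hf using Submodule.span_induction with
  | mem f hf =>
    obtain ⟨i, j, c, d, rfl, rfl, rfl⟩ := hf
    simpa [linT] using stiefelAvg_lin_pow_mem_invariants hm (c + d) i j c d rfl
  | zero => exact invariants_of_eq_zero fun z w => by simp
  | add f g _ _ hf hg =>
    have := Submodule.add_mem _ hf hg
    convert! this using 1
    ext z w; simp
  | smul c f _ hf =>
    have := Submodule.smul_mem _ c hf
    convert! this using 1
    ext z w; simp

theorem one_mem_stiefelForms : (fun _ _ => 1) ∈ stiefelForms m 0 0 :=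
  Submodule.subset_span ⟨0, 0, 0, 0, rfl, rfl, by ext; simp⟩

theorem mul_mem_stiefelForms_left {a b : ℕ} (α β : ℂ)
    {f g : (Fin m → ℂ) → (Fin m → ℂ) → MvPolynomial (Fin m ⊕ Fin m) ℂ}
    (hf : f ∈ stiefelForms m a b) (hg : ∀ z w, g z w = (α • linT z + β • linS z) * f z w) :
    g ∈ stiefelForms m (a + 1) b := by
  obtain rfl : g = fun z w => (α • linT z + β • linS z) * f z w := by
    funext z w; exact hg z w
  clear hg
  induction hf using Submodule.span_induction with
  | mem f hf =>
    obtain ⟨i, j, c, d, rfl, rfl, rfl⟩ := hf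
    have h1 : (fun z w => linT z ^ (i + 1) * linT w ^ j * (linS z ^ c * linS w ^ d)) ∈
      stiefelForms m (i + c + 1) (j + d) :=
      Submodule.subset_span ⟨i + 1, j, c, d, by omega, rfl, rfl⟩
    have h2 : (fun z w => linT z ^ i * linT w ^ j * (linS z ^ (c + 1) * linS w ^ d)) ∈
      stiefelForms m (i + c + 1) (j + d) :=
      Submodule.subset_span ⟨i, j, c + 1, d, by omega, rfl, rfl⟩
    convert! Submodule.add_mem _ (Submodule.smul_mem _ α h1) (Submodule.smul_mem _ β h2) using 1
    funext z w
    simp only [Pi.add_apply, Pi.smul_apply, smul_eq_C_mul]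
    ring
  | zero =>
    convert! Submodule.zero_mem _ using 1
    funext z w; simp
  | add f g _ _ hf hg =>
    convert! Submodule.add_mem _ hf hg using 1
    funext z w; simp only [Pi.add_apply]; ring
  | smul c f _ hf =>
    convert! Submodule.smul_mem _ c hf using 1
    funext z w; simp only [Pi.smul_apply, mul_smul_comm]

theorem mul_mem_stiefelForms_right {a b : ℕ} (α β : ℂ)
    {f g : (Fin m → ℂ) → (Fin m → ℂ) → MvPolynomial (Fin m ⊕ Fin m) ℂ}
    (hf : f ∈ stiefelForms m a b) (hg : ∀ z w, g z w = (α • linT w + β • linS w) * f z w) :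
    g ∈ stiefelForms m a (b + 1) := by
  obtain rfl : g = fun z w => (α • linT w + β • linS w) * f z w := by
    funext z w; exact hg z w
  clear hg
  induction hf using Submodule.span_induction with
  | mem f hf =>
    obtain ⟨i, j, c, d, rfl, rfl, rfl⟩ := hf
    have h1 : (fun z w => linT z ^ i * linT w ^ (j + 1) * (linS z ^ c * linS w ^ d)) ∈
      stiefelForms m (i + c) (j + d + 1) :=
      Submodule.subset_span ⟨i, j + 1, c, d, rfl, by omega, rfl⟩
    have h2 : (fun z w => linT z ^ i * linT w ^ j * (linS z ^ c * linS w ^ (d + 1))) ∈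
      stiefelForms m (i + c) (j + d + 1) :=
      Submodule.subset_span ⟨i, j, c, d + 1, rfl, by omega, rfl⟩
    convert! Submodule.add_mem _ (Submodule.smul_mem _ α h1) (Submodule.smul_mem _ β h2) using 1
    funext z w
    simp only [Pi.add_apply, Pi.smul_apply, smul_eq_C_mul]
    ring
  | zero =>
    convert! Submodule.zero_mem _ using 1
    funext z w; simp
  | add f g _ _ hf hg =>
    convert! Submodule.add_mem _ hf hg using 1
    funext z w; simp only [Pi.add_apply]; ring
  | smul c f _ hf =>
    convert! Submodule.smul_mem _ c hf using 1
    funext z w; simp only [Pi.smul_apply, mul_smul_comm]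

/-- `⟨z, τ⟩` as a polynomial in `(t, s)`. -/
def linTau (z : Fin m → ℂ) : MvPolynomial (Fin m ⊕ Fin m) ℂ :=
  (1 : ℂ) • linT z + Complex.I • linS z

/-- `⟨z, τ†⟩` as a polynomial in `(t, s)`. -/
def linDag (z : Fin m → ℂ) : MvPolynomial (Fin m ⊕ Fin m) ℂ :=
  (-1 : ℂ) • linT z + Complex.I • linS z

/-- The forms ⟨z,τ⟩ and ⟨z,τ†⟩ are combinations of ⟨z,t⟩ and ⟨z,s⟩, so multiplying by one of them
raises a single index of the bidegree by one. -/
theorem linTau_pow_mul_linDag_pow_mem (k l k' l' : ℕ) :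
    (fun z w : Fin m → ℂ => linTau z ^ k * (linDag z ^ l * (linDag w ^ k' * linTau w ^ l'))) ∈
      stiefelForms m (k + l) (k' + l') := by
  induction k with
  | zero =>
    rw [Nat.zero_add]
    induction l with
    | zero =>
      induction k' with
      | zero =>
        rw [Nat.zero_add]
        induction l' with
        | zero => simpa only [pow_zero, mul_one] using one_mem_stiefelForms
        | succ l' ih =>
          exact mul_mem_stiefelForms_right 1 Complex.I ih fun z w => by rw [← linTau]; ring
      | succ k' ih =>
        rw [Nat.succ_add]
        exact mul_mem_stiefelForms_right (-1) Complex.I ih fun z w => by rw [← linDag]; ring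
    | succ l ih =>
      exact mul_mem_stiefelForms_left (-1) Complex.I ih fun z w => by rw [← linDag]; ring
  | succ k ih =>
    rw [Nat.succ_add]
    exact mul_mem_stiefelForms_left 1 Complex.I ih fun z w => by rw [← linTau]; ring

/-- The polynomial `|x|²`. -/
def normSq (m : ℕ) : MvPolynomial (Fin m) ℂ := ∑ j, X j ^ 2

theorem eval_normSq (x : Fin m → ℂ) : eval x (normSq m) = x ⬝ᵥ x := by
  simp [normSq, dotProduct, sq]

theorem sphAvg_congr {p q : MvPolynomial (Fin m) ℂ}
    (h : ∀ t : E m, ‖t‖ = 1 → eval (toC t) p = eval (toC t) q) : sphAvg m p = sphAvg m q := by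
  rw [sphAvg_apply, sphAvg_apply]
  congr 2
  ext t; exact h t (by simp)

/-- An invariant kernel of bidegree `(d + 2n, d + 2n)` acts on harmonics of degree `d` as a multiple
of `⟨z, z⟩^n`. -/
theorem exists_invariants_eigenvalue (hm : 3 ≤ m) (d n : ℕ)
    {F : (Fin m → ℂ) → (Fin m → ℂ) → ℂ} (hF : F ∈ invariants m (d + 2 * n) (d + 2 * n)) :
    ∃ c : ℂ, ∀ (H : MvPolynomial (Fin m) ℂ) (z : Fin m → ℂ), IsHarmonic d H →
      ∃ Q : MvPolynomial (Fin m) ℂ, (∀ y, eval y Q = F z y * eval y H) ∧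
        sphAvg m Q = c * (z ⬝ᵥ z) ^ n * eval z H := by
  have hΛ := isSphericalMean_sphAvg hm
  induction hF using Submodule.span_induction with
  | mem F hF =>
    obtain ⟨i, j, h, h1, h2, rfl⟩ := hF
    -- Equal bidegrees force the powers of ⟨z,z⟩ and ⟨w,w⟩ to agree. On the unit sphere the latter
    -- is 1, which leaves (z·w)^j with j = d + 2(n - h): Funk-Hecke applies if h ≤ n, orthogonality
    -- otherwise.
    obtain rfl : h = i := by omega
    have key : ∀ (H : MvPolynomial (Fin m) ℂ) (z : Fin m → ℂ),
        sphAvg m ((z ⬝ᵥ z) ^ h • (lin z ^ j * H * normSq m ^ h)) =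
          (z ⬝ᵥ z) ^ h * sphAvg m (lin z ^ j * H) := by
      intro H z
      rw [map_smul, smul_eq_mul]
      congr 1
      refine sphAvg_congr fun t ht => ?_
      rw [map_mul _ _ (normSq m ^ h), map_pow _ (normSq m), eval_normSq, toC_dotProduct,
        real_inner_self_eq_norm_sq, ht]
      simp
    have hQ : ∀ (H : MvPolynomial (Fin m) ℂ) (z y : Fin m → ℂ),
        eval y ((z ⬝ᵥ z) ^ h • (lin z ^ j * H * normSq m ^ h)) =
          (z ⬝ᵥ z) ^ h * (z ⬝ᵥ y) ^ j * (y ⬝ᵥ y) ^ h * eval y H := by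
      intro H z y
      simp only [smul_eval, map_mul, map_pow, eval_lin, eval_normSq]
      ring
    by_cases hn : h ≤ n
    · refine ⟨kappa m d (n - h), fun H z hH => ⟨_, hQ H z, ?_⟩⟩
      rw [key, hΛ.funkHecke (by omega) z j d (n - h) H hH (by omega)]
      obtain ⟨e, rfl⟩ := Nat.exists_eq_add_of_le hn
      rw [Nat.add_sub_cancel_left, pow_add]
      ring
    · refine ⟨0, fun H z hH => ⟨_, hQ H z, ?_⟩⟩
      rw [key, hΛ.funkHecke_eq_zero (by omega) z j d H hH (by omega)]
      ring
  | zero => exact ⟨0, fun H z _ => ⟨0, by simp, by simp⟩⟩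
  | add F G _ _ hF hG =>
    obtain ⟨c, hc⟩ := hF
    obtain ⟨c', hc'⟩ := hG
    refine ⟨c + c', fun H z hH => ?_⟩
    obtain ⟨Q, h1, h2⟩ := hc H z hH
    obtain ⟨Q', h1', h2'⟩ := hc' H z hH
    exact ⟨Q + Q', fun y => by simp [h1, h1', add_mul], by rw [map_add, h2, h2']; ring⟩
  | smul a F _ hF =>
    obtain ⟨c, hc⟩ := hF
    refine ⟨a * c, fun H z hH => ?_⟩
    obtain ⟨Q, h1, h2⟩ := hc H z hH
    exact ⟨a • Q, fun y => by simp [h1, mul_assoc], by rw [map_smul, h2, smul_eq_mul]; ring⟩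

/-- The vector `τ` of complex `(t, s)`. -/
def tauOf (x : Fin m ⊕ Fin m → ℂ) : Fin m → ℂ := fun j => x (Sum.inl j) + Complex.I * x (Sum.inr j)

/-- The vector `τ†` of complex `(t, s)`. -/
def dagOf (x : Fin m ⊕ Fin m → ℂ) : Fin m → ℂ := fun j => -x (Sum.inl j) + Complex.I * x (Sum.inr j)

theorem eval_linTau (x : Fin m ⊕ Fin m → ℂ) (z : Fin m → ℂ) :
    eval x (linTau z) = z ⬝ᵥ tauOf x := by
  simp only [linTau, linT, linS, map_add, smul_eval, eval_rename, eval_lin, dotProduct, tauOf,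
    Finset.mul_sum, ← Finset.sum_add_distrib, Function.comp]
  exact Finset.sum_congr rfl fun j _ => by ring

theorem eval_linDag (x : Fin m ⊕ Fin m → ℂ) (z : Fin m → ℂ) :
    eval x (linDag z) = z ⬝ᵥ dagOf x := by
  simp only [linDag, linT, linS, map_add, smul_eval, eval_rename, eval_lin, dotProduct, dagOf,
    Finset.mul_sum, ← Finset.sum_add_distrib, Function.comp]
  exact Finset.sum_congr rfl fun j _ => by ring

/-- `⟨ω, τ⟩` as a polynomial in `(t, s, ω)`. -/
def pairTau (m : ℕ) : MvPolynomial ((Fin m ⊕ Fin m) ⊕ Fin m) ℂ :=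
  ∑ j, rename Sum.inl (linTau (Pi.single j 1)) * X (Sum.inr j)

/-- `⟨ω, τ†⟩` as a polynomial in `(t, s, ω)`. -/
def pairDag (m : ℕ) : MvPolynomial ((Fin m ⊕ Fin m) ⊕ Fin m) ℂ :=
  ∑ j, rename Sum.inl (linDag (Pi.single j 1)) * X (Sum.inr j)

theorem evalR_X_inr {σ τ : Type*} (y : τ → ℂ) (j : τ) :
    evalR (σ := σ) y (X (Sum.inr j)) = C (y j) := by simp [evalR]

theorem evalL_X_inr {σ τ : Type*} (x : σ → ℂ) (j : τ) :
    evalL x (X (Sum.inr j)) = X j := by simp [evalL]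

theorem evalR_pairTau (y : Fin m → ℂ) : evalR y (pairTau m) = linTau y := by
  refine MvPolynomial.funext fun x => ?_
  simp only [pairTau, map_sum, map_mul, evalR_rename_inl, evalR_X_inr, eval_linTau, eval_C,
    single_one_dotProduct]
  simp [dotProduct, mul_comm]

theorem evalR_pairDag (y : Fin m → ℂ) : evalR y (pairDag m) = linDag y := by
  refine MvPolynomial.funext fun x => ?_
  simp only [pairDag, map_sum, map_mul, evalR_rename_inl, evalR_X_inr, eval_linDag, eval_C,
    single_one_dotProduct]
  simp [dotProduct, mul_comm]

theorem evalL_pairTau (x : Fin m ⊕ Fin m → ℂ) : evalL x (pairTau m) = lin (tauOf x) := by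
  simp only [pairTau, map_sum, map_mul, evalL_rename_inl, evalL_X_inr, eval_linTau,
    single_one_dotProduct, lin]

theorem evalL_pairDag (x : Fin m ⊕ Fin m → ℂ) : evalL x (pairDag m) = lin (dagOf x) := by
  simp only [pairDag, map_sum, map_mul, evalL_rename_inl, evalL_X_inr, eval_linDag,
    single_one_dotProduct, lin]

/-- The polynomial `⟨z, τ⟩^k ⟨z, τ†⟩^l ⟨ω, τ†⟩^k ⟨ω, τ⟩^l H(ω)` in `(t, s, ω)`. -/
def kernelPoly (k l : ℕ) (z : Fin m → ℂ) (H : MvPolynomial (Fin m) ℂ) :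
    MvPolynomial ((Fin m ⊕ Fin m) ⊕ Fin m) ℂ :=
  rename Sum.inl (linTau z ^ k * linDag z ^ l) * (pairDag m ^ k * pairTau m ^ l) *
    rename Sum.inr H

theorem evalL_kernelPoly (k l : ℕ) (z : Fin m → ℂ) (H : MvPolynomial (Fin m) ℂ)
    (x : Fin m ⊕ Fin m → ℂ) : evalL x (kernelPoly k l z H) =
      ((z ⬝ᵥ tauOf x) ^ k * (z ⬝ᵥ dagOf x) ^ l) •
        (lin (dagOf x) ^ k * lin (tauOf x) ^ l * H) := by
  simp only [kernelPoly, map_mul (evalL x), map_pow (evalL x), evalL_rename_inl, evalL_rename_inr,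
    evalL_pairTau, evalL_pairDag, map_mul (eval x), map_pow (eval x), eval_linTau, eval_linDag,
    smul_eq_C_mul]
  ring

/-- The average over `(t, s)` of `⟨z, τ⟩^k ⟨z, τ†⟩^l ∫ ⟨ω, τ†⟩^k ⟨ω, τ⟩^l H(ω) dω` is a multiple of
`⟨z, z⟩^n H(z)`. -/
theorem exists_stiefelAvg_eigenvalue (hm : 3 ≤ m) (d n k l : ℕ) (hkl : k + l = d + 2 * n) :
    ∃ c : ℂ, ∀ (H : MvPolynomial (Fin m) ℂ) (z : Fin m → ℂ), IsHarmonic d H →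
      ∀ R : MvPolynomial (Fin m ⊕ Fin m) ℂ,
        (∀ x, eval x R = sphAvg m (evalL x (kernelPoly k l z H))) →
        stiefelAvg hm R = c * (z ⬝ᵥ z) ^ n * eval z H := by
  have h1 := stiefelAvg_mem_invariants hm (linTau_pow_mul_linDag_pow_mem (m := m) k l k l)
  rw [hkl] at h1
  obtain ⟨c, hc⟩ := exists_invariants_eigenvalue hm d n h1
  refine ⟨c, fun H z hH R hR => ?_⟩
  obtain ⟨Q, hQ1, hQ2⟩ := hc H z hH
  -- Exchanging the two averages: averaging over (t, s) first turns the product of linear forms into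
  -- an invariant kernel, which is then integrated against H.
  obtain ⟨Q', R', h2, h3, h4⟩ := exists_slice (stiefelAvg hm) (sphAvg m) (kernelPoly k l z H)
  have e1 : R' = R := MvPolynomial.funext fun x => by rw [h3, hR]
  have e2 : Q' = Q := MvPolynomial.funext fun y => by
    rw [h2, hQ1]
    simp only [kernelPoly, map_mul (evalR y), map_pow (evalR y), evalR_rename_inl,
      evalR_rename_inr, evalR_pairTau, evalR_pairDag]
    rw [mul_comm _ (C _), ← smul_eq_C_mul, map_smul, smul_eq_mul, mul_comm]
    congr 2; ring
  rw [← e1, ← h4, e2, hQ2]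

end Universality
-- Two summation formulas by telescoping.
section Hypergeometric

/-- The terms of a balanced terminating `₃F₂` at `1`. -/
def saalTerm (L : ℝ) (n p q j : ℕ) : ℝ :=
  (-1) ^ j * (p + q + n - j).factorial * Real.Gamma ((p : ℝ) + q - j + L) /
    (j.factorial * (p - j).factorial * (q - j).factorial *
      Real.Gamma (L + 1 + ((p : ℝ) + q + n - j)))

/-- A Zeilberger-type certificate for p = j + 1 + f and q = j + e. The combination of terms for q +
1 and q that the closed form suggests is the difference G(j + 1) - G(j), where G(j) = (j - (p + 2q +
L + n + 2)) j times the term for q + 1. -/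
theorem saalTerm_telescope {L : ℝ} (hL : 0 < L) (n e f j : ℕ) :
    ((j + e : ℕ) + 1 : ℝ) * (L + 1 + (j + 1 + f : ℕ) + (j + e : ℕ) + n) *
        saalTerm L n (j + 1 + f) (j + e + 1) j -
      ((j + e : ℕ) + 1 + n : ℝ) * (L + (j + e : ℕ)) * saalTerm L n (j + 1 + f) (j + e) j =
      (((j + 1 : ℕ) : ℝ) - ((j + 1 + f : ℕ) + 2 * (j + e : ℕ) + L + n + 2)) * (j + 1 : ℕ) *
          saalTerm L n (j + 1 + f) (j + e + 1) (j + 1) -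
        ((j : ℝ) - ((j + 1 + f : ℕ) + 2 * (j + e : ℕ) + L + n + 2)) * j *
          saalTerm L n (j + 1 + f) (j + e + 1) j := by
  unfold saalTerm
  set y : ℝ := j + 1 + f + e + L with hy
  set w : ℝ := L + 1 + (j + 1 + f + e + n) with hw
  have hypos : 0 < y := by positivity
  have hwpos : 0 < w := by positivity
  have g1 : Real.Gamma (((j + 1 + f : ℕ) : ℝ) + (j + e + 1 : ℕ) - j + L) = y * Real.Gamma y := by
    rw [← Real.Gamma_add_one hypos.ne']; congr 1; rw [hy]; push_cast; ring
  have g2 : Real.Gamma (((j + 1 + f : ℕ) : ℝ) + (j + e : ℕ) - j + L) = Real.Gamma y := by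
    congr 1; rw [hy]; push_cast; ring
  have g3 : Real.Gamma (((j + 1 + f : ℕ) : ℝ) + (j + e + 1 : ℕ) - (j + 1 : ℕ) + L) =
      Real.Gamma y := by
    congr 1; rw [hy]; push_cast; ring
  have g4 : Real.Gamma (L + 1 + (((j + 1 + f : ℕ) : ℝ) + (j + e + 1 : ℕ) + n - j)) =
      w * Real.Gamma w := by
    rw [← Real.Gamma_add_one hwpos.ne']; congr 1; rw [hw]; push_cast; ring
  have g5 : Real.Gamma (L + 1 + (((j + 1 + f : ℕ) : ℝ) + (j + e : ℕ) + n - j)) =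
      Real.Gamma w := by
    congr 1; rw [hw]; push_cast; ring
  have g6 : Real.Gamma (L + 1 + (((j + 1 + f : ℕ) : ℝ) + (j + e + 1 : ℕ) + n - (j + 1 : ℕ))) =
      Real.Gamma w := by
    congr 1; rw [hw]; push_cast; ring
  rw [g1, g2, g3, g4, g5, g6,
    show j + 1 + f + (j + e + 1) + n - j = (j + 1 + f + e + n) + 1 by omega,
    show j + 1 + f + (j + e) + n - j = j + 1 + f + e + n by omega,
    show j + 1 + f + (j + e + 1) + n - (j + 1) = j + 1 + f + e + n by omega,
    show j + 1 + f - j = f + 1 by omega, show j + 1 + f - (j + 1) = f by omega,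
    show j + e + 1 - j = e + 1 by omega, show j + e - j = e by omega,
    show j + e + 1 - (j + 1) = e by omega]
  have G1 : Real.Gamma y ≠ 0 := (Real.Gamma_pos_of_pos hypos).ne'
  have G2 : Real.Gamma w ≠ 0 := (Real.Gamma_pos_of_pos hwpos).ne'
  simp only [Nat.factorial_succ (j + 1 + f + e + n), Nat.factorial_succ f, Nat.factorial_succ e,
    Nat.factorial_succ j]
  have hyw : y = w - 1 - 1 - n + 1 := by rw [hy, hw]; ring
  push_cast
  have F1 : ((j + 1 + f + e + n).factorial : ℝ) ≠ 0 := by positivity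
  have e1 : (-1 : ℝ) ^ (j + 1) = -(-1) ^ j := by ring
  rw [e1]
  have F0 : (-1 : ℝ) ^ j ≠ 0 := pow_ne_zero _ (by norm_num)
  generalize ((j + 1 + f + e + n).factorial : ℝ) = A at *
  generalize (-1 : ℝ) ^ j = s at *
  field_simp
  rw [hy, hw]
  ring

/-- The **Pfaff-Saalschütz** summation formula. -/
theorem sum_saalTerm {L : ℝ} (hL : 0 < L) (n p q : ℕ) (hqp : q ≤ p) :
    ∑ j ∈ Finset.range (q + 1), saalTerm L n p q j =
      (p + n).factorial * (q + n).factorial * Real.Gamma (L + p) * Real.Gamma (L + q) /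
        (p.factorial * q.factorial * n.factorial * Real.Gamma L *
          Real.Gamma (L + 1 + (p + q + n))) := by
  induction q with
  | zero =>
    have h1 : Real.Gamma L ≠ 0 := (Real.Gamma_pos_of_pos hL).ne'
    simp only [saalTerm, zero_add, Finset.sum_range_one, Nat.factorial_zero, pow_zero, Nat.cast_zero,
      add_zero, sub_zero, Nat.sub_zero, Nat.cast_one]
    rw [add_comm (p : ℝ) L]
    field_simp
  | succ q ih =>
    have ih := ih (by omega)
    have hc : ((q : ℝ) + 1) * (L + 1 + p + q + n) ≠ 0 := by positivity
    have key : ((q : ℝ) + 1) * (L + 1 + p + q + n) *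
        ∑ j ∈ Finset.range (q + 1 + 1), saalTerm L n p (q + 1) j =
        ((q : ℝ) + 1 + n) * (L + q) * ∑ j ∈ Finset.range (q + 1), saalTerm L n p q j := by
      have tel := Finset.sum_range_sub (fun j : ℕ =>
        ((j : ℝ) - (p + 2 * q + L + n + 2)) * j * saalTerm L n p (q + 1) j) (q + 1)
      -- The term j = q + 1 exists only in the longer sum. It is split off because truncated
      -- subtraction would give a spurious term for q; the boundary value of the certificate cancels
      -- it.
      rw [Finset.sum_range_succ, mul_add, Finset.mul_sum, Finset.mul_sum, ← sub_eq_zero,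
        add_sub_right_comm, ← Finset.sum_sub_distrib]
      have : ∀ j ∈ Finset.range (q + 1), ((q : ℝ) + 1) * (L + 1 + p + q + n) *
          saalTerm L n p (q + 1) j - ((q : ℝ) + 1 + n) * (L + q) * saalTerm L n p q j =
          (((j + 1 : ℕ) : ℝ) - (p + 2 * q + L + n + 2)) * (j + 1 : ℕ) *
            saalTerm L n p (q + 1) (j + 1) -
          ((j : ℝ) - (p + 2 * q + L + n + 2)) * j * saalTerm L n p (q + 1) j := by
        intro j hj
        have hj := Finset.mem_range.1 hj
        obtain ⟨e, rfl⟩ := Nat.exists_eq_add_of_le (show j ≤ q by omega)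
        obtain ⟨f, rfl⟩ := Nat.exists_eq_add_of_le (show j + 1 ≤ p by omega)
        exact saalTerm_telescope hL n e f j
      rw [Finset.sum_congr rfl this, tel]
      push_cast
      ring
    rw [ih] at key
    refine mul_left_cancel₀ hc (key.trans ?_)
    have e1 : Real.Gamma (L + (q + 1 : ℕ)) = (L + q) * Real.Gamma (L + q) := by
      rw [← Real.Gamma_add_one (by positivity)]; congr 1; push_cast; ring
    have e2 : Real.Gamma (L + 1 + (p + (q + 1 : ℕ) + n)) =
        (L + 1 + (p + q + n)) * Real.Gamma (L + 1 + (p + q + n)) := by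
      rw [← Real.Gamma_add_one (by positivity)]; congr 1; push_cast; ring
    have h1 : Real.Gamma L ≠ 0 := (Real.Gamma_pos_of_pos hL).ne'
    have h2 : Real.Gamma (L + 1 + (p + q + n)) ≠ 0 := (Real.Gamma_pos_of_pos (by positivity)).ne'
    rw [e1, e2, show q + 1 + n = (q + n) + 1 by ring, Nat.factorial_succ (q + n),
      Nat.factorial_succ q]
    push_cast
    field_simp
    ring

/-- The coefficients of the zonal harmonics (Gegenbauer polynomials). -/
def zonalCoeff (L : ℝ) (d j : ℕ) : ℝ :=
  (-1) ^ j * Real.Gamma ((d : ℝ) - j + L) / (4 ^ j * j.factorial * (d - 2 * j).factorial)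

/-- The telescoping certificate, -4j times the coefficient in degree d + 1, for the first-order
recursion in d satisfied by the values at the pole. -/
theorem zonalCoeff_telescope {L : ℝ} (hL : 0 < L) (j e : ℕ) :
    2 * ((2 * j + 1 + e : ℕ) + 1 : ℝ) * zonalCoeff L (2 * j + 1 + e + 1) j -
      (2 * L + (2 * j + 1 + e : ℕ)) * zonalCoeff L (2 * j + 1 + e) j =
    (-4) * (j + 1 : ℕ) * zonalCoeff L (2 * j + 1 + e + 1) (j + 1) -
      (-4) * j * zonalCoeff L (2 * j + 1 + e + 1) j := by
  unfold zonalCoeff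
  set y : ℝ := j + 1 + e + L with hy
  have hypos : 0 < y := by positivity
  have g1 : Real.Gamma (((2 * j + 1 + e + 1 : ℕ) : ℝ) - j + L) = y * Real.Gamma y := by
    rw [← Real.Gamma_add_one hypos.ne']; congr 1; rw [hy]; push_cast; ring
  have g2 : Real.Gamma (((2 * j + 1 + e : ℕ) : ℝ) - j + L) = Real.Gamma y := by
    congr 1; rw [hy]; push_cast; ring
  have g3 : Real.Gamma (((2 * j + 1 + e + 1 : ℕ) : ℝ) - (j + 1 : ℕ) + L) = Real.Gamma y := by
    congr 1; rw [hy]; push_cast; ring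
  rw [g1, g2, g3, show 2 * j + 1 + e + 1 - 2 * j = e + 1 + 1 by omega,
    show 2 * j + 1 + e - 2 * j = e + 1 by omega,
    show 2 * j + 1 + e + 1 - 2 * (j + 1) = e by omega]
  have G1 : Real.Gamma y ≠ 0 := (Real.Gamma_pos_of_pos hypos).ne'
  simp only [Nat.factorial_succ (e + 1), Nat.factorial_succ e, Nat.factorial_succ j]
  push_cast
  rw [pow_succ (-1 : ℝ), pow_succ (4 : ℝ)]
  field_simp
  rw [hy]
  ring

theorem sum_zonalCoeff_succ {L : ℝ} (hL : 0 < L) (d : ℕ) :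
    2 * ((d : ℝ) + 1) * ∑ j ∈ Finset.range ((d + 1) / 2 + 1), zonalCoeff L (d + 1) j =
      (2 * L + d) * ∑ j ∈ Finset.range (d / 2 + 1), zonalCoeff L d j := by
  have tel := Finset.sum_range_sub (fun j : ℕ => (-4 : ℝ) * j * zonalCoeff L (d + 1) j)
  have pt : ∀ j, 2 * j + 1 ≤ d → 2 * ((d : ℝ) + 1) * zonalCoeff L (d + 1) j -
      (2 * L + d) * zonalCoeff L d j = (-4) * (j + 1 : ℕ) * zonalCoeff L (d + 1) (j + 1) -
      (-4) * j * zonalCoeff L (d + 1) j := by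
    intro j hj
    obtain ⟨e, rfl⟩ := Nat.exists_eq_add_of_le hj
    exact zonalCoeff_telescope hL j e
  -- The summation range grows only when d is odd. For even d the certificate fails to cover the top
  -- term of both sums; for odd d it misses only the new term. The boundary value of the certificate
  -- accounts for either.
  rcases Nat.even_or_odd' d with ⟨K, rfl | rfl⟩
  · rw [show (2 * K + 1) / 2 = K by omega, show 2 * K / 2 = K by omega, ← sub_eq_zero,
      Finset.mul_sum, Finset.mul_sum, ← Finset.sum_sub_distrib, Finset.sum_range_succ,
      Finset.sum_congr rfl fun j hj => pt j (by have := Finset.mem_range.1 hj; omega), tel K]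
    have hy : (0 : ℝ) < K + L := by positivity
    have g1 : Real.Gamma (((2 * K + 1 : ℕ) : ℝ) - K + L) = (K + L) * Real.Gamma (K + L) := by
      rw [← Real.Gamma_add_one hy.ne']; congr 1; push_cast; ring
    have g2 : Real.Gamma (((2 * K : ℕ) : ℝ) - K + L) = Real.Gamma (K + L) := by
      congr 1; push_cast; ring
    rw [Nat.cast_zero, mul_zero, zero_mul, sub_zero, zonalCoeff, zonalCoeff, g1, g2,
      show 2 * K + 1 - 2 * K = 1 by omega, Nat.sub_self]
    push_cast
    simp only [Nat.factorial]
    field_simp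
    push_cast
    ring
  · rw [show (2 * K + 1 + 1) / 2 = K + 1 by omega, show (2 * K + 1) / 2 = K by omega,
      ← sub_eq_zero, Finset.sum_range_succ, mul_add, Finset.mul_sum, Finset.mul_sum,
      add_sub_right_comm, ← Finset.sum_sub_distrib,
      Finset.sum_congr rfl fun j hj => pt j (by have := Finset.mem_range.1 hj; omega), tel (K + 1)]
    push_cast
    ring

/-- The value of the zonal harmonic at the pole. -/
theorem sum_zonalCoeff {L : ℝ} (hL : 0 < L) (d : ℕ) :
    ∑ j ∈ Finset.range (d / 2 + 1), zonalCoeff L d j =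
      Real.Gamma L * Real.Gamma (2 * L + d) / (2 ^ d * d.factorial * Real.Gamma (2 * L)) := by
  have h2 : Real.Gamma (2 * L) ≠ 0 := (Real.Gamma_pos_of_pos (by positivity)).ne'
  induction d with
  | zero => simp [zonalCoeff]; field_simp
  | succ d ih =>
    have h := sum_zonalCoeff_succ hL d
    rw [ih] at h
    have hc : 2 * ((d : ℝ) + 1) ≠ 0 := by positivity
    refine mul_left_cancel₀ hc (h.trans ?_)
    have e1 : Real.Gamma (2 * L + (d + 1 : ℕ)) = (2 * L + d) * Real.Gamma (2 * L + d) := by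
      rw [← Real.Gamma_add_one (by positivity)]; congr 1; push_cast; ring
    rw [e1, Nat.factorial_succ]
    push_cast
    field_simp
    ring

end Hypergeometric

/-! ### Zonal harmonics as explicit polynomials. -/

section Zonal

open MvPolynomial

variable {m : ℕ}

theorem lap_C_mul (c : ℂ) (p : MvPolynomial (Fin m) ℂ) : lap (C c * p) = C c * lap p := by
  simp only [lap, pderiv_C_mul, Finset.mul_sum]

theorem lap_sum {ι : Type*} (s : Finset ι) (p : ι → MvPolynomial (Fin m) ℂ) :
    lap (∑ i ∈ s, p i) = ∑ i ∈ s, lap (p i) := by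
  simp only [lap, map_sum]
  exact Finset.sum_comm

theorem isHomogeneous_normSq : (normSq m).IsHomogeneous 2 :=
  IsHomogeneous.sum _ _ _ fun j _ => by simpa using (isHomogeneous_X ℂ j).pow 2

theorem lap_mul_normSq {p : MvPolynomial (Fin m) ℂ} {a : ℕ} (hp : p.IsHomogeneous a) :
    lap (p * normSq m) = lap p * normSq m + C (4 * a + 2 * m : ℂ) * p := by
  have h1 : ∀ j, pderiv j (normSq m) = C 2 * X j := by
    intro j
    rw [normSq, map_sum, Finset.sum_eq_single j]
    · rw [pderiv_pow, pderiv_X_self]; simp [map_ofNat]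
    · intro k _ hk; rw [pderiv_pow, pderiv_X_of_ne hk]; simp
    · simp
  have h2 : ∀ j, pderiv j (pderiv j (p * normSq m)) =
      pderiv j (pderiv j p) * normSq m + C 4 * (X j * pderiv j p) + C 2 * p := by
    intro j
    rw [pderiv_mul, map_add, pderiv_mul, pderiv_mul, h1, pderiv_C_mul, pderiv_X_self]
    rw [show (C (4 : ℂ) : MvPolynomial (Fin m) ℂ) = C 2 + C 2 by rw [← C_add]; norm_num]
    ring
  simp only [lap, h2, Finset.sum_add_distrib, ← Finset.sum_mul, ← Finset.mul_sum,
    hp.sum_X_mul_pderiv]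
  rw [Finset.sum_const, Finset.card_univ, Fintype.card_fin, nsmul_eq_mul, nsmul_eq_mul]
  simp only [map_add, map_mul, map_natCast, map_ofNat]
  ring

/-- Iterates the product rule for one factor |x|², whose cross term is evaluated by Euler's
identity; each step sees a degree higher by two. -/
theorem lap_mul_normSq_pow {p : MvPolynomial (Fin m) ℂ} {a : ℕ} (hp : p.IsHomogeneous a) (j : ℕ) :
    lap (p * normSq m ^ (j + 1)) = lap p * normSq m ^ (j + 1) +
      C (2 * (j + 1) * (2 * a + 2 * j + m) : ℂ) * (p * normSq m ^ j) := by
  induction j with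
  | zero =>
    rw [zero_add, pow_one, lap_mul_normSq hp, pow_zero, mul_one]
    congr 3; push_cast; ring
  | succ j ih =>
    have hh : (p * normSq m ^ (j + 1)).IsHomogeneous (a + 2 * (j + 1)) :=
      hp.mul (isHomogeneous_normSq.pow (j + 1))
    rw [pow_succ, ← mul_assoc, lap_mul_normSq hh, ih]
    simp only [map_add, map_mul, map_natCast, map_ofNat, map_one, Nat.cast_add, Nat.cast_mul,
      Nat.cast_ofNat, Nat.cast_one]
    ring

theorem lap_X_pow (i : Fin m) (a : ℕ) :
    lap (X i ^ a : MvPolynomial (Fin m) ℂ) = C ((a * (a - 1 : ℕ) : ℕ) : ℂ) * X i ^ (a - 2) := by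
  rw [lap, Finset.sum_eq_single i]
  · rw [pderiv_pow, pderiv_X_self, mul_one, ← map_natCast C a, pderiv_C_mul, pderiv_pow,
      pderiv_X_self, mul_one, Nat.sub_sub]
    simp only [map_natCast, Nat.cast_mul, map_mul]
    ring
  · intro k _ hk; rw [pderiv_pow, pderiv_X_of_ne hk.symm]; simp
  · simp

/-- The zonal harmonic of degree `d` with pole `e_i`. -/
def zonal (i : Fin m) (d : ℕ) : MvPolynomial (Fin m) ℂ :=
  ∑ j ∈ Finset.range (d / 2 + 1),
    C ((zonalCoeff ((m : ℝ) / 2 - 1) d j : ℝ) : ℂ) * (X i ^ (d - 2 * j) * normSq m ^ j)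

theorem isHarmonic_zonal (hm : 3 ≤ m) (i : Fin m) (d : ℕ) : IsHarmonic d (zonal i d) := by
  refine ⟨IsHomogeneous.sum _ _ _ fun j hj => ?_, ?_⟩
  · have hj := Finset.mem_range.1 hj
    have := (isHomogeneous_C (Fin m) ((zonalCoeff ((m : ℝ) / 2 - 1) d j : ℝ) : ℂ)).mul
      (((isHomogeneous_X ℂ i).pow (d - 2 * j)).mul (isHomogeneous_normSq.pow j))
    convert! this using 1
    omega
  · set L : ℝ := (m : ℝ) / 2 - 1 with hL
    have hm' : (3 : ℝ) ≤ m := by exact_mod_cast hm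
    -- The Laplacian of the j-th summand splits into A j, where it falls on the power of x_i, and B
    -- (j - 1), where it falls on |x|^{2j}. The coefficients are designed so that A j + B j = 0, and
    -- the last A vanishes because the remaining power of x_i is at most 1.
    set A : ℕ → MvPolynomial (Fin m) ℂ := fun j => C ((zonalCoeff L d j : ℝ) : ℂ) *
      (lap (X i ^ (d - 2 * j)) * normSq m ^ j) with hA
    set B : ℕ → MvPolynomial (Fin m) ℂ := fun j => C ((zonalCoeff L d (j + 1) : ℝ) : ℂ) *
      (C (2 * (j + 1) * (2 * (d - 2 * (j + 1) : ℕ) + 2 * j + m) : ℂ) *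
        (X i ^ (d - 2 * (j + 1)) * normSq m ^ j)) with hB
    have h0 : lap (C ((zonalCoeff L d 0 : ℝ) : ℂ) * (X i ^ (d - 2 * 0) * normSq m ^ 0)) = A 0 := by
      simp [hA, lap_C_mul]
    have h1 : ∀ j, lap (C ((zonalCoeff L d (j + 1) : ℝ) : ℂ) *
        (X i ^ (d - 2 * (j + 1)) * normSq m ^ (j + 1))) = A (j + 1) + B j := by
      intro j
      have hX : (X i ^ (d - 2 * (j + 1)) : MvPolynomial (Fin m) ℂ).IsHomogeneous
          (d - 2 * (j + 1)) := by
        simpa using (isHomogeneous_X ℂ i).pow (d - 2 * (j + 1))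
      rw [lap_C_mul, lap_mul_normSq_pow hX, mul_add]
    have hlast : A (d / 2) = 0 := by
      simp only [hA, lap_X_pow]
      have : (d - 2 * (d / 2)) * (d - 2 * (d / 2) - 1) = 0 := by
        have : d - 2 * (d / 2) = 0 ∨ d - 2 * (d / 2) - 1 = 0 := by omega
        rcases this with h | h <;> simp [h]
      rw [this]; simp
    have hcancel : ∀ j, j < d / 2 → A j + B j = 0 := by
      intro j hj
      obtain ⟨e, rfl⟩ : ∃ e, d = 2 * j + 2 + e := ⟨d - (2 * j + 2), by omega⟩
      simp only [hA, hB, lap_X_pow]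
      have e1 : 2 * j + 2 + e - 2 * j = e + 2 := by omega
      have e2 : 2 * j + 2 + e - 2 * (j + 1) = e := by omega
      rw [e1, e2]
      have key : zonalCoeff L (2 * j + 2 + e) j * ((e + 2) * (e + 1)) +
          zonalCoeff L (2 * j + 2 + e) (j + 1) * (2 * (j + 1) * (2 * e + 2 * j + m)) = 0 := by
        rw [zonalCoeff, zonalCoeff, e1, e2]
        have hy : (0 : ℝ) < j + 1 + e + L := by
          have h1 : (0 : ℝ) ≤ j := by positivity
          have h2 : (0 : ℝ) ≤ e := by positivity
          rw [hL]; linarith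
        have g1 : Real.Gamma (((2 * j + 2 + e : ℕ) : ℝ) - j + L) =
            (j + 1 + e + L) * Real.Gamma (j + 1 + e + L) := by
          rw [← Real.Gamma_add_one hy.ne']; congr 1; push_cast; ring
        have g2 : Real.Gamma (((2 * j + 2 + e : ℕ) : ℝ) - (j + 1 : ℕ) + L) =
            Real.Gamma (j + 1 + e + L) := by
          congr 1; push_cast; ring
        rw [g1, g2, Nat.factorial_succ (e + 1), Nat.factorial_succ e, Nat.factorial_succ j,
          show (m : ℝ) = 2 * L + 2 by rw [hL]; ring, pow_succ (-1 : ℝ), pow_succ (4 : ℝ)]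
        push_cast
        field_simp
        ring
      have keyC := congrArg (fun x : ℝ => (C (x : ℂ) : MvPolynomial (Fin m) ℂ)) key
      simp only [Complex.ofReal_add, Complex.ofReal_mul, map_add, map_mul, Complex.ofReal_natCast,
        Complex.ofReal_ofNat, Complex.ofReal_one, Complex.ofReal_zero, map_zero] at keyC
      simp only [map_add, map_mul, Nat.add_sub_cancel,
        Nat.cast_mul, Nat.cast_add, Nat.cast_ofNat, Nat.cast_one,
        show e + 2 - 1 = e + 1 by omega] at keyC ⊢
      linear_combination (X i ^ e * normSq m ^ j) * keyC
    rw [zonal, lap_sum, Finset.sum_range_succ', Finset.sum_congr rfl fun j _ => h1 j, h0,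
      Finset.sum_add_distrib, add_right_comm, ← Finset.sum_range_succ' A, Finset.sum_range_succ,
      hlast, add_zero, ← Finset.sum_add_distrib]
    exact Finset.sum_eq_zero fun j hj => hcancel j (Finset.mem_range.1 hj)

theorem eval_zonal (i : Fin m) (d : ℕ) (x : Fin m → ℂ) : eval x (zonal i d) =
    ∑ j ∈ Finset.range (d / 2 + 1), ((zonalCoeff ((m : ℝ) / 2 - 1) d j : ℝ) : ℂ) *
      (x i ^ (d - 2 * j) * (x ⬝ᵥ x) ^ j) := by
  simp [zonal, eval_normSq]

end Zonal
-- Computation of the eigenvalues on zonal harmonics.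
section Eigenvalue

open MvPolynomial

variable {m : ℕ}

/-- The Funk-Hecke formula for a product of powers of two null linear forms. -/
theorem sphAvg_null_pair (hm : 3 ≤ m) {a b : Fin m → ℂ} (ha : a ⬝ᵥ a = 0) (hb : b ⬝ᵥ b = 0)
    (hab : a ⬝ᵥ b = -2) {d : ℕ} {H : MvPolynomial (Fin m) ℂ} (hH : IsHarmonic d H)
    (g : Polynomial ℂ) (hg : ∀ u, g.eval u = eval (b + u • a) H) (n k l : ℕ)
    (hkl : k + l = d + 2 * n) :
    ((k + l).choose k : ℂ) * sphAvg m (lin a ^ k * lin b ^ l * H) =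
      kappa m d n * ((-4) ^ n * if n ≤ k then g.coeff (k - n) else 0) := by
  -- The generating function in u of all mixed averages is the average of ⟨b + ua, ·⟩^{k+l} H. As a
  -- and b are null, ⟨b + ua, b + ua⟩ = -4u, so Funk-Hecke gives it in closed form; the coefficients
  -- of u^k are then compared.
  set P : Polynomial ℂ := ∑ i ∈ Finset.range (k + l + 1),
    Polynomial.C (((k + l).choose i : ℂ) * sphAvg m (lin a ^ i * lin b ^ (k + l - i) * H)) *
      Polynomial.X ^ i with hP
  have hPQ : P = Polynomial.C (kappa m d n * (-4) ^ n : ℂ) * (g * Polynomial.X ^ n) := by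
    refine Polynomial.funext fun u => ?_
    have h1 := (isSphericalMean_sphAvg hm).funkHecke (by omega) (b + u • a) (k + l) d n H hH hkl
    have h2 : (b + u • a) ⬝ᵥ (b + u • a) = -4 * u := by
      simp only [add_dotProduct, dotProduct_add, smul_dotProduct, dotProduct_smul, ha, hb, hab,
        dotProduct_comm b a, smul_eq_mul]
      ring
    have h3 : sphAvg m (lin (b + u • a) ^ (k + l) * H) = P.eval u := by
      rw [lin_add_smul, add_comm, add_pow, Finset.sum_mul, map_sum, hP, Polynomial.eval_finsetSum]
      refine Finset.sum_congr rfl fun i _ => ?_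
      rw [Polynomial.eval_mul, Polynomial.eval_C, Polynomial.eval_pow, Polynomial.eval_X,
        mul_pow, ← C_pow, ← map_natCast C,
        show C (u ^ i) * lin a ^ i * lin b ^ (k + l - i) * C ((k + l).choose i : ℂ) * H =
          C (u ^ i * (k + l).choose i) * (lin a ^ i * lin b ^ (k + l - i) * H) by
            rw [C_mul]; ring, ← smul_eq_C_mul, map_smul, smul_eq_mul]
      ring
    rw [← h3, h1, h2, Polynomial.eval_mul, Polynomial.eval_mul, Polynomial.eval_C,
      Polynomial.eval_pow, Polynomial.eval_X, hg]
    ring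
  have hc := congrArg (fun p => Polynomial.coeff p k) hPQ
  simp only [hP, Polynomial.finsetSum_coeff, Polynomial.coeff_C_mul_X_pow] at hc
  rw [Finset.sum_eq_single k (fun i _ hi => by simp [Ne.symm hi]) (by simp), if_pos rfl,
    Nat.add_sub_cancel_left, Polynomial.coeff_C_mul, Polynomial.coeff_mul_X_pow'] at hc
  rw [hc]; ring

theorem tauOf_toC (t s : E m) : tauOf (Sum.elim (toC t) (toC s)) = tau t s := by
  ext j; simp [tauOf, tau]

theorem dagOf_toC (t s : E m) : dagOf (Sum.elim (toC t) (toC s)) = dagger (tau t s) := by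
  ext j
  simp only [dagOf, dagger, tau, Sum.elim_inl, Sum.elim_inr, Pi.add_apply, Pi.smul_apply,
    smul_eq_mul, map_add, map_mul, Complex.conj_I, toC, Complex.conj_ofReal]
  ring

theorem dagger_tau (t s : E m) : dagger (tau t s) = -toC t + Complex.I • toC s := by
  rw [← dagOf_toC]; ext j; simp [dagOf]

theorem tau_dotProduct_tau {t s : E m} (ht : ‖t‖ = 1) (hs : ‖s‖ = 1)
    (hts : inner ℝ t s = 0) : tau t s ⬝ᵥ tau t s = 0 := by
  simp only [tau, add_dotProduct, dotProduct_add, smul_dotProduct, dotProduct_smul, toC_dotProduct,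
    real_inner_self_eq_norm_sq, ht, hs, hts, (real_inner_comm t s).trans hts, smul_eq_mul]
  push_cast
  linear_combination Complex.I_mul_I

theorem dagger_dotProduct_dagger {t s : E m} (ht : ‖t‖ = 1) (hs : ‖s‖ = 1)
    (hts : inner ℝ t s = 0) : dagger (tau t s) ⬝ᵥ dagger (tau t s) = 0 := by
  have := tau_dotProduct_tau ht hs hts
  simp only [dagger, dotProduct] at this ⊢
  simp only [neg_mul_neg, ← map_mul, ← map_sum, this, map_zero]

theorem dagger_dotProduct_tau {t s : E m} (ht : ‖t‖ = 1) (hs : ‖s‖ = 1)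
    (hts : inner ℝ t s = 0) : dagger (tau t s) ⬝ᵥ tau t s = -2 := by
  simp only [dagger_tau]
  simp only [tau, add_dotProduct, dotProduct_add, smul_dotProduct, dotProduct_smul, toC_dotProduct,
    real_inner_self_eq_norm_sq, ht, hs, hts, (real_inner_comm t s).trans hts, smul_eq_mul,
    neg_dotProduct]
  push_cast
  linear_combination Complex.I_mul_I

/-- The moments `∫ ⟨z, τ⟩^N ⟨z, τ†⟩^N`. -/
theorem stiefelAvg_linTau_pow_mul_linDag_pow (hm : 3 ≤ m) (N : ℕ) (z : Fin m → ℂ) :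
    stiefelAvg hm (linTau z ^ N * linDag z ^ N) =
      (((-1) ^ N * N.factorial * Real.Gamma ((m : ℝ) / 2) / Real.Gamma ((m : ℝ) / 2 + N) : ℝ) : ℂ) *
        (z ⬝ᵥ z) ^ N := by
  have hmem := stiefelAvg_mem_invariants hm (linTau_pow_mul_linDag_pow_mem (m := m) N N 0 0)
  obtain ⟨c, hc⟩ : ∃ c : ℂ, ∀ z : Fin m → ℂ,
      stiefelAvg hm (linTau z ^ N * linDag z ^ N) = c * (z ⬝ᵥ z) ^ N := by
    have : ∀ F ∈ invariants m (N + N) (0 + 0), ∃ c : ℂ, ∀ z w, F z w = c * (z ⬝ᵥ z) ^ N := by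
      intro F hF
      induction hF using Submodule.span_induction with
      | mem F hF =>
        obtain ⟨i, j, h, h1, h2, rfl⟩ := hF
        obtain ⟨rfl, rfl, rfl⟩ : j = 0 ∧ h = 0 ∧ i = N := by omega
        exact ⟨1, fun z w => by ring⟩
      | zero => exact ⟨0, fun z w => by simp⟩
      | add F G _ _ hF hG =>
        obtain ⟨c, hc⟩ := hF
        obtain ⟨c', hc'⟩ := hG
        exact ⟨c + c', fun z w => by simp [hc, hc', add_mul]⟩
      | smul a F _ hF =>
        obtain ⟨c, hc⟩ := hF
        exact ⟨a * c, fun z w => by simp [hc, mul_assoc]⟩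
    obtain ⟨c, hc⟩ := this _ hmem
    exact ⟨c, fun z => by simpa using hc z 0⟩
  rw [hc z]
  congr 1
  -- The constant c is found by also averaging z over the unit sphere and exchanging the averages.
  -- For a fixed orthonormal pair the average over the sphere is the null-pair formula with H = 1
  -- and k = l = n = N, and it does not depend on the pair.
  obtain ⟨Q, R, h1, h2, h3⟩ := exists_slice (stiefelAvg hm) (sphAvg m)
    (pairDag m ^ N * pairTau m ^ N)
  have hQ : sphAvg m Q = c := by
    have : sphAvg m Q = sphAvg m (C c) := sphAvg_congr fun t ht => by
      rw [h1, map_mul, map_pow, map_pow, evalR_pairTau, evalR_pairDag, mul_comm, hc,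
        toC_dotProduct, real_inner_self_eq_norm_sq, ht]
      simp
    rw [this, ← mul_one (C c), ← smul_eq_C_mul, map_smul, (isSphericalMean_sphAvg hm).one,
      smul_eq_mul, mul_one]
  rw [← hQ, h3]
  set r : ℝ := (-1) ^ N * N.factorial * Real.Gamma ((m : ℝ) / 2) / Real.Gamma ((m : ℝ) / 2 + N)
    with hr
  have hR : stiefelAvg hm R = stiefelAvg hm (C (r : ℂ)) := by
    refine stiefelAvg_congr_eval hm fun t s ht hs hts => ?_
    rw [h2, map_mul, map_pow, map_pow, evalL_pairTau, evalL_pairDag, tauOf_toC, dagOf_toC, eval_C]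
    have h1H : IsHarmonic 0 (1 : MvPolynomial (Fin m) ℂ) :=
      ⟨isHomogeneous_one _ _, by simp [lap]⟩
    have h := sphAvg_null_pair hm (dagger_dotProduct_dagger ht hs hts)
      (tau_dotProduct_tau ht hs hts) (dagger_dotProduct_tau ht hs hts) h1H 1 (by simp) N N N
      (by ring)
    rw [mul_one, if_pos le_rfl, Nat.sub_self, Polynomial.coeff_one_zero, mul_one] at h
    have hch : ((N + N).choose N : ℝ) = (N + N).factorial / (N.factorial * N.factorial) := by
      rw [Nat.add_choose, Nat.cast_div (Nat.factorial_mul_factorial_dvd_factorial_add N N)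
        (by positivity)]
      push_cast; rfl
    have hch0 : ((N + N).choose N : ℂ) ≠ 0 :=
      Nat.cast_ne_zero.2 (Nat.choose_pos (by omega)).ne'
    refine mul_left_cancel₀ hch0 (h.trans ?_)
    have hreal : kappa m 0 N * (-4) ^ N = ((N + N).choose N : ℝ) * r := by
      have hG : Real.Gamma ((m : ℝ) / 2 + N) ≠ 0 :=
        (Real.Gamma_pos_of_pos (by positivity)).ne'
      rw [hch, hr, kappa, show 0 + 2 * N = N + N by ring, pow_add 2 N N, ← mul_pow,
        show (-4 : ℝ) = (-1) * (2 * 2) by norm_num, mul_pow (-1 : ℝ)]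
      push_cast
      rw [add_zero]
      have h22 : ((2 : ℝ) * 2) ^ N ≠ 0 := by positivity
      field_simp
    exact_mod_cast hreal
  rw [hR, ← mul_one (C (r : ℂ)), ← smul_eq_C_mul, map_smul, stiefelAvg_one, smul_eq_mul, mul_one]

theorem coeff_linear_pow (a b : ℂ) (N i : ℕ) :
    ((Polynomial.C b + Polynomial.X * Polynomial.C a) ^ N).coeff i =
      a ^ i * b ^ (N - i) * N.choose i := by
  rw [add_comm, add_pow, Polynomial.finsetSum_coeff]
  have : ∀ k, ((Polynomial.X * Polynomial.C a) ^ k * Polynomial.C b ^ (N - k) *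
      (N.choose k : Polynomial ℂ)).coeff i = if i = k then a ^ k * b ^ (N - k) * N.choose k else 0 := by
    intro k
    rw [mul_pow, ← Polynomial.C_pow, ← Polynomial.C_pow, ← Polynomial.C_eq_natCast, mul_assoc,
      mul_assoc, ← Polynomial.C_mul, ← Polynomial.C_mul, Polynomial.coeff_mul_C,
      Polynomial.coeff_X_pow]
    split_ifs <;> simp [mul_assoc]
  simp only [this]
  rw [Finset.sum_ite_eq]
  split_ifs with h
  · rfl
  · rw [Nat.choose_eq_zero_of_lt (by simpa using h)]; simp

/-- The restriction of the zonal harmonic to the line `b + u a`, as a polynomial in `u`. -/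
def zonalLine (i : Fin m) (d : ℕ) (a b : Fin m → ℂ) : Polynomial ℂ :=
  ∑ j ∈ Finset.range (d / 2 + 1),
    Polynomial.C (((zonalCoeff ((m : ℝ) / 2 - 1) d j : ℝ) : ℂ) * (-4) ^ j) *
      ((Polynomial.C (b i) + Polynomial.X * Polynomial.C (a i)) ^ (d - 2 * j) * Polynomial.X ^ j)

theorem eval_zonalLine (i : Fin m) (d : ℕ) {a b : Fin m → ℂ} (ha : a ⬝ᵥ a = 0)
    (hb : b ⬝ᵥ b = 0) (hab : a ⬝ᵥ b = -2) (u : ℂ) :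
    (zonalLine i d a b).eval u = eval (b + u • a) (zonal i d) := by
  have h2 : (b + u • a) ⬝ᵥ (b + u • a) = -4 * u := by
    simp only [add_dotProduct, dotProduct_add, smul_dotProduct, dotProduct_smul, ha, hb, hab,
      dotProduct_comm b a, smul_eq_mul]
    ring
  rw [eval_zonal, zonalLine, Polynomial.eval_finsetSum, h2]
  refine Finset.sum_congr rfl fun j _ => ?_
  simp only [Polynomial.eval_mul, Polynomial.eval_C, Polynomial.eval_pow, Polynomial.eval_X,
    Polynomial.eval_add, Pi.add_apply, Pi.smul_apply, smul_eq_mul]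
  ring

/-- The sum stops at q: for j > q the power (b_i + u a_i)^{p+q-2j} has degree below p - j, so the
binomial coefficient is zero. -/
theorem coeff_zonalLine (i : Fin m) (p q : ℕ) (hqp : q ≤ p) (a b : Fin m → ℂ) :
    (zonalLine i (p + q) a b).coeff p = ∑ j ∈ Finset.range (q + 1),
      (((zonalCoeff ((m : ℝ) / 2 - 1) (p + q) j : ℝ) : ℂ) * (-4) ^ j) *
        (a i ^ (p - j) * b i ^ (q - j) * (p + q - 2 * j).choose (p - j)) := by
  rw [zonalLine, Polynomial.finsetSum_coeff]
  have hsub : Finset.range (q + 1) ⊆ Finset.range ((p + q) / 2 + 1) :=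
    Finset.range_subset_range.2 (by omega)
  rw [← Finset.sum_subset hsub]
  · refine Finset.sum_congr rfl fun j hj => ?_
    have hj := Finset.mem_range.1 hj
    rw [Polynomial.coeff_C_mul, Polynomial.coeff_mul_X_pow', if_pos (by omega), coeff_linear_pow,
      show p + q - 2 * j - (p - j) = q - j by omega]
  · intro j hj hj'
    have hj := Finset.mem_range.1 hj
    have hj' : ¬ j < q + 1 := fun h => hj' (Finset.mem_range.2 h)
    rw [Polynomial.coeff_C_mul, Polynomial.coeff_mul_X_pow', if_pos (by omega), coeff_linear_pow,
      Nat.choose_eq_zero_of_lt (by omega)]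
    simp

theorem coeff_zonalLine_eq_zero (i : Fin m) (d k : ℕ) (hk : d < k) (a b : Fin m → ℂ) :
    (zonalLine i d a b).coeff k = 0 := by
  rw [zonalLine, Polynomial.finsetSum_coeff]
  refine Finset.sum_eq_zero fun j hj => ?_
  have hj := Finset.mem_range.1 hj
  rw [Polynomial.coeff_C_mul, Polynomial.coeff_mul_X_pow', if_pos (by omega), coeff_linear_pow,
    Nat.choose_eq_zero_of_lt (by omega)]
  simp

/-- Here p = k - n and q = l - n. Up to a common factor the summands are those of the
Pfaff-Saalschütz sum with L = m/2 - 1. The sum on the right is the value at the pole, the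
normalisation to be divided out. -/
theorem zonal_sum_eq_theta (hm : 3 ≤ m) (n p q : ℕ) (hqp : q ≤ p) :
    ∑ j ∈ Finset.range (q + 1),
      (kappa m (p + q) n * (-4) ^ n / ((p + n + (q + n)).choose (p + n)) *
        (zonalCoeff ((m : ℝ) / 2 - 1) (p + q) j * (-4) ^ j * (p + q - 2 * j).choose (p - j))) *
      ((-1) ^ (p + q + n - j) * (p + q + n - j).factorial * Real.Gamma ((m : ℝ) / 2) /
        Real.Gamma ((m : ℝ) / 2 + (p + q + n - j : ℕ))) =
    theta m n (p + n) (q + n) *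
      ∑ j ∈ Finset.range ((p + q) / 2 + 1), zonalCoeff ((m : ℝ) / 2 - 1) (p + q) j := by
  have hm' : (3 : ℝ) ≤ m := by exact_mod_cast hm
  set L : ℝ := (m : ℝ) / 2 - 1 with hL
  have hLpos : 0 < L := by linarith
  have hmL : (m : ℝ) = 2 * L + 2 := by rw [hL]; ring
  have hterm : ∀ j ∈ Finset.range (q + 1),
      (kappa m (p + q) n * (-4) ^ n / ((p + n + (q + n)).choose (p + n)) *
        (zonalCoeff L (p + q) j * (-4) ^ j * (p + q - 2 * j).choose (p - j))) *
      ((-1) ^ (p + q + n - j) * (p + q + n - j).factorial * Real.Gamma ((m : ℝ) / 2) /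
        Real.Gamma ((m : ℝ) / 2 + (p + q + n - j : ℕ))) =
      (kappa m (p + q) n * (-4) ^ n / ((p + n + (q + n)).choose (p + n)) *
        ((-1) ^ (p + q + n) * Real.Gamma ((m : ℝ) / 2))) * saalTerm L n p q j := by
    intro j hj
    have hj := Finset.mem_range.1 hj
    obtain ⟨e, rfl⟩ := Nat.exists_eq_add_of_le (show j ≤ q by omega)
    obtain ⟨f, rfl⟩ := Nat.exists_eq_add_of_le (show j ≤ p by omega)
    have hch : ((j + f + (j + e) - 2 * j).choose (j + f - j) : ℝ) =
        (f + e).factorial / (f.factorial * e.factorial) := by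
      rw [show j + f + (j + e) - 2 * j = f + e by omega, Nat.add_sub_cancel_left,
        Nat.cast_add_choose]
    have e1 : (-1 : ℝ) ^ (j + f + (j + e) + n) = (-1) ^ j * (-1) ^ (j + f + (j + e) + n - j) := by
      rw [← pow_add]; congr 1; omega
    have g1 : Real.Gamma (L + 1 + (((j + f : ℕ) : ℝ) + (j + e : ℕ) + n - j)) =
        Real.Gamma ((m : ℝ) / 2 + (j + f + (j + e) + n - j : ℕ)) := by
      rw [show j + f + (j + e) + n - j = j + f + e + n by omega]
      congr 1; rw [hL]; push_cast; ring
    have g2 : ((j + f + (j + e) : ℕ) : ℝ) - j + L = ((j + f : ℕ) : ℝ) + (j + e : ℕ) - j + L := by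
      push_cast; ring
    rw [hch, saalTerm, zonalCoeff, g1, g2, e1, show j + f + (j + e) - 2 * j = f + e by omega,
      Nat.add_sub_cancel_left, Nat.add_sub_cancel_left, show (-4 : ℝ) ^ j = (-1) ^ j * 4 ^ j by
        rw [← mul_pow]; norm_num]
    have hs : (-1 : ℝ) ^ j * (-1) ^ j = 1 := by rw [← mul_pow]; norm_num
    have hG : Real.Gamma ((m : ℝ) / 2 + (j + f + (j + e) + n - j : ℕ)) ≠ 0 :=
      (Real.Gamma_pos_of_pos (by positivity)).ne'
    have hC : (((j + f + n + (j + e + n)).choose (j + f + n) : ℕ) : ℝ) ≠ 0 :=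
      Nat.cast_ne_zero.2 (Nat.choose_pos (by omega)).ne'
    have hfe : ((f + e).factorial : ℝ) ≠ 0 := by positivity
    field_simp
  rw [Finset.sum_congr rfl hterm, ← Finset.mul_sum, sum_saalTerm hLpos n p q hqp,
    sum_zonalCoeff hLpos]
  have hch : ((p + n + (q + n)).choose (p + n) : ℝ) =
      (p + n + (q + n)).factorial / ((p + n).factorial * (q + n).factorial) :=
    Nat.cast_add_choose ℝ
  rw [hch, kappa, theta, show p + q + 2 * n = p + n + (q + n) by ring,
    show p + n + (q + n) - 2 * n = p + q by omega, Nat.add_sub_cancel, Nat.add_sub_cancel]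
  have hG1 : Real.Gamma ((m : ℝ) / 2) = L * Real.Gamma L := by
    rw [← Real.Gamma_add_one hLpos.ne']; congr 1; rw [hL]; ring
  have hG2 : Real.Gamma ((m : ℝ) - 1) = 2 * L * Real.Gamma (2 * L) := by
    rw [← Real.Gamma_add_one (by positivity)]; congr 1; rw [hL]; ring
  have hG3 : Real.Gamma ((m : ℝ) / 2 + (p + n : ℕ) - n - 1) = Real.Gamma (L + p) := by
    congr 1; rw [hL]; push_cast; ring
  have hG4 : Real.Gamma ((m : ℝ) / 2 + (q + n : ℕ) - n - 1) = Real.Gamma (L + q) := by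
    congr 1; rw [hL]; push_cast; ring
  have hG5 : Real.Gamma ((m : ℝ) / 2 + (p + n : ℕ) + (q + n : ℕ) - n) =
      Real.Gamma (L + 1 + (p + q + n)) := by
    congr 1; rw [hL]; push_cast; ring
  have hG6 : Real.Gamma ((m : ℝ) / 2 + (p + q : ℕ) + n) = Real.Gamma (L + 1 + (p + q + n)) := by
    congr 1; rw [hL]; push_cast; ring
  have hG7 : Real.Gamma ((m : ℝ) + (p + n : ℕ) + (q + n : ℕ) - 2 * n - 2) =
      Real.Gamma (2 * L + (p + q : ℕ)) := by
    congr 1; rw [hL]; push_cast; ring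
  rw [hG1, hG2, hG3, hG4, hG5, hG6, hG7, hmL]
  have N1 : Real.Gamma L ≠ 0 := (Real.Gamma_pos_of_pos hLpos).ne'
  have N2 : Real.Gamma (2 * L) ≠ 0 := (Real.Gamma_pos_of_pos (by positivity)).ne'
  have N3 : Real.Gamma (L + 1 + (p + q + n)) ≠ 0 := (Real.Gamma_pos_of_pos (by positivity)).ne'
  have N4 : Real.Gamma (2 * L + (p + q : ℕ)) ≠ 0 := (Real.Gamma_pos_of_pos (by positivity)).ne'
  have e1 : (2 : ℝ) ^ (p + n + (q + n)) = 2 ^ (p + q) * 4 ^ n := by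
    rw [show (4 : ℝ) = 2 ^ 2 by norm_num, ← pow_mul, ← pow_add]; congr 1; ring
  have e2 : (-4 : ℝ) ^ n * (-1) ^ (p + q + n) = 4 ^ n * (-1) ^ (p + n + (q + n)) := by
    rw [show (-4 : ℝ) = 4 * (-1) by norm_num, mul_pow, mul_assoc, ← pow_add]; congr 2; ring
  have hfac : ((p + n + (q + n)).factorial : ℝ) ≠ 0 := by positivity
  rw [e1, add_sub_cancel_right]
  generalize Real.Gamma (L + 1 + (p + q + n)) = a1 at *
  generalize Real.Gamma (2 * L + (p + q : ℕ)) = a2 at *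
  generalize Real.Gamma (L + p) = a3 at *
  generalize Real.Gamma (L + q) = a4 at *
  generalize Real.Gamma L = a5 at *
  generalize Real.Gamma (2 * L) = a6 at *
  have h4 : (4 : ℝ) ^ n ≠ 0 := by positivity
  generalize (-4 : ℝ) ^ n = a7 at *
  generalize (4 : ℝ) ^ n = a8 at *
  generalize (-1 : ℝ) ^ (p + q + n) = a9 at *
  generalize (-1 : ℝ) ^ (p + n + (q + n)) = a10 at *
  field_simp
  linear_combination 4 * a3 * a4 * e2

/-- The eigenvalues of the averaged kernels on `⟨z, z⟩^n H(z)`. -/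
theorem stiefelAvg_kernel (hm : 3 ≤ m) (d n k l : ℕ) (hkl : k + l = d + 2 * n) (hlk : l ≤ k)
    {H : MvPolynomial (Fin m) ℂ} (hH : IsHarmonic d H) (z : Fin m → ℂ)
    {R : MvPolynomial (Fin m ⊕ Fin m) ℂ}
    (hR : ∀ x, eval x R = sphAvg m (evalL x (kernelPoly k l z H))) :
    stiefelAvg hm R = ((if n ≤ l then theta m n k l else 0 : ℝ) : ℂ) * (z ⬝ᵥ z) ^ n *
      eval z H := by
  obtain ⟨c, hc⟩ := exists_stiefelAvg_eigenvalue (m := m) hm d n k l hkl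
  rw [hc H z hH R hR]
  congr 2
  -- The constant c does not depend on H or z, so it may be computed at the pole of a zonal
  -- harmonic, whose value there is nonzero.
  let i : Fin m := ⟨0, by omega⟩
  set z₀ : Fin m → ℂ := Pi.single i 1 with hz₀
  obtain ⟨-, R₀, -, hR₀, -⟩ := exists_slice (stiefelAvg hm) (sphAvg m)
    (kernelPoly k l z₀ (zonal i d))
  have h1 := hc (zonal i d) z₀ (isHarmonic_zonal hm i d) R₀ hR₀
  have hzz : z₀ ⬝ᵥ z₀ = 1 := by simp [hz₀]
  have hev : eval z₀ (zonal i d) =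
      ((∑ j ∈ Finset.range (d / 2 + 1), zonalCoeff ((m : ℝ) / 2 - 1) d j : ℝ) : ℂ) := by
    rw [eval_zonal, hzz]
    simp [hz₀]
  have hSpos : (∑ j ∈ Finset.range (d / 2 + 1), zonalCoeff ((m : ℝ) / 2 - 1) d j) ≠ 0 := by
    have hm' : (3 : ℝ) ≤ m := by exact_mod_cast hm
    have hL : (0 : ℝ) < (m : ℝ) / 2 - 1 := by linarith
    rw [sum_zonalCoeff hL]
    have := Real.Gamma_pos_of_pos hL
    have := Real.Gamma_pos_of_pos (s := 2 * ((m : ℝ) / 2 - 1)) (by positivity)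
    have := Real.Gamma_pos_of_pos (s := 2 * ((m : ℝ) / 2 - 1) + d) (by positivity)
    positivity
  rw [hzz, one_pow, mul_one, hev] at h1
  have hSC : ((∑ j ∈ Finset.range (d / 2 + 1), zonalCoeff ((m : ℝ) / 2 - 1) d j : ℝ) : ℂ) ≠ 0 := by
    exact_mod_cast hSpos
  refine mul_right_cancel₀ hSC (h1.symm.trans ?_)
  have hval : ∀ t s : E m, ‖t‖ = 1 → ‖s‖ = 1 → inner ℝ t s = 0 →
      ((k + l).choose k : ℂ) * eval (Sum.elim (toC t) (toC s)) R₀ =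
        kappa m d n * ((-4) ^ n * if n ≤ k then
          (zonalLine i d (dagger (tau t s)) (tau t s)).coeff (k - n) else 0) *
        (tau t s i ^ k * dagger (tau t s) i ^ l) := by
    intro t s ht hs hts
    have h := sphAvg_null_pair hm (dagger_dotProduct_dagger ht hs hts)
      (tau_dotProduct_tau ht hs hts) (dagger_dotProduct_tau ht hs hts) (isHarmonic_zonal hm i d) _
      (eval_zonalLine i d (dagger_dotProduct_dagger ht hs hts)
      (tau_dotProduct_tau ht hs hts) (dagger_dotProduct_tau ht hs hts)) n k l hkl
    rw [← h, hR₀, evalL_kernelPoly, map_smul, smul_eq_mul, tauOf_toC, dagOf_toC,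
      hz₀, single_one_dotProduct, single_one_dotProduct]
    ring
  have hch0 : ((k + l).choose k : ℂ) ≠ 0 := Nat.cast_ne_zero.2 (Nat.choose_pos (by omega)).ne'
  split_ifs with hnl
  · obtain ⟨q, rfl⟩ := Nat.exists_eq_add_of_le' hnl
    obtain ⟨p, rfl⟩ := Nat.exists_eq_add_of_le' (hnl.trans hlk)
    obtain rfl : d = p + q := by omega
    -- The coefficient of u^p carries (τ†_i)^{p-j} τ_i^{q-j}; with the outer factor τ_i^k (τ†_i)^l
    -- both exponents become p + q + n - j. Hence only moments of equal powers occur.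
    set R₁ : MvPolynomial (Fin m ⊕ Fin m) ℂ := ∑ j ∈ Finset.range (q + 1),
      C ((kappa m (p + q) n * (-4) ^ n / ((p + n + (q + n)).choose (p + n)) *
        (zonalCoeff ((m : ℝ) / 2 - 1) (p + q) j * (-4) ^ j * (p + q - 2 * j).choose (p - j)) :
          ℝ) : ℂ) *
      (linTau z₀ ^ (p + q + n - j) * linDag z₀ ^ (p + q + n - j)) with hR₁
    have h2 : stiefelAvg hm R₀ = stiefelAvg hm R₁ := by
      refine stiefelAvg_congr_eval hm fun t s ht hs hts => mul_left_cancel₀ hch0 ?_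
      rw [hval t s ht hs hts, if_pos (by omega), Nat.add_sub_cancel,
        coeff_zonalLine i p q (by omega), hR₁, map_sum]
      simp only [Finset.mul_sum, Finset.sum_mul]
      refine Finset.sum_congr rfl fun j hj => ?_
      have hj := Finset.mem_range.1 hj
      obtain ⟨e, rfl⟩ := Nat.exists_eq_add_of_le (show j ≤ q by omega)
      obtain ⟨f, rfl⟩ := Nat.exists_eq_add_of_le (show j ≤ p by omega)
      simp only [map_mul, map_pow, eval_C, eval_linTau, eval_linDag, tauOf_toC, dagOf_toC,
        hz₀, single_one_dotProduct]
      rw [show j + f + (j + e) + n - j = j + f + e + n by omega, Nat.add_sub_cancel_left,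
        Nat.add_sub_cancel_left]
      push_cast
      field_simp
      ring
    rw [h2, hR₁, map_sum, ← Complex.ofReal_mul, ← zonal_sum_eq_theta hm n p q (by omega),
      Complex.ofReal_sum]
    refine Finset.sum_congr rfl fun j _ => ?_
    rw [← smul_eq_C_mul, map_smul, stiefelAvg_linTau_pow_mul_linDag_pow, hzz, one_pow, mul_one,
      smul_eq_mul, ← Complex.ofReal_mul]
  -- If n > l then k - n = d + (n - l) exceeds the degree d of the harmonic on the line, so the
  -- required coefficient is zero.
  · have h2 : stiefelAvg hm R₀ = stiefelAvg hm 0 := by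
      refine stiefelAvg_congr_eval hm fun t s ht hs hts => mul_left_cancel₀ hch0 ?_
      rw [hval t s ht hs hts]
      split_ifs with hnk
      · rw [coeff_zonalLine_eq_zero _ _ _ (by omega)]; simp
      · simp
    rw [h2]; simp

end Eigenvalue
-- Bounds for ⟨z,τ⟩ in the Lie ball.
section LieBall

variable {m : ℕ}

theorem dagger_tau_eq_tau_neg (t s : E m) : dagger (tau t s) = tau (-t) s := by
  rw [dagger_tau, tau, toC_neg]

/-- For `x + iy` in the Lie ball, `⟨x, t⟩ + ⟨y, s⟩ < 1` for all orthonormal `t` and `s`. -/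
theorem inner_add_inner_lt_one {x y t s : E m} (ht : ‖t‖ = 1) (hs : ‖s‖ = 1)
    (hts : inner ℝ t s = 0)
    (h : {u : E m | ‖u - x‖ = ‖y‖ ∧ inner ℝ (u - x) y = 0} ⊆ Metric.ball 0 1) :
    inner ℝ x t + inner ℝ y s < 1 := by
  -- The point x + w lies on the sphere defining the Lie ball. Generically w is the projection P of
  -- t off y, rescaled to length |y|. Then ⟨w,t⟩² = |y|² - ⟨y,t⟩², which is at least ⟨y,s⟩² by
  -- Bessel's inequality. If P = 0, then y is parallel to t and ⟨y,s⟩ = 0.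
  have key : ∃ w : E m, ‖w‖ = ‖y‖ ∧ inner ℝ w y = 0 ∧ inner ℝ y s ≤ inner ℝ w t := by
    rcases eq_or_ne y 0 with rfl | hy
    · exact ⟨0, by simp⟩
    have hy0 : 0 < ‖y‖ := norm_pos_iff.2 hy
    set c : ℝ := inner ℝ y t / ‖y‖ ^ 2 with hc
    set P : E m := t - c • y with hP
    have hPy : inner ℝ P y = 0 := by
      rw [hP, inner_sub_left, real_inner_smul_left, real_inner_self_eq_norm_sq, hc,
        real_inner_comm]
      field_simp
      ring
    have hPt : inner ℝ P t = ‖P‖ ^ 2 := by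
      rw [← real_inner_self_eq_norm_sq]
      nth_rewrite 3 [hP]
      rw [inner_sub_right, real_inner_smul_right, hPy, mul_zero, sub_zero]
    by_cases hP0 : P = 0
    · have hys : inner ℝ y s = 0 := by
        have ht' : t = c • y := sub_eq_zero.1 hP0
        have hc0 : c ≠ 0 := by
          rintro h0
          rw [h0, zero_smul] at ht'
          rw [ht', norm_zero] at ht
          exact zero_ne_one ht
        rw [ht', real_inner_smul_left] at hts
        exact (mul_eq_zero.1 hts).resolve_left hc0
      refine ⟨‖y‖ • s, by rw [norm_smul, hs, norm_norm, mul_one], ?_, ?_⟩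
      · rw [real_inner_smul_left, real_inner_comm, hys, mul_zero]
      · rw [hys, real_inner_smul_left, real_inner_comm, hts, mul_zero]
    · have hPpos : 0 < ‖P‖ := norm_pos_iff.2 hP0
      refine ⟨(‖y‖ / ‖P‖) • P, ?_, ?_, ?_⟩
      · rw [norm_smul, norm_div, norm_norm, norm_norm, div_mul_cancel₀ _ hPpos.ne']
      · rw [real_inner_smul_left, hPy, mul_zero]
      · rw [real_inner_smul_left, hPt]
        have e1 : ‖y‖ / ‖P‖ * ‖P‖ ^ 2 = ‖y‖ * ‖P‖ := by field_simp
        rw [e1]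
        refine le_of_sq_le_sq ?_ (by positivity)
        have hP2 : ‖y‖ ^ 2 * ‖P‖ ^ 2 = ‖y‖ ^ 2 - inner ℝ y t ^ 2 := by
          rw [← hPt, hP, inner_sub_left, real_inner_smul_left, real_inner_self_eq_norm_sq, ht, hc]
          field_simp
        have hB : 0 ≤ ‖y - (inner ℝ y t : ℝ) • t - (inner ℝ y s : ℝ) • s‖ ^ 2 := sq_nonneg _
        rw [← real_inner_self_eq_norm_sq] at hB
        simp only [inner_sub_left, inner_sub_right, real_inner_smul_left, real_inner_smul_right,
          real_inner_self_eq_norm_sq, norm_smul, Real.norm_eq_abs, mul_pow, sq_abs,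
          ht, hs, hts, real_inner_comm y t, real_inner_comm y s,
          (real_inner_comm t s).trans hts] at hB
        rw [mul_pow, hP2]
        nlinarith [hB]
  obtain ⟨w, hw, hwy, hle⟩ := key
  have hmem : x + w ∈ Metric.ball (0 : E m) 1 := h ⟨by simpa using hw, by simpa using hwy⟩
  rw [mem_ball_zero_iff] at hmem
  have h1 := real_inner_le_norm (x + w) t
  rw [ht, mul_one, inner_add_left] at h1
  linarith

/-- A phase times τ is again of the form t' + is'' with t', s'' orthonormal. The phase that makes
the product real and nonnegative reduces the modulus to a real part; s' is -s''. -/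
theorem exists_norm_dotProduct_tau_eq {t s : E m} (ht : ‖t‖ = 1) (hs : ‖s‖ = 1)
    (hts : inner ℝ t s = 0) (x y : E m) :
    ∃ t' s' : E m, ‖t'‖ = 1 ∧ ‖s'‖ = 1 ∧ inner ℝ t' s' = 0 ∧
      ‖(toC x + Complex.I • toC y) ⬝ᵥ tau t s‖ = inner ℝ x t' + inner ℝ y s' := by
  set c : ℂ := (toC x + Complex.I • toC y) ⬝ᵥ tau t s with hc
  have hcv : c = ((inner ℝ x t - inner ℝ y s : ℝ) : ℂ) +
      ((inner ℝ x s + inner ℝ y t : ℝ) : ℂ) * Complex.I := by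
    simp only [hc, tau, add_dotProduct, dotProduct_add, smul_dotProduct, dotProduct_smul,
      toC_dotProduct, smul_eq_mul]
    push_cast
    linear_combination ((inner ℝ y s : ℝ) : ℂ) * Complex.I_mul_I
  have hre : c.re = inner ℝ x t - inner ℝ y s := by simp [hcv]
  have him : c.im = inner ℝ x s + inner ℝ y t := by simp [hcv]
  -- These are the cosine and sine of the argument of c, with (1, 0) chosen when c = 0.
  obtain ⟨a, b, hab, hn⟩ : ∃ a b : ℝ, a ^ 2 + b ^ 2 = 1 ∧ ‖c‖ = a * c.re + b * c.im := by
    have hsq : ‖c‖ ^ 2 = c.re ^ 2 + c.im ^ 2 := by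
      rw [Complex.sq_norm, Complex.normSq_apply]; ring
    rcases eq_or_ne c 0 with h0 | h0
    · exact ⟨1, 0, by norm_num, by simp [h0]⟩
    · have hpos : 0 < ‖c‖ := norm_pos_iff.2 h0
      refine ⟨c.re / ‖c‖, c.im / ‖c‖, ?_, ?_⟩
      · rw [div_pow, div_pow, ← add_div, ← hsq, div_self (by positivity)]
      · field_simp; linarith
  have hst : inner ℝ s t = 0 := (real_inner_comm t s).trans hts
  refine ⟨a • t + b • s, b • t - a • s, ?_, ?_, ?_, ?_⟩
  · rw [← sq_eq_sq₀ (norm_nonneg _) zero_le_one, ← real_inner_self_eq_norm_sq]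
    simp only [inner_add_left, inner_add_right, real_inner_smul_left, real_inner_smul_right,
      real_inner_self_eq_norm_sq, norm_smul, Real.norm_eq_abs, mul_pow, sq_abs,
          ht, hs, hts, hst]
    linarith
  · rw [← sq_eq_sq₀ (norm_nonneg _) zero_le_one, ← real_inner_self_eq_norm_sq]
    simp only [inner_sub_left, inner_sub_right, real_inner_smul_left, real_inner_smul_right,
      real_inner_self_eq_norm_sq, norm_smul, Real.norm_eq_abs, mul_pow, sq_abs,
          ht, hs, hts, hst]
    linarith
  · simp only [inner_add_left, inner_sub_right, real_inner_smul_left, real_inner_smul_right,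
      real_inner_self_eq_norm_sq, ht, hs, hts, hst]
    ring
  · rw [hn, hre, him]
    simp only [inner_add_right, inner_sub_right, real_inner_smul_right]
    ring

theorem norm_dotProduct_tau_lt_one {z : Fin m → ℂ} (hz : z ∈ lieBall m) {t s : E m}
    (ht : ‖t‖ = 1) (hs : ‖s‖ = 1) (hts : inner ℝ t s = 0) : ‖z ⬝ᵥ tau t s‖ < 1 := by
  obtain ⟨x, y, rfl, h⟩ := hz
  obtain ⟨t', s', ht', hs', hts', e⟩ := exists_norm_dotProduct_tau_eq ht hs hts x y
  rw [e]
  exact inner_add_inner_lt_one ht' hs' hts' h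

theorem norm_dotProduct_dagger_tau_lt_one {z : Fin m → ℂ} (hz : z ∈ lieBall m) {t s : E m}
    (ht : ‖t‖ = 1) (hs : ‖s‖ = 1) (hts : inner ℝ t s = 0) : ‖z ⬝ᵥ dagger (tau t s)‖ < 1 := by
  rw [dagger_tau_eq_tau_neg]
  exact norm_dotProduct_tau_lt_one hz (by simpa) hs (by simpa)

theorem norm_toC_dotProduct_tau_le_one {ω t s : E m} (hω : ‖ω‖ = 1)
    (ht : ‖t‖ = 1) (hs : ‖s‖ = 1) (hts : inner ℝ t s = 0) : ‖toC ω ⬝ᵥ tau t s‖ ≤ 1 := by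
  obtain ⟨t', s', ht', hs', hts', e⟩ := exists_norm_dotProduct_tau_eq ht hs hts ω 0
  have h0 : toC ω + Complex.I • toC (0 : E m) = toC ω := by ext j; simp [toC]
  rw [h0] at e
  rw [e, inner_zero_left, add_zero]
  simpa [hω, ht'] using real_inner_le_norm ω t'

theorem norm_toC_dotProduct_dagger_tau_le_one {ω t s : E m} (hω : ‖ω‖ = 1)
    (ht : ‖t‖ = 1) (hs : ‖s‖ = 1) (hts : inner ℝ t s = 0) :
    ‖toC ω ⬝ᵥ dagger (tau t s)‖ ≤ 1 := by
  rw [dagger_tau_eq_tau_neg]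
  exact norm_toC_dotProduct_tau_le_one hω (by simpa) hs (by simpa)

end LieBall

/-! ### Growth of the coefficients ν. -/

section Coefficients

theorem summable_nu_diag (m : ℕ) (hm : 0 < m) {r : ℝ} (hr0 : 0 < r) (hr : r < 1) :
    Summable fun N : ℕ => Real.Gamma (N + (m : ℝ) / 2) /
      (Real.Gamma (N + 1) * Real.Gamma ((m : ℝ) / 2)) * r ^ N := by
  have hm' : (0 : ℝ) < m := by exact_mod_cast hm
  have hpos : ∀ N : ℕ, 0 < Real.Gamma (N + (m : ℝ) / 2) /
      (Real.Gamma (N + 1) * Real.Gamma ((m : ℝ) / 2)) * r ^ N := fun N => by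
    have := Real.Gamma_pos_of_pos (s := N + (m : ℝ) / 2) (by positivity)
    have := Real.Gamma_pos_of_pos (s := (N : ℝ) + 1) (by positivity)
    have := Real.Gamma_pos_of_pos (s := (m : ℝ) / 2) (by positivity)
    positivity
  refine summable_of_ratio_test_tendsto_lt_one hr (.of_forall fun N => (hpos N).ne') ?_
  have hratio : ∀ N : ℕ, ‖Real.Gamma ((N + 1 : ℕ) + (m : ℝ) / 2) /
      (Real.Gamma ((N + 1 : ℕ) + 1) * Real.Gamma ((m : ℝ) / 2)) * r ^ (N + 1)‖ /
      ‖Real.Gamma (N + (m : ℝ) / 2) /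
      (Real.Gamma (N + 1) * Real.Gamma ((m : ℝ) / 2)) * r ^ N‖ =
      (1 + ((m : ℝ) / 2 - 1) * (1 / ((N : ℝ) + 1))) * r := by
    intro N
    rw [Real.norm_of_nonneg (hpos N).le, Real.norm_of_nonneg (hpos (N + 1)).le]
    have h1 : Real.Gamma ((N + 1 : ℕ) + (m : ℝ) / 2) =
        (N + (m : ℝ) / 2) * Real.Gamma (N + (m : ℝ) / 2) := by
      rw [← Real.Gamma_add_one (by positivity)]; congr 1; push_cast; ring
    have h2 : Real.Gamma ((N + 1 : ℕ) + 1) = ((N : ℝ) + 1) * Real.Gamma ((N : ℝ) + 1) := by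
      rw [← Real.Gamma_add_one (by positivity)]; push_cast; rfl
    have := Real.Gamma_pos_of_pos (s := N + (m : ℝ) / 2) (by positivity)
    have := Real.Gamma_pos_of_pos (s := (N : ℝ) + 1) (by positivity)
    have := Real.Gamma_pos_of_pos (s := (m : ℝ) / 2) (by positivity)
    rw [h1, h2, pow_succ]
    field_simp
    ring
  simp only [hratio]
  simpa using ((tendsto_one_div_add_atTop_nhds_zero_nat (𝕜 := ℝ)).const_mul
    ((m : ℝ) / 2 - 1)).const_add 1 |>.mul_const r

theorem abs_nu (m k s : ℕ) (hm : 0 < m) : |nu m k s| =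
    Real.Gamma ((k + 2 * s : ℕ) + (m : ℝ) / 2) /
      (Real.Gamma ((k + 2 * s : ℕ) + 1) * Real.Gamma ((m : ℝ) / 2)) := by
  have hm' : (0 : ℝ) < m := by exact_mod_cast hm
  have h1 := Real.Gamma_pos_of_pos (s := (k + 2 * s : ℕ) + (m : ℝ) / 2) (by positivity)
  have h2 := Real.Gamma_pos_of_pos (s := ((k + 2 * s : ℕ) : ℝ) + 1) (by positivity)
  have h3 := Real.Gamma_pos_of_pos (s := (m : ℝ) / 2) (by positivity)
  push_cast at h1 h2 ⊢
  rw [nu, abs_div, abs_mul, abs_pow, abs_neg, abs_one, one_pow, one_mul, abs_of_pos h1, abs_mul,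
    abs_of_pos h2, abs_of_pos h3]

/-- The modulus of ν depends on k + 2s only. For r < ρ < 1 the terms of the convergent series at ρ
are bounded, which leaves geometric decay with ratio r/ρ and hence a summable double series. -/
theorem exists_abs_nu_mul_pow_le (m : ℕ) (hm : 0 < m) {r : ℝ} (hr0 : 0 ≤ r) (hr : r < 1) :
    ∃ C q : ℝ, 0 ≤ q ∧ q < 1 ∧ ∀ k s, |nu m k s| * r ^ (k + 2 * s) ≤ C * q ^ (k + 2 * s) := by
  obtain ⟨ρ, hrρ, hρ⟩ := exists_between hr
  have hρ0 : 0 < ρ := hr0.trans_lt hrρ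
  have hs := summable_nu_diag m hm hρ0 hρ
  obtain ⟨C, hC⟩ := hs.tendsto_atTop_zero.bddAbove_range
  refine ⟨C, r / ρ, by positivity, (div_lt_one hρ0).2 hrρ, fun k s => ?_⟩
  have h := hC ⟨k + 2 * s, rfl⟩
  simp only [← abs_nu m k s hm] at h
  calc |nu m k s| * r ^ (k + 2 * s)
      = |nu m k s| * ρ ^ (k + 2 * s) * (r / ρ) ^ (k + 2 * s) := by
        rw [div_pow]; field_simp
    _ ≤ _ := by gcongr

theorem summable_nu_bound (m : ℕ) (hm : 0 < m) {r : ℝ} (hr0 : 0 ≤ r) (hr : r < 1) :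
    Summable fun p : ℕ × ℕ => |nu m p.2 p.1| * r ^ (p.2 + 2 * p.1) := by
  obtain ⟨C, q, hq0, hq, h⟩ := exists_abs_nu_mul_pow_le m hm hr0 hr
  refine .of_nonneg_of_le (fun p => by positivity) (fun p => h p.2 p.1) (.mul_left C ?_)
  have h2 : q ^ 2 < 1 := pow_lt_one₀ hq0 hq two_ne_zero
  refine ((summable_geometric_of_lt_one (by positivity) h2).mul_of_nonneg
    (summable_geometric_of_lt_one hq0 hq) (fun _ => by positivity)
    (fun _ => by positivity)).congr fun p => ?_
  rw [← pow_mul]; ring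

theorem summable_nu_zero_bound (m : ℕ) (hm : 0 < m) {r : ℝ} (hr0 : 0 ≤ r) (hr : r < 1) :
    Summable fun s : ℕ => |nu m 0 s| * r ^ (2 * s) := by
  have := (summable_nu_bound m hm hr0 hr).comp_injective
    (i := fun s : ℕ => (s, 0)) (fun a b h => congrArg Prod.fst h)
  simpa [Function.comp_def] using this

end Coefficients
-- Selection of the terms of matching degree.
section Fourier

variable {m : ℕ}

/-- The phase `e^{-iNθ} e^{itθ}`. -/
def phase (t N : ℕ) (θ : ℝ) : ℂ :=
  Complex.exp ((-θ : ℝ) * Complex.I) ^ N * Complex.exp (θ * Complex.I) ^ t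

theorem norm_phase (t N : ℕ) (θ : ℝ) : ‖phase t N θ‖ = 1 := by
  rw [phase, norm_mul, norm_pow, norm_pow, Complex.norm_exp_ofReal_mul_I,
    Complex.norm_exp_ofReal_mul_I, one_pow, one_pow, one_mul]

theorem continuous_phase (t N : ℕ) : Continuous (phase t N) := by
  unfold phase; fun_prop

theorem phase_eq_exp (t N : ℕ) (θ : ℝ) :
    phase t N θ = Complex.exp ((((t : ℂ) - N) * Complex.I) * θ) := by
  rw [phase, ← Complex.exp_nat_mul, ← Complex.exp_nat_mul, ← Complex.exp_add]
  congr 1; push_cast; ring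

instance : IsFiniteMeasure thetaMeasure := by
  unfold thetaMeasure; infer_instance

theorem integral_phase_self (t : ℕ) : ∫ θ, phase t t θ ∂thetaMeasure = Real.pi := by
  simp [phase_eq_exp, thetaMeasure, Real.pi_pos.le]

theorem integral_phase_eq_zero {t N : ℕ} (h : N ≠ t) (he : Even (N + t)) :
    ∫ θ, phase t N θ ∂thetaMeasure = 0 := by
  have hc : ((t : ℂ) - N) * Complex.I ≠ 0 := by
    refine mul_ne_zero (sub_ne_zero.2 ?_) Complex.I_ne_zero
    exact_mod_cast h.symm
  obtain ⟨j, hj⟩ : ∃ j : ℤ, (t : ℤ) - N = 2 * j := by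
    obtain ⟨r, hr⟩ := he
    -- Over a half period only even frequencies integrate to zero, hence the parity hypothesis.
    exact ⟨r - N, by omega⟩
  rw [thetaMeasure, integral_Ico_eq_integral_Ioc, ← intervalIntegral.integral_of_le Real.pi_pos.le]
  simp only [phase_eq_exp]
  rw [integral_exp_mul_complex hc]
  have : Complex.exp (((t : ℂ) - N) * Complex.I * Real.pi) = 1 := by
    rw [← Complex.exp_int_mul_two_pi_mul_I j]
    congr 1
    have : (t : ℂ) - N = 2 * j := by exact_mod_cast hj
    rw [this]; ring
  rw [this]; simp

theorem integrable_of_continuous_of_bound {α : Type*} [TopologicalSpace α] [MeasurableSpace α]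
    [BorelSpace α] {μ : Measure α} [IsFiniteMeasure μ] {g : α → ℂ}
    (hg : Continuous g) (C : ℝ) (hC : ∀ x, ‖g x‖ ≤ C) : Integrable g μ :=
  .of_bound hg.measurable.aestronglyMeasurable C (.of_forall hC)

variable {ι : Type*} [Countable ι] {N : ι → ℕ} {q : ι → Metric.sphere (0 : E m) 1 → ℂ}
  {B : ι → ℝ} {t : ℕ} {g : Metric.sphere (0 : E m) 1 → ℂ}

theorem integral_phase_sum (hB : Summable B) (hqB : ∀ p ω, ‖q p ω‖ ≤ B p)
    (ω : Metric.sphere (0 : E m) 1) :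
    Integrable (fun θ => ∑' p, phase t (N p) θ * q p ω) thetaMeasure ∧
    ∫ θ, ∑' p, phase t (N p) θ * q p ω ∂thetaMeasure =
      ∑' p, (∫ θ, phase t (N p) θ ∂thetaMeasure) * q p ω := by
  have hbd : ∀ p θ, ‖phase t (N p) θ * q p ω‖ ≤ B p := fun p θ => by
    rw [norm_mul, norm_phase, one_mul]; exact hqB p ω
  have hint : ∀ p, Integrable (fun θ => phase t (N p) θ * q p ω) thetaMeasure := fun p =>
    integrable_of_continuous_of_bound ((continuous_phase _ _).mul_const _) _ (hbd p)
  refine ⟨integrable_of_continuous_of_bound (C := ∑' p, B p)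
    (continuous_tsum (fun p => (continuous_phase _ _).mul_const _) hB hbd)
    fun θ => tsum_of_norm_bounded hB.hasSum fun p => hbd p θ, ?_⟩
  rw [← (hasSum_integral_of_summable_integral_norm hint ?_).tsum_eq]
  · simp only [integral_mul_const]
  · simp only [norm_mul, norm_phase, one_mul, integral_const, smul_eq_mul]
    exact (Summable.of_nonneg_of_le (fun _ => norm_nonneg _) (fun p => hqB p ω) hB).mul_left _

theorem norm_integral_phase_le (t N : ℕ) :
    ‖∫ θ, phase t N θ ∂thetaMeasure‖ ≤ thetaMeasure.real Set.univ := by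
  simpa using norm_integral_le_of_norm_le_const (μ := thetaMeasure)
    (.of_forall fun θ => (norm_phase t N θ).le)

/-- Uniform domination by B allows integration term by term. The θ-integral removes the degrees N p
≠ t of the same parity as t, antipodal symmetry those of opposite parity, and the matching degree
contributes the factor π. -/
theorem sphere_integral_phase_sum (hB : Summable B) (hqB : ∀ p ω, ‖q p ω‖ ≤ B p)
    (hq : ∀ p, Continuous (q p)) (hqp : ∀ p ω, q p (-ω) = (-1) ^ N p * q p ω)
    (hg : Continuous g) (hgp : ∀ ω, g (-ω) = (-1) ^ t * g ω) :
    Integrable (fun ω => ∫ θ, (∑' p, phase t (N p) θ * q p ω) * g ω ∂thetaMeasure)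
      (sphereMeasure m) ∧
    ∫ ω, ∫ θ, (∑' p, phase t (N p) θ * q p ω) * g ω ∂thetaMeasure ∂sphereMeasure m =
      Real.pi * ∑' p, if N p = t then ∫ ω, q p ω * g ω ∂sphereMeasure m else 0 := by
  set A := thetaMeasure.real Set.univ
  have hrw : ∀ ω, ∫ θ, (∑' p, phase t (N p) θ * q p ω) * g ω ∂thetaMeasure =
      ∑' p, (∫ θ, phase t (N p) θ ∂thetaMeasure) * q p ω * g ω := fun ω => by
    rw [integral_mul_const, (integral_phase_sum hB hqB ω).2, tsum_mul_right]
  obtain ⟨G, hG⟩ : ∃ G, ∀ ω, ‖g ω‖ ≤ G := by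
    obtain ⟨G, hG⟩ := (isCompact_range hg).isBounded.exists_norm_le
    exact ⟨G, fun ω => hG _ ⟨ω, rfl⟩⟩
  have hbd : ∀ p ω, ‖(∫ θ, phase t (N p) θ ∂thetaMeasure) * q p ω * g ω‖ ≤ A * B p * G := by
    intro p ω
    rw [norm_mul, norm_mul]
    have hB0 : 0 ≤ B p := (norm_nonneg _).trans (hqB p ω)
    gcongr
    · exact norm_integral_phase_le _ _
    · exact hqB p ω
    · exact hG ω
  have hs : Summable fun p => A * B p * G := (hB.mul_left A).mul_right G
  have hcont : ∀ p, Continuous fun ω => (∫ θ, phase t (N p) θ ∂thetaMeasure) * q p ω * g ω :=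
    fun p => ((hq p).const_mul _).mul hg
  simp only [hrw]
  refine ⟨integrable_of_continuous_of_bound (continuous_tsum hcont hs hbd) (∑' p, A * B p * G)
    fun ω => tsum_of_norm_bounded hs.hasSum fun p => hbd p ω, ?_⟩
  rw [← (hasSum_integral_of_summable_integral_norm
    (fun p => integrable_of_continuous_of_bound (hcont p) _ (hbd p)) ?_).tsum_eq, ← tsum_mul_left]
  · refine tsum_congr fun p => ?_
    simp only [mul_assoc, integral_const_mul]
    split_ifs with h
    · rw [h, integral_phase_self]
    · rcases Nat.even_or_odd (N p + t) with he | ho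
      · rw [integral_phase_eq_zero h he, zero_mul, mul_zero]
      · have hneg := integral_toSphere_comp_neg (volume : Measure (E m)) (fun ω => q p ω * g ω)
        simp only [hqp, hgp] at hneg
        have hz : ∀ ω, (-1 : ℂ) ^ N p * q p ω * ((-1) ^ t * g ω) = -(q p ω * g ω) := fun ω => by
          rw [show (-1 : ℂ) ^ N p * q p ω * ((-1) ^ t * g ω) =
            (-1) ^ (N p + t) * (q p ω * g ω) by rw [pow_add]; ring, ho.neg_one_pow]; ring
        simp only [hz, integral_neg] at hneg
        rw [sphereMeasure, self_eq_neg.1 hneg.symm, mul_zero, mul_zero]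
  · refine .of_nonneg_of_le (fun p => integral_nonneg fun _ => norm_nonneg _) (fun p => ?_)
      (hs.mul_right ((sphereMeasure m).real Set.univ))
    have := norm_integral_le_of_norm_le_const (μ := sphereMeasure m)
      (f := fun ω => ‖(∫ θ, phase t (N p) θ ∂thetaMeasure) * q p ω * g ω‖)
      (.of_forall fun ω => by rw [norm_norm]; exact hbd p ω)
    exact (le_abs_self _).trans this

end Fourier

/-! ### Integrals of finite Clifford-valued sums. -/

section CliffordIntegrals

variable {m : ℕ} {α : Type*} [MeasurableSpace α] {μ : Measure α}

theorem HasCliffIntegral.cliffIntegral_eq {F : α → Cl m} {I : Cl m}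
    (h : HasCliffIntegral μ F I) : cliffIntegral μ F = I := by
  have hF : CliffIntegrable μ F := ⟨I, h⟩
  rw [cliffIntegral, dif_pos hF]
  exact hF.choose_spec.unique h

theorem HasCliffIntegral.sub {F G : α → Cl m} {I J : Cl m}
    (hF : HasCliffIntegral μ F I) (hG : HasCliffIntegral μ G J) :
    HasCliffIntegral μ (fun x => F x - G x) (I - J) := fun φ => by
  simp only [map_sub]
  exact ⟨(hF φ).1.sub (hG φ).1, by rw [integral_sub (hF φ).1 (hG φ).1, (hF φ).2, (hG φ).2]⟩

theorem hasCliffIntegral_sum_smul {ι : Type*} (s : Finset ι) (g : ι → α → ℂ) (c : ι → Cl m)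
    (hg : ∀ i ∈ s, Integrable (g i) μ) :
    HasCliffIntegral μ (fun x => ∑ i ∈ s, g i x • c i) (∑ i ∈ s, (∫ x, g i x ∂μ) • c i) := by
  intro φ
  simp only [map_sum, map_smul, smul_eq_mul]
  exact ⟨integrable_finsetSum _ fun i hi => (hg i hi).mul_const _, by
    rw [integral_finsetSum _ fun i hi => (hg i hi).mul_const _]
    simp only [integral_mul_const]⟩

end CliffordIntegrals

/-! ### Clifford identities and the components of monogenics. -/

section Clifford

open MvPolynomial

variable {m : ℕ}

theorem dotProduct_self_eq (u : Fin m → ℂ) : cliffordForm m u = -(u ⬝ᵥ u) := by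
  simp [cliffordForm, QuadraticMap.weightedSumSquares_apply, dotProduct]

theorem vec_mul_self (u : Fin m → ℂ) : vec u * vec u = (-(u ⬝ᵥ u)) • (1 : Cl m) := by
  rw [vec, CliffordAlgebra.ι_sq_scalar, dotProduct_self_eq, Algebra.algebraMap_eq_smul_one]

theorem vec_pow_two_mul (u : Fin m → ℂ) (n : ℕ) :
    vec u ^ (2 * n) = ((-(u ⬝ᵥ u)) ^ n) • (1 : Cl m) := by
  rw [pow_mul, pow_two, vec_mul_self, smul_pow, one_pow]

theorem vec_mul_add_swap (u v : Fin m → ℂ) :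
    vec u * vec v + vec v * vec u = (-2 * (u ⬝ᵥ v)) • (1 : Cl m) := by
  have h := vec_mul_self (u + v)
  have h2 : vec (u + v) = vec u + vec v := by simp [vec]
  rw [h2, add_mul, mul_add, mul_add, vec_mul_self, vec_mul_self] at h
  have h3 : vec u * vec v + vec v * vec u = (-((u + v) ⬝ᵥ (u + v))) • (1 : Cl m) -
      (-(u ⬝ᵥ u)) • (1 : Cl m) - (-(v ⬝ᵥ v)) • (1 : Cl m) := by
    rw [← h]; abel
  rw [h3, ← sub_smul, ← sub_smul]
  congr 1
  simp only [add_dotProduct, dotProduct_add, dotProduct_comm v u]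
  ring

/-- `τ† τ = 2 + 2 i s t` for orthonormal `t` and `s`. -/
theorem vec_dagger_tau_mul_vec_tau {t s : E m} (ht : ‖t‖ = 1) (hs : ‖s‖ = 1)
    (hts : inner ℝ t s = 0) :
    (vec (dagger (tau t s)) * vec (tau t s) : Cl m) =
      (2 : ℂ) • (1 : Cl m) + (2 * Complex.I) • (vec (toC s) * vec (toC t)) := by
  have hcomm := vec_mul_add_swap (toC t) (toC s)
  have htt := vec_mul_self (toC t)
  have hss := vec_mul_self (toC s)
  rw [toC_dotProduct, real_inner_self_eq_norm_sq] at htt hss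
  rw [toC_dotProduct, hts, Complex.ofReal_zero, mul_zero, zero_smul] at hcomm
  have h1 : vec (dagger (tau t s)) = -vec (toC t) + Complex.I • vec (toC s) := by
    rw [dagger_tau]; simp [vec]
  have h2 : vec (tau t s) = vec (toC t) + Complex.I • vec (toC s) := by simp [vec, tau]
  have h3 : vec (toC t) * vec (toC s) = -(vec (toC s) * vec (toC t)) :=
    eq_neg_of_add_eq_zero_left hcomm
  rw [h1, h2, add_mul, mul_add, mul_add, neg_mul, neg_mul, mul_smul_comm, smul_mul_assoc,
    smul_mul_assoc, mul_smul_comm, htt, hss, h3, ht, hs]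
  match_scalars
  · linear_combination -Complex.I_sq
  · ring

theorem eval_sum_tmul {ι : Type*} (s : Finset ι) (p : ι → MvPolynomial (Fin m) ℂ) (c : ι → Cl m)
    (w : Fin m → ℂ) :
    CliffPoly.eval (∑ i ∈ s, p i ⊗ₜ[ℂ] c i) w = ∑ i ∈ s, eval w (p i) • c i := by
  simp [CliffPoly.eval, map_sum, aeval_eq_eval]

/-- The Dirac operator factorises the Laplacian. -/
theorem dirac_dirac (M : CliffPoly m) :
    dirac m (dirac m M) = -((∑ j, (pderiv j).toLinearMap ∘ₗ (pderiv j).toLinearMap :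
      MvPolynomial (Fin m) ℂ →ₗ[ℂ] MvPolynomial (Fin m) ℂ).rTensor (Cl m) M) := by
  induction M using TensorProduct.induction_on with
  | zero => simp
  | add x y hx hy => rw [map_add, map_add, hx, hy, map_add, neg_add]
  | tmul p c =>
    have h1 : dirac m (dirac m (p ⊗ₜ c)) =
        ∑ j, ∑ k, pderiv k (pderiv j p) ⊗ₜ[ℂ] (e k * (e j * c)) := by
      simp [dirac, map_sum]
    -- Second derivatives commute, so the double sum may also be written with e_j and e_k exchanged.
    -- Adding both forms leaves only the anticommutators, at the price of a factor 2.
    have h2 : dirac m (dirac m (p ⊗ₜ c)) =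
        ∑ j, ∑ k, pderiv k (pderiv j p) ⊗ₜ[ℂ] (e j * (e k * c)) := by
      rw [h1, Finset.sum_comm]
      simp only [pderiv_pderiv_comm]
    have h3 : ∀ j k : Fin m, (e k * (e j * c) + e j * (e k * c) : Cl m) =
        if k = j then (-2 : ℂ) • c else 0 := by
      intro j k
      rw [← mul_assoc, ← mul_assoc, ← add_mul]
      split_ifs with h
      · subst h
        rw [e_mul_self, ← two_smul ℂ, smul_mul_assoc, neg_one_mul]
        module
      · rw [e_mul_add_mul h, zero_mul]
    have h4 : (2 : ℂ) • dirac m (dirac m (p ⊗ₜ c)) =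
        (2 : ℂ) • -((∑ j, (pderiv j).toLinearMap ∘ₗ (pderiv j).toLinearMap :
          MvPolynomial (Fin m) ℂ →ₗ[ℂ] MvPolynomial (Fin m) ℂ).rTensor (Cl m) (p ⊗ₜ c)) := by
      rw [two_smul]
      nth_rewrite 1 [h1]
      rw [h2]
      simp only [← Finset.sum_add_distrib, ← TensorProduct.tmul_add, h3]
      simp only [TensorProduct.tmul_ite, Finset.sum_ite_eq', Finset.mem_univ, if_true, LinearMap.rTensor_tmul, LinearMap.sum_apply,
        LinearMap.comp_apply, TensorProduct.sum_tmul, TensorProduct.tmul_smul]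
      rw [← Finset.smul_sum]
      simp
    exact smul_right_injective _ (two_ne_zero (α := ℂ)) h4

/-- The components of a spherical monogenic are spherical harmonics. -/
theorem exists_harmonic_decomposition {d : ℕ} {M : CliffPoly m} (hM : M ∈ sphericalMonogenics m d) :
    ∃ (ι : Type) (s : Finset ι) (p : ι → MvPolynomial (Fin m) ℂ) (c : ι → Cl m),
      (∀ i, IsHarmonic d (p i)) ∧ M = ∑ i ∈ s, p i ⊗ₜ[ℂ] c i := by
  classical
  -- Coordinates in a basis of the algebra commute with operators on the polynomial factor, so each
  -- coordinate is homogeneous and annihilated by the Laplacian. The sum runs over the finite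
  -- support of the coordinates.
  let b := Module.Free.chooseBasis ℂ (Cl m)
  have happ := fun x i => TensorProduct.equivFinsuppOfBasisRight_apply
    (M := MvPolynomial (Fin m) ℂ) b x i
  set φ := TensorProduct.equivFinsuppOfBasisRight (M := MvPolynomial (Fin m) ℂ) b
  obtain ⟨⟨y, hy⟩, hM2⟩ := hM
  refine ⟨_, (φ M).support, φ M, b, fun i => ⟨?_, ?_⟩, ?_⟩
  · rw [happ, ← hy, ← mem_homogeneousSubmodule]
    clear hy
    induction y using TensorProduct.induction_on with
    | zero => simp
    | add x y hx hy => simpa only [map_add] using Submodule.add_mem _ hx hy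
    | tmul p c =>
      rw [LinearMap.rTensor_tmul, LinearMap.lTensor_tmul, TensorProduct.rid_tmul]
      exact Submodule.smul_mem _ _ p.2
  · have h1 := dirac_dirac M
    rw [LinearMap.mem_ker.1 hM2, map_zero, eq_comm, neg_eq_zero] at h1
    have h2 : ∀ N : CliffPoly m, φ (((∑ j, (pderiv j).toLinearMap ∘ₗ (pderiv j).toLinearMap :
      MvPolynomial (Fin m) ℂ →ₗ[ℂ] MvPolynomial (Fin m) ℂ)).rTensor (Cl m) N) i = lap (φ N i) := by
      intro N
      rw [happ, happ]
      induction N using TensorProduct.induction_on with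
      | zero => simp [lap]
      | add x y hx hy => simp only [map_add, hx, hy, lap, Finset.sum_add_distrib]
      | tmul p c => simp [lap, Finset.smul_sum]
    rw [← h2, h1, map_zero, Finsupp.zero_apply]
  · have := TensorProduct.equivFinsuppOfBasisRight_symm_apply b (φ M)
    rw [LinearEquiv.symm_apply_apply] at this
    exact this

end Clifford

/-! ### The polarized transform as a finite polynomial expression. -/

section Polarized

open MvPolynomial

variable {m : ℕ}

theorem liePoint_dotProduct (θ : ℝ) (ω : E m) (u : Fin m → ℂ) :
    liePoint θ ω ⬝ᵥ u = Complex.exp (θ * Complex.I) * (toC ω ⬝ᵥ u) := by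
  rw [liePoint, smul_dotProduct, smul_eq_mul]

theorem coefA_liePoint (τ z : Fin m → ℂ) (θ : ℝ) (ω : E m) :
    coefA τ z (liePoint θ ω) = Complex.exp (θ * Complex.I) * coefA τ z (toC ω) := by
  rw [coefA, coefA, liePoint_dotProduct]; ring

theorem coefB_liePoint (τ z : Fin m → ℂ) (θ : ℝ) (ω : E m) :
    coefB τ z (liePoint θ ω) = Complex.exp (θ * Complex.I) * coefB τ z (toC ω) := by
  rw [coefB, coefB, liePoint_dotProduct]; ring

/-- The terms of the kernel series. -/
def kernelTerm (τ z : Fin m → ℂ) (p : ℕ × ℕ) (y : Fin m → ℂ) : ℂ :=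
  (nu m p.2 p.1 : ℂ) * coefA τ z y ^ (p.2 + p.1) * coefB τ z y ^ p.1

theorem kernelTerm_liePoint (τ z : Fin m → ℂ) (p : ℕ × ℕ) (θ : ℝ) (ω : E m) :
    kernelTerm τ z p (liePoint θ ω) =
      Complex.exp (θ * Complex.I) ^ (p.2 + 2 * p.1) * kernelTerm τ z p (toC ω) := by
  rw [kernelTerm, kernelTerm, coefA_liePoint, coefB_liePoint]; ring

theorem kernelTerm_neg (τ z : Fin m → ℂ) (p : ℕ × ℕ) (y : Fin m → ℂ) :
    kernelTerm τ z p (-y) = (-1) ^ (p.2 + 2 * p.1) * kernelTerm τ z p y := by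
  simp only [kernelTerm, coefA, coefB, neg_dotProduct, mul_neg]
  rw [neg_pow, neg_pow ((z ⬝ᵥ dagger τ) * _)]
  ring

theorem continuous_kernelTerm_toC (τ z : Fin m → ℂ) (p : ℕ × ℕ) :
    Continuous fun ω : E m => kernelTerm τ z p (toC ω) := by
  unfold kernelTerm coefA coefB dotProduct toC; fun_prop

theorem norm_kernelTerm_le {z : Fin m → ℂ} {a b ω : E m} (ha : ‖a‖ = 1) (hb : ‖b‖ = 1)
    (hab : inner ℝ a b = 0) (hω : ‖ω‖ = 1) (p : ℕ × ℕ) :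
    ‖kernelTerm (tau a b) z p (toC ω)‖ ≤ |nu m p.2 p.1| *
      max ‖z ⬝ᵥ tau a b‖ ‖z ⬝ᵥ dagger (tau a b)‖ ^ (p.2 + 2 * p.1) := by
  set r := max ‖z ⬝ᵥ tau a b‖ ‖z ⬝ᵥ dagger (tau a b)‖
  have hA : ‖coefA (tau a b) z (toC ω)‖ ≤ r := by
    rw [coefA, norm_mul]
    exact (mul_le_of_le_one_right (norm_nonneg _)
      (norm_toC_dotProduct_dagger_tau_le_one hω ha hb hab)).trans (le_max_left _ _)
  have hB : ‖coefB (tau a b) z (toC ω)‖ ≤ r := by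
    rw [coefB, norm_mul]
    exact (mul_le_of_le_one_right (norm_nonneg _)
      (norm_toC_dotProduct_tau_le_one hω ha hb hab)).trans (le_max_right _ _)
  rw [kernelTerm, norm_mul, norm_mul, norm_pow, norm_pow, Complex.norm_real, Real.norm_eq_abs,
    mul_assoc, show p.2 + 2 * p.1 = p.2 + p.1 + p.1 by ring, pow_add r]
  gcongr

theorem eval_vec_pow_mul {ι : Type*} (I : Finset ι) {d n : ℕ} {p : ι → MvPolynomial (Fin m) ℂ}
    (hp : ∀ i, (p i).IsHomogeneous d) (c : ι → Cl m) {ω : E m} (hω : ‖ω‖ = 1) (θ : ℝ) :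
    vec (liePoint θ ω) ^ (2 * n) * CliffPoly.eval (∑ i ∈ I, p i ⊗ₜ[ℂ] c i) (liePoint θ ω) =
      ∑ i ∈ I, (Complex.exp (θ * Complex.I) ^ (d + 2 * n) *
        ((-1) ^ n * eval (toC ω) (p i))) • c i := by
  rw [vec_pow_two_mul, eval_sum_tmul, smul_one_mul, Finset.smul_sum]
  refine Finset.sum_congr rfl fun i _ => ?_
  rw [smul_smul, liePoint_dotProduct, dotProduct_comm, liePoint_dotProduct, toC_dotProduct,
    real_inner_self_eq_norm_sq, hω, liePoint, eval_smul_of_isHomogeneous (hp i)]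
  congr 1
  rw [neg_pow]
  push_cast
  ring

theorem tsum_ite_degree_eq (N : ℕ) (g : ℕ × ℕ → ℂ) :
    ∑' p : ℕ × ℕ, (if p.2 + 2 * p.1 = N then g p else 0) =
      ∑ s ∈ Finset.range (N / 2 + 1), g (s, N - 2 * s) := by
  have hinj : Set.InjOn (fun s => (s, N - 2 * s)) (Finset.range (N / 2 + 1) : Set ℕ) :=
    fun a _ b _ h => congrArg Prod.fst h
  rw [tsum_eq_sum (s := (Finset.range (N / 2 + 1)).image fun s => (s, N - 2 * s)),
    Finset.sum_image hinj]
  · refine Finset.sum_congr rfl fun s hs => if_pos ?_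
    have := Finset.mem_range.1 hs
    dsimp only; omega
  · rintro ⟨s, k⟩ hp
    refine if_neg fun h => hp (Finset.mem_image.2 ⟨s, Finset.mem_range.2 ?_, ?_⟩)
    · dsimp only at h; omega
    · dsimp only at h; rw [← h, Nat.add_sub_cancel]

theorem tsum_ite_two_mul_eq (N : ℕ) (g : ℕ → ℂ) :
    ∑' s : ℕ, (if 2 * s = N then g s else 0) = if Even N then g (N / 2) else 0 := by
  rw [tsum_eq_single (N / 2) fun s hs => if_neg (by omega)]
  refine if_congr ?_ rfl rfl
  rw [Nat.even_iff]; omega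

/-- The sphere integral of the degree-`N` terms of the kernel as an average of a polynomial. -/
theorem integral_kernelTerm (hm : 0 < m) (a b : E m) (z : Fin m → ℂ) (s k : ℕ) (u : ℂ)
    (H : MvPolynomial (Fin m) ℂ) :
    ((1 / (Real.pi * sphereArea m) : ℝ) : ℂ) * (Real.pi *
      ∫ ω : Metric.sphere (0 : E m) 1, kernelTerm (tau a b) z (s, k) (toC (ω : E m)) *
        (u * eval (toC (ω : E m)) H) ∂sphereMeasure m) =
    u * (nu m k s * sphAvg m (evalL (Sum.elim (toC a) (toC b)) (kernelPoly (k + s) s z H))) := by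
  have hA : ((sphereArea m : ℝ) : ℂ) ≠ 0 := by exact_mod_cast (sphereArea_pos hm).ne'
  have hpi : (Real.pi : ℂ) ≠ 0 := by exact_mod_cast Real.pi_ne_zero
  have h : ∀ ω : Metric.sphere (0 : E m) 1,
      kernelTerm (tau a b) z (s, k) (toC (ω : E m)) * (u * eval (toC (ω : E m)) H) =
      u * nu m k s * eval (toC (ω : E m))
        (evalL (Sum.elim (toC a) (toC b)) (kernelPoly (k + s) s z H)) := fun ω => by
    rw [evalL_kernelPoly, tauOf_toC, dagOf_toC, smul_eval, map_mul, map_mul, map_pow, map_pow,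
      eval_lin, eval_lin, kernelTerm, coefA, coefB, dotProduct_comm (toC _) (dagger _),
      dotProduct_comm (toC _) (tau _ _)]
    ring
  simp only [h]
  rw [integral_const_mul, sphAvg_apply]
  push_cast
  field_simp

/-- The scalar components of the polarized Hua-Radon transform of degree `N`. -/
def mainComponent (N n : ℕ) (z : Fin m → ℂ) (H : MvPolynomial (Fin m) ℂ)
    (x : Fin m ⊕ Fin m → ℂ) : ℂ :=
  ∑ s ∈ Finset.range (N / 2 + 1),
    (-1) ^ n * (nu m (N - 2 * s) s * sphAvg m (evalL x (kernelPoly (N - s) s z H)))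

/-- The scalar components of the correction term of the polarized Hua-Radon transform. -/
def diagComponent (N n : ℕ) (z : Fin m → ℂ) (H : MvPolynomial (Fin m) ℂ)
    (x : Fin m ⊕ Fin m → ℂ) : ℂ :=
  if Even N then
    (-1) ^ n * (nu m 0 (N / 2) * sphAvg m (evalL x (kernelPoly (N / 2) (N / 2) z H)))
  else 0

/-- Uses only the homogeneity of the components. The factor (-1)^n in the result is the value of
ω^{2n} at a unit vector, and the constants π and A_m of the kernel cancel against the θ-integral and
the normalisation of the average. -/
theorem polarizedHuaRadon_eq (hm : 3 ≤ m) {ι : Type*} (I : Finset ι) {d n : ℕ}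
    {p : ι → MvPolynomial (Fin m) ℂ} (hp : ∀ i, (p i).IsHomogeneous d) (c : ι → Cl m)
    {f : (Fin m → ℂ) → Cl m}
    (hf : ∀ z, f z = vec z ^ (2 * n) * CliffPoly.eval (∑ i ∈ I, p i ⊗ₜ[ℂ] c i) z)
    {z : Fin m → ℂ} (hz : z ∈ lieBall m) {a b : E m} (ha : ‖a‖ = 1) (hb : ‖b‖ = 1)
    (hab : inner ℝ a b = 0) :
    PolarizedHuaRadonConverges (tau a b) f z ∧
    polarizedHuaRadon (tau a b) f z =
      ∑ i ∈ I, mainComponent (d + 2 * n) n z (p i) (Sum.elim (toC a) (toC b)) • c i -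
      ∑ i ∈ I, diagComponent (d + 2 * n) n z (p i) (Sum.elim (toC a) (toC b)) •
        ((1 / 4 : ℂ) • (vec (dagger (tau a b)) * vec (tau a b)) * c i) := by
  have hm0 : 0 < m := by omega
  set τ := tau a b with hτ
  set N := d + 2 * n with hN
  set r := max ‖z ⬝ᵥ τ‖ ‖z ⬝ᵥ dagger τ‖ with hr
  have hr0 : 0 ≤ r := le_max_of_le_left (norm_nonneg _)
  have hr1 : r < 1 := max_lt (norm_dotProduct_tau_lt_one hz ha hb hab)
    (norm_dotProduct_dagger_tau_lt_one hz ha hb hab)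
  have hB1 := summable_nu_bound m hm0 hr0 hr1
  have hB2 := summable_nu_zero_bound m hm0 hr0 hr1
  have hsph : ∀ ω : Metric.sphere (0 : E m) 1, ‖(ω : E m)‖ = 1 := fun ω => by simp
  have hsum1 : ∀ (ω : E m) (θ : ℝ), ‖ω‖ = 1 →
      Summable fun p => kernelTerm τ z p (liePoint (-θ) ω) := fun ω θ hω =>
    .of_norm_bounded hB1 fun p => by
      rw [kernelTerm_liePoint, norm_mul, norm_pow, Complex.norm_exp_ofReal_mul_I, one_pow, one_mul]
      exact norm_kernelTerm_le ha hb hab hω p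
  have hsum2 : ∀ (ω : E m) (θ : ℝ), ‖ω‖ = 1 →
      Summable fun s : ℕ => kernelTerm τ z (s, 0) (liePoint (-θ) ω) := fun ω θ hω =>
    (hsum1 ω θ hω).comp_injective (i := fun s : ℕ => (s, 0)) fun a b h => congrArg Prod.fst h
  set C : ℂ := ((1 / (Real.pi * sphereArea m) : ℝ) : ℂ) with hC
  let q1 : ℕ × ℕ → Metric.sphere (0 : E m) 1 → ℂ := fun p ω => kernelTerm τ z p (toC (ω : E m))
  let q2 : ℕ → Metric.sphere (0 : E m) 1 → ℂ := fun s ω => kernelTerm τ z (s, 0) (toC (ω : E m))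
  let g : ι → Metric.sphere (0 : E m) 1 → ℂ := fun i ω => (-1) ^ n * eval (toC (ω : E m)) (p i)
  let V : ι → Cl m := fun i => (1 / 4 : ℂ) • (vec (dagger τ) * vec τ) * c i
  let S1 : Metric.sphere (0 : E m) 1 → ℝ → ℂ := fun ω θ =>
    ∑' p : ℕ × ℕ, phase N (p.2 + 2 * p.1) θ * q1 p ω
  let S2 : Metric.sphere (0 : E m) 1 → ℝ → ℂ := fun ω θ => ∑' s : ℕ, phase N (2 * s) θ * q2 s ω
  have hq1B : ∀ p ω, ‖q1 p ω‖ ≤ |nu m p.2 p.1| * r ^ (p.2 + 2 * p.1) := fun p ω =>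
    norm_kernelTerm_le ha hb hab (hsph ω) p
  have hq2B : ∀ s ω, ‖q2 s ω‖ ≤ |nu m 0 s| * r ^ (2 * s) := fun s ω => by
    simpa using hq1B (s, 0) ω
  have hq1c : ∀ p, Continuous (q1 p) := fun p =>
    (continuous_kernelTerm_toC τ z p).comp continuous_subtype_val
  have hq1n : ∀ p ω, q1 p (-ω) = (-1) ^ (p.2 + 2 * p.1) * q1 p ω := fun p ω => by
    simp only [q1]
    rw [← kernelTerm_neg, ← toC_neg]; rfl
  have hq2n : ∀ s ω, q2 s (-ω) = (-1) ^ (2 * s) * q2 s ω := fun s ω => by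
    simpa using hq1n (s, 0) ω
  have hgc : ∀ i, Continuous (g i) := fun i =>
    ((continuous_eval_toC (p i)).comp continuous_subtype_val).const_mul _
  have hgn : ∀ i ω, g i (-ω) = (-1) ^ N * g i ω := fun i ω => by
    have : toC ((-ω : Metric.sphere (0 : E m) 1) : E m) = (-1 : ℂ) • toC (ω : E m) := by
      rw [neg_one_smul, ← toC_neg]; rfl
    simp only [g]
    rw [this, eval_smul_of_isHomogeneous (hp i), hN, pow_add, pow_mul]
    ring
  have hintegrand : ∀ (ω : Metric.sphere (0 : E m) 1) (θ : ℝ), polarizedIntegrand τ f z ω θ =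
      ∑ i ∈ I, (C * (S1 ω θ * g i ω)) • c i - ∑ i ∈ I, (C * (S2 ω θ * g i ω)) • V i := by
    intro ω θ
    have e1 : S1 ω θ = (∑' s : ℕ, ∑' k : ℕ, (nu m k s : ℂ) *
        coefA τ z (liePoint (-θ) ω) ^ (k + s) * coefB τ z (liePoint (-θ) ω) ^ s) *
          Complex.exp (θ * Complex.I) ^ N := by
      -- Summability over pairs identifies the iterated sum of the kernel with the sum over ℕ × ℕ.
      have h := (hsum1 ω θ (hsph ω)).tsum_prod
      simp only [kernelTerm] at h
      rw [← h, ← tsum_mul_right]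
      refine tsum_congr fun p => ?_
      have h2 := kernelTerm_liePoint τ z p (-θ) (ω : E m)
      rw [kernelTerm] at h2
      rw [h2, phase]
      ring
    have e2 : S2 ω θ = (∑' s : ℕ, (nu m 0 s : ℂ) *
        coefA τ z (liePoint (-θ) ω) ^ s * coefB τ z (liePoint (-θ) ω) ^ s) *
          Complex.exp (θ * Complex.I) ^ N := by
      rw [← tsum_mul_right]
      refine tsum_congr fun s => ?_
      have h2 := kernelTerm_liePoint τ z (s, 0) (-θ) (ω : E m)
      rw [kernelTerm] at h2
      simp only [zero_add] at h2
      rw [h2, phase]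
      ring
    rw [polarizedIntegrand, hf, eval_vec_pow_mul I hp c (hsph ω), kernelL, sub_mul, ← hC, ← hN,
      Finset.mul_sum, Finset.mul_sum]
    congr 1
    · refine Finset.sum_congr rfl fun i _ => ?_
      rw [smul_smul, smul_one_mul, smul_smul, e1]
      congr 1; ring
    · refine Finset.sum_congr rfl fun i _ => ?_
      rw [smul_smul, smul_mul_smul_comm, e2]
      congr 1; ring
  have hθ1 : ∀ i ω, Integrable (fun θ => C * (S1 ω θ * g i ω)) thetaMeasure := fun i ω =>
    ((integral_phase_sum hB1 hq1B ω).1.mul_const _).const_mul _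
  have hθ2 : ∀ i ω, Integrable (fun θ => C * (S2 ω θ * g i ω)) thetaMeasure := fun i ω =>
    ((integral_phase_sum hB2 hq2B ω).1.mul_const _).const_mul _
  have hθ : ∀ ω : Metric.sphere (0 : E m) 1,
      HasCliffIntegral thetaMeasure (fun θ => polarizedIntegrand τ f z ω θ)
        (∑ i ∈ I, (∫ θ, C * (S1 ω θ * g i ω) ∂thetaMeasure) • c i -
          ∑ i ∈ I, (∫ θ, C * (S2 ω θ * g i ω) ∂thetaMeasure) • V i) := fun ω => by
    simp only [hintegrand]
    exact (hasCliffIntegral_sum_smul I _ c fun i _ => hθ1 i ω).sub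
      (hasCliffIntegral_sum_smul I _ V fun i _ => hθ2 i ω)
  have hω1 := fun i => sphere_integral_phase_sum hB1 hq1B hq1c hq1n (hgc i) (hgn i)
  have hω2 := fun i => sphere_integral_phase_sum hB2 hq2B (fun s => hq1c (s, 0)) hq2n
    (hgc i) (hgn i)
  have hω : HasCliffIntegral (sphereMeasure m)
      (fun ω => cliffIntegral thetaMeasure fun θ => polarizedIntegrand τ f z ω θ)
      (∑ i ∈ I, (∫ ω, ∫ θ, C * (S1 ω θ * g i ω) ∂thetaMeasure ∂sphereMeasure m) • c i -
        ∑ i ∈ I, (∫ ω, ∫ θ, C * (S2 ω θ * g i ω) ∂thetaMeasure ∂sphereMeasure m) • V i) := by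
    simp only [fun ω => (hθ ω).cliffIntegral_eq]
    refine (hasCliffIntegral_sum_smul I _ c fun i _ => ?_).sub
      (hasCliffIntegral_sum_smul I _ V fun i _ => ?_)
    · simp only [integral_const_mul]; exact (hω1 i).1.const_mul _
    · simp only [integral_const_mul]; exact (hω2 i).1.const_mul _
  refine ⟨⟨fun ω θ hω => ⟨hsum1 ω θ hω, by simpa [kernelTerm] using hsum2 ω θ hω⟩,
    fun ω => ⟨_, hθ ω⟩, ⟨_, hω⟩⟩, ?_⟩
  rw [polarizedHuaRadon, hω.cliffIntegral_eq]
  congr 1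
  · refine Finset.sum_congr rfl fun i _ => ?_
    simp only [integral_const_mul]
    rw [(hω1 i).2, tsum_ite_degree_eq N, mainComponent, Finset.mul_sum, Finset.mul_sum]
    congr 1
    refine Finset.sum_congr rfl fun s hs => ?_
    have hs := Finset.mem_range.1 hs
    rw [hC, integral_kernelTerm hm0 a b z s (N - 2 * s), show N - 2 * s + s = N - s by omega]
  · refine Finset.sum_congr rfl fun i _ => ?_
    simp only [integral_const_mul]
    rw [(hω2 i).2, tsum_ite_two_mul_eq N, diagComponent]
    congr 1
    split_ifs
    · rw [hC, integral_kernelTerm hm0 a b z (N / 2) 0, zero_add]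
    · simp

end Polarized

/-! ### The dual transform and the final eigenvalue. -/

section Dual

open MvPolynomial

variable {m : ℕ}

theorem exists_eval_eq_mainComponent (N n : ℕ) (z : Fin m → ℂ) (H : MvPolynomial (Fin m) ℂ) :
    ∃ R : MvPolynomial (Fin m ⊕ Fin m) ℂ, ∀ x, eval x R = mainComponent N n z H x := by
  choose _ R _ hR _ using fun s => exists_slice (0 : MvPolynomial (Fin m ⊕ Fin m) ℂ →ₗ[ℂ] ℂ)
    (sphAvg m) (kernelPoly (N - s) s z H)
  refine ⟨∑ s ∈ Finset.range (N / 2 + 1), C ((-1) ^ n * (nu m (N - 2 * s) s : ℂ)) * R s,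
    fun x => ?_⟩
  simp only [map_sum, map_mul (eval x), eval_C, hR, mainComponent, mul_assoc]

theorem exists_eval_eq_diagComponent (N n : ℕ) (z : Fin m → ℂ) (H : MvPolynomial (Fin m) ℂ) :
    ∃ R : MvPolynomial (Fin m ⊕ Fin m) ℂ, ∀ x, eval x R = diagComponent N n z H x := by
  obtain ⟨_, R, _, hR, _⟩ := exists_slice (0 : MvPolynomial (Fin m ⊕ Fin m) ℂ →ₗ[ℂ] ℂ)
    (sphAvg m) (kernelPoly (N / 2) (N / 2) z H)
  refine ⟨if Even N then C ((-1) ^ n * (nu m 0 (N / 2) : ℂ)) * R else 0, fun x => ?_⟩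
  unfold diagComponent
  split_ifs
  · rw [map_mul, eval_C, hR, mul_assoc]
  · simp

/-- Changing the sign of s exchanges τ with -τ†. The diagonal kernel has equal powers of both, so it
is symmetric and the signs cancel in pairs. -/
theorem diagComponent_neg (N n : ℕ) (z : Fin m → ℂ) (H : MvPolynomial (Fin m) ℂ) (t s : E m) :
    diagComponent N n z H (Sum.elim (toC t) (toC (-s))) =
      diagComponent N n z H (Sum.elim (toC t) (toC s)) := by
  have h1 : tau t (-s) = -dagger (tau t s) := by
    rw [dagger_tau, tau, toC_neg, smul_neg, neg_add, neg_neg]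
  have h2 : dagger (tau t (-s)) = -tau t s := by
    rw [dagger_tau, tau, toC_neg, smul_neg, neg_add]
  have h3 : ∀ u : Fin m → ℂ, lin (-u) = -lin u := fun u => by simp [lin]
  unfold diagComponent
  simp only [evalL_kernelPoly, tauOf_toC, dagOf_toC, h2]
  simp only [h1, h3, dotProduct_neg]
  split_ifs
  · simp only [← mul_pow, neg_mul_neg]
    rw [mul_comm (z ⬝ᵥ dagger _), mul_comm (lin (tau t s))]
  · rfl

theorem stiefelAvg_mainComponent (hm : 3 ≤ m) {d n : ℕ} (z : Fin m → ℂ)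
    {H : MvPolynomial (Fin m) ℂ} (hH : IsHarmonic d H) {R : MvPolynomial (Fin m ⊕ Fin m) ℂ}
    (hR : ∀ x, eval x R = mainComponent (d + 2 * n) n z H x) :
    stiefelAvg hm R =
      ((∑ s ∈ Finset.Icc n ((d + 2 * n) / 2), nu m (d + 2 * n - 2 * s) s *
        theta m n (d + 2 * n - s) s : ℝ) : ℂ) * ((-(z ⬝ᵥ z)) ^ n * eval z H) := by
  set N := d + 2 * n with hN
  choose _ Q _ hQ _ using fun s => exists_slice (0 : MvPolynomial (Fin m ⊕ Fin m) ℂ →ₗ[ℂ] ℂ)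
    (sphAvg m) (kernelPoly (N - s) s z H)
  have hRQ : R = ∑ s ∈ Finset.range (N / 2 + 1), ((-1) ^ n * (nu m (N - 2 * s) s : ℂ)) • Q s :=
    MvPolynomial.funext fun x => by
      simp only [hR, map_sum, smul_eval, hQ, mainComponent, mul_assoc]
  have hsub : Finset.Icc n (N / 2) ⊆ Finset.range (N / 2 + 1) := fun s hs => by
    have := Finset.mem_Icc.1 hs
    exact Finset.mem_range.2 (by omega)
  rw [hRQ, map_sum, Complex.ofReal_sum, Finset.sum_mul, ← Finset.sum_subset hsub]
  · refine Finset.sum_congr rfl fun s hs => ?_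
    have hs := Finset.mem_Icc.1 hs
    rw [map_smul, stiefelAvg_kernel hm d n (N - s) s (by omega) (by omega) hH z (hQ s),
      if_pos hs.1, smul_eq_mul, neg_pow (z ⬝ᵥ z)]
    push_cast; ring
  · intro s hs hs'
    have hs := Finset.mem_range.1 hs
    have hns : ¬ n ≤ s := fun h => hs' (Finset.mem_Icc.2 ⟨h, by omega⟩)
    rw [map_smul, stiefelAvg_kernel hm d n (N - s) s (by omega) (by omega) hH z (hQ s),
      if_neg hns]
    simp

theorem stiefelAvg_diagComponent (hm : 3 ≤ m) {d n : ℕ} (z : Fin m → ℂ)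
    {H : MvPolynomial (Fin m) ℂ} (hH : IsHarmonic d H) {R : MvPolynomial (Fin m ⊕ Fin m) ℂ}
    (hR : ∀ x, eval x R = diagComponent (d + 2 * n) n z H x) :
    stiefelAvg hm R =
      ((if Even (d + 2 * n) then nu m 0 ((d + 2 * n) / 2) *
        theta m n ((d + 2 * n) / 2) ((d + 2 * n) / 2) else 0 : ℝ) : ℂ) *
          ((-(z ⬝ᵥ z)) ^ n * eval z H) := by
  set N := d + 2 * n with hN
  obtain ⟨_, Q, _, hQ, _⟩ := exists_slice (0 : MvPolynomial (Fin m ⊕ Fin m) ℂ →ₗ[ℂ] ℂ)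
    (sphAvg m) (kernelPoly (N / 2) (N / 2) z H)
  split_ifs with he
  · have hRQ : R = ((-1) ^ n * (nu m 0 (N / 2) : ℂ)) • Q := MvPolynomial.funext fun x => by
      rw [hR, diagComponent, if_pos he, smul_eval, hQ, mul_assoc]
    have hN2 := Nat.even_iff.1 he
    rw [hRQ, map_smul, stiefelAvg_kernel hm d n (N / 2) (N / 2) (by omega) le_rfl hH z hQ,
      if_pos (by omega), smul_eq_mul, neg_pow (z ⬝ᵥ z)]
    push_cast; ring
  · have hR0 : R = 0 := MvPolynomial.funext fun x => by
      rw [hR, diagComponent, if_neg he, map_zero]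
    rw [hR0]; simp

/-- Merges the two parities of t into the form that the averages produce: the factor 1/4 and ϑ = 2θ
combine to 1/2. -/
theorem rho_eq {d n : ℕ} : rho m (d + 2 * n) n =
    (∑ s ∈ Finset.Icc n ((d + 2 * n) / 2), nu m (d + 2 * n - 2 * s) s *
        theta m n (d + 2 * n - s) s) -
      1 / 2 * if Even (d + 2 * n) then nu m 0 ((d + 2 * n) / 2) *
        theta m n ((d + 2 * n) / 2) ((d + 2 * n) / 2) else 0 := by
  set N := d + 2 * n
  unfold rho
  dsimp only
  split_ifs with he
  · have hN := Nat.even_iff.1 he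
    rw [show 2 * (N / 2) = N by omega, vartheta, Nat.mul_div_cancel_left _ two_pos, pow_mul]
    ring
  · have hN := Nat.not_even_iff.1 he
    rw [show 2 * (N / 2) + 1 = N by omega, mul_zero, sub_zero]

theorem vec_eq_sum (u : Fin m → ℂ) : (vec u : Cl m) = ∑ j, u j • e j := by
  have h : u = ∑ j, u j • Pi.single j (1 : ℂ) := by
    ext k; simp [Finset.sum_apply, Pi.single_apply]
  conv_lhs => rw [h]
  simp only [vec, e, map_sum, map_smul]

theorem integral_perpSphere (hm : 3 ≤ m) (t : E m) (p : MvPolynomial (Fin m) ℂ) :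
    ∫ s : perpSphere t, eval (toC (s.1 : E m)) p ∂perpSphereMeasure t =
      (sphereArea (m - 1) : ℂ) * perpAvg t p := by
  have hA : ((sphereArea (m - 1) : ℝ) : ℂ) ≠ 0 := by
    exact_mod_cast (sphereArea_pos (by omega)).ne'
  rw [perpAvg_apply, mul_inv_cancel_left₀ hA]

/-- The dual Radon transform of a function that is given by polynomials in `(t, s)`. -/
theorem dualRadon_eq (hm : 3 ≤ m) {ι : Type*} (I : Finset ι)
    (P : ι → MvPolynomial (Fin m ⊕ Fin m) ℂ) (c : ι → Cl m)
    (F : (Fin m → ℂ) → (Fin m → ℂ) → Cl m) (z : Fin m → ℂ)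
    (hF : ∀ t s : E m, ‖t‖ = 1 → ‖s‖ = 1 → inner ℝ t s = 0 →
      F z (tau t s) = ∑ i ∈ I, eval (Sum.elim (toC t) (toC s)) (P i) • c i) :
    DualRadonConverges F z ∧ dualRadon F z = ∑ i ∈ I, stiefelAvg hm (P i) • c i := by
  have hA : ((sphereArea m : ℝ) : ℂ) ≠ 0 := by exact_mod_cast (sphereArea_pos (by omega)).ne'
  have hA' : ((sphereArea (m - 1) : ℝ) : ℂ) ≠ 0 := by
    exact_mod_cast (sphereArea_pos (by omega)).ne'
  have hin : ∀ t : Metric.sphere (0 : E m) 1,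
      HasCliffIntegral (perpSphereMeasure (t : E m)) (fun s => F z (tau (t : E m) (s.1 : E m)))
        (∑ i ∈ I, ((sphereArea (m - 1) : ℂ) *
          perpAvg (t : E m) (evalL (toC (t : E m)) (P i))) • c i) := fun t => by
    have h : ∀ s : perpSphere (t : E m), F z (tau (t : E m) (s.1 : E m)) =
        ∑ i ∈ I, eval (toC (s.1 : E m)) (evalL (toC (t : E m)) (P i)) • c i := fun s => by
      rw [hF t s.1 (by simp) (mem_sphere_zero_iff_norm.1 s.2)
        (Submodule.mem_orthogonal_singleton_iff_inner_right.1 s.1.2)]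
      simp only [eval_evalL]
    simp only [h, ← integral_perpSphere hm]
    exact hasCliffIntegral_sum_smul I _ c fun i _ => integrable_perpSphere _ (continuous_eval_toC _)
  have hout : HasCliffIntegral (sphereMeasure m) (fun t : Metric.sphere (0 : E m) 1 =>
      cliffIntegral (perpSphereMeasure (t : E m)) fun s => F z (tau (t : E m) (s.1 : E m)))
      (∑ i ∈ I, (∫ t : Metric.sphere (0 : E m) 1, (sphereArea (m - 1) : ℂ) *
          perpAvg (t : E m) (evalL (toC (t : E m)) (P i)) ∂sphereMeasure m) • c i) := by
    simp only [fun t => (hin t).cliffIntegral_eq]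
    exact hasCliffIntegral_sum_smul I _ c fun i _ => (integrable_perpAvg hm (P i)).const_mul _
  refine ⟨⟨fun t => ⟨_, hin t⟩, ⟨_, hout⟩⟩, ?_⟩
  rw [dualRadon, hout.cliffIntegral_eq, Finset.smul_sum]
  refine Finset.sum_congr rfl fun i _ => ?_
  rw [smul_smul, integral_const_mul, stiefelAvg_apply]
  congr 1
  push_cast
  field_simp

/-- Polynomials that are odd in `s` have mean zero. -/
theorem stiefelAvg_eq_zero_of_odd (hm : 3 ≤ m) {p : MvPolynomial (Fin m ⊕ Fin m) ℂ}
    (h : ∀ t s : E m, eval (Sum.elim (toC t) (toC (-s))) p =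
      -eval (Sum.elim (toC t) (toC s)) p) : stiefelAvg hm p = 0 := by
  have h2 : stiefelAvg hm p = stiefelAvg hm (-p) := stiefelAvg_congr hm fun t _ =>
    perpAvg_comp_neg fun s => by rw [eval_evalL, eval_evalL, h, map_neg]
  rw [map_neg] at h2
  exact self_eq_neg.1 h2

theorem dualRadon_polarizedHuaRadon (hm : 3 ≤ m) {ι : Type*} (I : Finset ι) {d n : ℕ}
    {p : ι → MvPolynomial (Fin m) ℂ} (hp : ∀ i, IsHarmonic d (p i)) (c : ι → Cl m)
    {f : (Fin m → ℂ) → Cl m}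
    (hf : ∀ z, f z = vec z ^ (2 * n) * CliffPoly.eval (∑ i ∈ I, p i ⊗ₜ[ℂ] c i) z)
    {z : Fin m → ℂ} (hz : z ∈ lieBall m) :
    DualRadonConverges (fun z τ => polarizedHuaRadon τ f z) z ∧
      dualRadon (fun z τ => polarizedHuaRadon τ f z) z = (rho m (d + 2 * n) n : ℂ) • f z := by
  set N := d + 2 * n with hN
  choose R₁ hR₁ using fun i => exists_eval_eq_mainComponent N n z (p i)
  choose R₂ hR₂ using fun i => exists_eval_eq_diagComponent N n z (p i)
  -- With τ†τ/4 = 1/2 + (i/2) st, the bivector st is expanded in the products e_j e_k with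
  -- coefficients s_j t_k. These are odd in s while the diagonal component is even, so every `W x`
  -- has mean zero. The scalar 1/2 is kept with the main term.
  let W : ι × Fin m × Fin m → MvPolynomial (Fin m ⊕ Fin m) ℂ := fun x =>
    -(C (Complex.I / 2) * X (Sum.inr x.2.1) * X (Sum.inl x.2.2) * R₂ x.1)
  have hW : ∀ x, stiefelAvg hm (W x) = 0 := fun x => by
    refine stiefelAvg_eq_zero_of_odd hm fun t s => ?_
    simp only [W, map_neg, map_mul (eval _), eval_C, eval_X, hR₂, diagComponent_neg, Sum.elim_inl,
      Sum.elim_inr]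
    rw [toC_neg, Pi.neg_apply]
    ring
  obtain ⟨h1, h2⟩ := dualRadon_eq hm (I.disjSum (I ×ˢ Finset.univ))
    (Sum.elim (fun i => R₁ i - C (1 / 2) * R₂ i) W)
    (Sum.elim c fun x => e x.2.1 * e x.2.2 * c x.1)
    (fun z τ => polarizedHuaRadon τ f z) z fun t s ht hs hts => by
      rw [(polarizedHuaRadon_eq hm I (fun i => (hp i).1) c hf hz ht hs hts).2,
        Finset.sum_disjSum, vec_dagger_tau_mul_vec_tau ht hs hts, Finset.sum_product,
        ← Finset.sum_sub_distrib, ← Finset.sum_add_distrib]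
      refine Finset.sum_congr rfl fun i _ => ?_
      simp only [Sum.elim_inl, Sum.elim_inr, W, map_sub, map_neg, map_mul (eval _), eval_C, eval_X,
        hR₁, hR₂, ← hN]
      have hV : vec (toC s) * vec (toC t) * c i =
          ∑ x : Fin m × Fin m, (toC s x.1 * toC t x.2) • (e x.1 * e x.2 * c i) := by
        rw [vec_eq_sum, vec_eq_sum, Finset.sum_mul_sum, Finset.sum_mul, Fintype.sum_prod_type]
        refine Finset.sum_congr rfl fun j _ => ?_
        rw [Finset.sum_mul]
        refine Finset.sum_congr rfl fun k _ => ?_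
        rw [smul_mul_smul_comm, smul_mul_assoc]
      have hsum : ∑ x : Fin m × Fin m, -(Complex.I / 2 * toC s x.1 * toC t x.2 *
            diagComponent N n z (p i) (Sum.elim (toC t) (toC s))) • (e x.1 * e x.2 * c i) =
          -(Complex.I / 2 * diagComponent N n z (p i) (Sum.elim (toC t) (toC s))) •
            (vec (toC s) * vec (toC t) * c i) := by
        rw [hV, Finset.smul_sum]
        refine Finset.sum_congr rfl fun x _ => ?_
        rw [smul_smul]
        congr 1; ring
      rw [hsum, smul_mul_assoc, add_mul, smul_mul_assoc, smul_mul_assoc, one_mul]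
      module
  refine ⟨h1, h2.trans ?_⟩
  rw [Finset.sum_disjSum]
  simp only [Sum.elim_inl, Sum.elim_inr, hW, zero_smul, Finset.sum_const_zero, add_zero]
  rw [hf, vec_pow_two_mul, eval_sum_tmul, smul_one_mul, Finset.smul_sum, Finset.smul_sum]
  refine Finset.sum_congr rfl fun i _ => ?_
  rw [smul_smul, smul_smul, map_sub, ← smul_eq_C_mul, map_smul,
    stiefelAvg_mainComponent hm z (hp i) (hR₁ i), stiefelAvg_diagComponent hm z (hp i) (hR₂ i),
    hN, rho_eq]
  congr 1
  push_cast
  rw [smul_eq_mul]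
  ring

end Dual

end HuaRadon
end

theorem mainTheorem7 (m t n : ℕ) (hm : 3 ≤ m) (hn : 2 * n ≤ t)
    (M : HuaRadon.CliffPoly m) (hM : M ∈ HuaRadon.sphericalMonogenics m (t - 2 * n))
    (f : (Fin m → ℂ) → HuaRadon.Cl m)
    (hf : ∀ z, f z = HuaRadon.vec z ^ (2 * n) * M.eval z)
    (z : Fin m → ℂ) (hz : z ∈ HuaRadon.lieBall m) :
    (∀ p ∈ HuaRadon.stiefel m,
      HuaRadon.PolarizedHuaRadonConverges (HuaRadon.tau p.1 p.2) f z) ∧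
    HuaRadon.DualRadonConverges (fun z τ => HuaRadon.polarizedHuaRadon τ f z) z ∧
    HuaRadon.dualRadon (fun z τ => HuaRadon.polarizedHuaRadon τ f z) z =
      (HuaRadon.rho m t n : ℂ) • f z := by
  obtain ⟨d, rfl⟩ := Nat.exists_eq_add_of_le' hn
  rw [Nat.add_sub_cancel] at hM
  obtain ⟨ι, I, p, c, hp, rfl⟩ := HuaRadon.exists_harmonic_decomposition hM
  exact ⟨fun x hx => (HuaRadon.polarizedHuaRadon_eq hm I (fun i => (hp i).1) c hf hz
    hx.1 hx.2.1 hx.2.2).1, HuaRadon.dualRadon_polarizedHuaRadon hm I hp c hf hz⟩
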